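/- Let $\mathcal F$ be a non-trivial minor-closed family of finite simple graphs, i.e. $\mathcal F$ contains every minor of each of its members and is not the family of all finite graphs, and let $k\ge 3$ be fixed. Then there are a randomized algorithm and a constant $C$, both depending only on $\mathcal F$ and $k$, such that the following holds for every $n$ and every $n$-vertex graph $G\in\mathcal F$ that contains an induced cycle of size $k$. Given $G$ by adjacency lists (with the neighbours in each list in any order), the algorithm halts with probability $1$; whenever it halts, it outputs the vertices, in cyclic order, of an induced cycle of size $k$ in $G$; and its expected running time is at most $Cn$, i.e. $O(n)$. The running time is the number of steps of a random access machine with fair coin tosses and unit cost for each instruction and each comparison. The arithmetic instructions may be restricted to successor and predecessor, so that all stored numbers exceed the largest number in the input and in the program by at most the number of steps. -/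

import Mathlib

open MeasureTheory

/-! ### Minor-closed families of finite graphs -/

/-- `H` is a minor of `G`: there are pairwise disjoint (nonempty) connected branch sets `B w` in
`G`, one for each vertex `w` of `H`, such that every edge of `H` is witnessed by an edge of `G`
between the two corresponding branch sets. Equivalently, `H` arises, up to isomorphism, from a
subgraph of `G` by contracting each branch set to a single vertex. -/
def IsGraphMinor {W V : Type*} (H : SimpleGraph W) (G : SimpleGraph V) : Prop :=
  ∃ B : W → Set V,
    (∀ w, (G.induce (B w)).Connected) ∧
    (∀ w w', w ≠ w' → Disjoint (B w) (B w')) ∧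
    (∀ w w', H.Adj w w' → ∃ v ∈ B w, ∃ v' ∈ B w', G.Adj v v')

/-- A family of finite graphs, given by its members on the vertex sets `{0, …, n - 1}`. -/
abbrev GraphFamily : Type := (n : ℕ) → Set (SimpleGraph (Fin n))

/-- The family contains all minors of its members; in particular it is closed under isomorphism,
because a graph is a minor of every graph isomorphic to it. -/
def GraphFamily.MinorClosed (F : GraphFamily) : Prop :=
  ∀ (n m : ℕ) (G : SimpleGraph (Fin n)) (H : SimpleGraph (Fin m)),
    G ∈ F n → IsGraphMinor H G → H ∈ F m

/-- The family does not consist of all finite graphs. -/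
def GraphFamily.Nontrivial (F : GraphFamily) : Prop :=
  ∃ (m : ℕ) (H : SimpleGraph (Fin m)), H ∉ F m

/-! ### Randomized random access machines with uniform cost

The machine has number registers and random access memory, which is divided into arrays of
natural numbers; a program mentions only finitely many registers and arrays. The only arithmetic
operations are successor and predecessor, so that after `t` steps no stored number
exceeds the largest number in the input and in the program by more than `t`; for this reason it is
fair to charge one unit of time for every instruction. -/

namespace RAM

/-- Elementary instructions. Registers and arrays are named by natural numbers. -/
inductive Instr : Type
  /-- Do nothing. -/
  | skip : Instr
  /-- Set register `x` to the constant `c`. -/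
  | const (x c : ℕ) : Instr
  /-- Set register `x` to the content of register `y`. -/
  | copy (x y : ℕ) : Instr
  /-- Increase register `x` by one. -/
  | inc (x : ℕ) : Instr
  /-- Decrease register `x` by one (zero stays zero). -/
  | dec (x : ℕ) : Instr
  /-- Set register `x` to the entry of array `a` whose index is in register `y`. -/
  | load (x a y : ℕ) : Instr
  /-- Set the entry of array `a` whose index is in register `y` to the content of register `x`. -/
  | store (a y x : ℕ) : Instr
  /-- Toss a fair coin and set register `x` to the outcome, `0` or `1`. -/
  | toss (x : ℕ) : Instr

/-- Comparisons between two registers. -/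
inductive Test : Type
  | eq (x y : ℕ) : Test
  | lt (x y : ℕ) : Test

/-- Programs. `loop b p` is the loop "while `b` do `p`". -/
inductive Prog : Type
  | instr (i : Instr) : Prog
  | seq (p q : Prog) : Prog
  | cond (b : Test) (p q : Prog) : Prog
  | loop (b : Test) (p : Prog) : Prog

/-- Contents of the registers and of the arrays, and the number of coins tossed so far. -/
structure State : Type where
  reg : ℕ → ℕ
  mem : ℕ → ℕ → ℕ
  coins : ℕ

/-- The effect of an instruction, when `ω i` is the outcome of the `i`-th coin toss. -/
def Instr.exec (ω : ℕ → Bool) : Instr → State → State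
  | skip, σ => σ
  | const x c, σ => { σ with reg := Function.update σ.reg x c }
  | copy x y, σ => { σ with reg := Function.update σ.reg x (σ.reg y) }
  | inc x, σ => { σ with reg := Function.update σ.reg x (σ.reg x + 1) }
  | dec x, σ => { σ with reg := Function.update σ.reg x (σ.reg x - 1) }
  | load x a y, σ => { σ with reg := Function.update σ.reg x (σ.mem a (σ.reg y)) }
  | store a y x, σ =>
      { σ with mem := Function.update σ.mem a (Function.update (σ.mem a) (σ.reg y) (σ.reg x)) }
  | toss x, σ =>
      { σ with reg := Function.update σ.reg x (ω σ.coins).toNat, coins := σ.coins + 1 }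

/-- The outcome of a comparison. -/
def Test.Holds : Test → State → Prop
  | eq x y, σ => σ.reg x = σ.reg y
  | lt x y, σ => σ.reg x < σ.reg y

/-- `Runs ω p σ σ' t`: with coin tosses `ω`, the program `p` started in the state `σ` halts in the
state `σ'` after exactly `t` steps. Every instruction and every evaluation of a comparison is one
step. -/
inductive Runs (ω : ℕ → Bool) : Prog → State → State → ℕ → Prop
  | instr (i : Instr) (σ : State) : Runs ω (.instr i) σ (i.exec ω σ) 1
  | seq {p q : Prog} {σ σ' σ'' : State} {s t : ℕ} (hp : Runs ω p σ σ' s)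
      (hq : Runs ω q σ' σ'' t) : Runs ω (.seq p q) σ σ'' (s + t)
  | condTrue {b : Test} {p q : Prog} {σ σ' : State} {t : ℕ} (hb : b.Holds σ)
      (hp : Runs ω p σ σ' t) : Runs ω (.cond b p q) σ σ' (t + 1)
  | condFalse {b : Test} {p q : Prog} {σ σ' : State} {t : ℕ} (hb : ¬ b.Holds σ)
      (hq : Runs ω q σ σ' t) : Runs ω (.cond b p q) σ σ' (t + 1)
  | loopFalse {b : Test} {p : Prog} {σ : State} (hb : ¬ b.Holds σ) : Runs ω (.loop b p) σ σ 1
  | loopTrue {b : Test} {p : Prog} {σ σ' σ'' : State} {s t : ℕ} (hb : b.Holds σ)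
      (hp : Runs ω p σ σ' s) (hl : Runs ω (.loop b p) σ' σ'' t) :
      Runs ω (.loop b p) σ σ'' (s + t + 1)

/-- For given coin tosses the machine is deterministic. -/
theorem Runs.det {ω : ℕ → Bool} {p : Prog} {σ σ₁ σ₂ : State} {t₁ t₂ : ℕ}
    (h₁ : Runs ω p σ σ₁ t₁) (h₂ : Runs ω p σ σ₂ t₂) : σ₁ = σ₂ ∧ t₁ = t₂ := by
  induction h₁ generalizing σ₂ t₂ with
  | instr i σ => cases h₂; exact ⟨rfl, rfl⟩
  | seq _ _ ihp ihq =>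
    cases h₂ with
    | seq hp' hq' =>
      obtain ⟨rfl, rfl⟩ := ihp hp'
      obtain ⟨rfl, rfl⟩ := ihq hq'
      exact ⟨rfl, rfl⟩
  | condTrue hb _ ih =>
    cases h₂ with
    | condTrue _ h => obtain ⟨rfl, rfl⟩ := ih h; exact ⟨rfl, rfl⟩
    | condFalse hb' _ => exact absurd hb hb'
  | condFalse hb _ ih =>
    cases h₂ with
    | condTrue hb' _ => exact absurd hb' hb
    | condFalse _ h => obtain ⟨rfl, rfl⟩ := ih h; exact ⟨rfl, rfl⟩
  | loopFalse hb =>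
    cases h₂ with
    | loopFalse _ => exact ⟨rfl, rfl⟩
    | loopTrue hb' _ _ => exact absurd hb' hb
  | loopTrue hb _ _ ihp ihl =>
    cases h₂ with
    | loopFalse hb' => exact absurd hb hb'
    | loopTrue _ hp' hl' =>
      obtain ⟨rfl, rfl⟩ := ihp hp'
      obtain ⟨rfl, rfl⟩ := ihl hl'
      exact ⟨rfl, rfl⟩

theorem Runs.coins_le {ω : ℕ → Bool} {p : Prog} {σ σ' : State} {t : ℕ}
    (h : Runs ω p σ σ' t) : σ.coins ≤ σ'.coins ∧ σ'.coins ≤ σ.coins + t := by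
  induction h with
  | instr i σ => cases i <;> simp [Instr.exec]
  | seq _ _ _ _ => omega
  | condTrue _ _ _ => omega
  | condFalse _ _ _ => omega
  | loopFalse _ => omega
  | loopTrue _ _ _ _ _ => omega

/-- A run depends only on the coins that were tossed in it. -/
theorem Runs.congr {ω ω' : ℕ → Bool} {p : Prog} {σ σ' : State} {t : ℕ}
    (h : Runs ω p σ σ' t) (hω : ∀ i < σ'.coins, ω i = ω' i) : Runs ω' p σ σ' t := by
  induction h with
  | instr i σ =>
    have hi : i.exec ω σ = i.exec ω' σ := by
      cases i with
      | toss x =>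
        have := hω σ.coins (by simp [Instr.exec])
        simp [Instr.exec, this]
      | _ => rfl
    rw [hi]
    exact .instr i σ
  | seq _ hq ihp ihq =>
    exact .seq (ihp fun i hi => hω i (hi.trans_le hq.coins_le.1)) (ihq hω)
  | condTrue hb _ ih => exact .condTrue hb (ih hω)
  | condFalse hb _ ih => exact .condFalse hb (ih hω)
  | loopFalse hb => exact .loopFalse hb
  | loopTrue hb _ hl ihp ihl =>
    exact .loopTrue hb (ihp fun i hi => hω i (hi.trans_le hl.coins_le.1)) (ihl hω)

/-- The number of steps after which the program halts, or `⊤` if it does not halt. -/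
noncomputable def runTime (p : Prog) (σ : State) (ω : ℕ → Bool) : ℕ∞ :=
  ⨅ (t : ℕ) (_ : ∃ σ', Runs ω p σ σ' t), (t : ℕ∞)

theorem Runs.runTime_eq {ω : ℕ → Bool} {p : Prog} {σ σ' : State} {t : ℕ}
    (h : Runs ω p σ σ' t) : runTime p σ ω = t := by
  refine le_antisymm (iInf₂_le t ⟨σ', h⟩) (le_iInf₂ ?_)
  rintro s ⟨σ'', hs⟩
  rw [(h.det hs).2]

/-- The law of a sequence of independent tosses of a fair coin. -/
noncomputable def coinMeasure : Measure (ℕ → Bool) :=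
  Measure.infinitePi fun _ => (PMF.uniformOfFintype Bool).toMeasure

instance : IsProbabilityMeasure coinMeasure := by
  unfold coinMeasure; infer_instance

theorem measurableSet_halts (p : Prog) (σ : State) (t : ℕ) :
    MeasurableSet {ω : ℕ → Bool | ∃ σ', Runs ω p σ σ' t} := by
  apply IsOpen.measurableSet
  rw [isOpen_iff_mem_nhds]
  rintro ω ⟨σ', h⟩
  have hU : IsOpen (Set.pi (Set.Iio σ'.coins) fun i => ({ω i} : Set Bool)) :=
    isOpen_set_pi (Set.finite_Iio _) fun _ _ => isOpen_discrete _
  refine Filter.mem_of_superset (hU.mem_nhds fun i _ => rfl) fun ω' hω' => ⟨σ', h.congr ?_⟩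
  intro i hi
  exact (hω' i hi).symm

/-- The running time is a random variable. -/
theorem measurable_runTime (p : Prog) (σ : State) : Measurable (runTime p σ) := by
  have hfin : ∀ t : ℕ, runTime p σ ⁻¹' {(t : ℕ∞)} = {ω | ∃ σ', Runs ω p σ σ' t} := by
    intro t
    ext ω
    constructor
    · intro h
      by_cases hh : ∃ s σ', Runs ω p σ σ' s
      · obtain ⟨s, σ', hs⟩ := hh
        have h' : runTime p σ ω = t := h
        rw [hs.runTime_eq] at h'
        obtain rfl : s = t := by exact_mod_cast h'
        exact ⟨σ', hs⟩
      · have h' : runTime p σ ω = t := h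
        have htop : runTime p σ ω = ⊤ :=
          iInf_eq_top.2 fun s => iInf_eq_top.2 fun hs => absurd ⟨s, hs⟩ hh
        rw [htop] at h'
        exact absurd h'.symm (ENat.natCast_ne_top t)
    · rintro ⟨σ', h⟩
      exact h.runTime_eq
  have hm : ∀ t : ℕ, MeasurableSet (runTime p σ ⁻¹' {(t : ℕ∞)}) := fun t => by
    rw [hfin t]; exact measurableSet_halts p σ t
  refine measurable_to_countable' fun x => ?_
  induction x using ENat.recTopCoe with
  | coe t => exact hm t
  | top =>
    have : runTime p σ ⁻¹' {⊤} = (⋃ t : ℕ, runTime p σ ⁻¹' {(t : ℕ∞)})ᶜ := by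
      ext ω
      cases hω : runTime p σ ω using ENat.recTopCoe <;> simp [hω]
    rw [this]
    exact (MeasurableSet.iUnion hm).compl

/-- The expected number of steps. -/
noncomputable def expectedTime (p : Prog) (σ : State) : ENNReal :=
  ∫⁻ ω, (runTime p σ ω : ENNReal) ∂coinMeasure

end RAM

/-! ### Input and output -/

/-- `adj` lists, in some order and without repetition, the neighbours of each vertex of `G`. -/
def IsAdjacencyList {n : ℕ} (G : SimpleGraph (Fin n)) (adj : Fin n → List (Fin n)) : Prop :=
  ∀ v, (adj v).Nodup ∧ ∀ w, w ∈ adj v ↔ G.Adj v w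

/-- The initial state of a machine whose input is a graph on `{0, …, n - 1}` given by adjacency
lists. Register `0` holds `n`; array `1` holds the concatenation of the adjacency lists of the
vertices `0, …, n - 1`; for `v ≤ n` the `v`-th entry of array `0` is the total length of the lists
of the vertices smaller than `v`, so that the list of `v` occupies the entries of array `1` from
position `mem 0 v` to just before position `mem 0 (v + 1)`. All other registers and arrays are
zero. -/
def inputState {n : ℕ} (adj : Fin n → List (Fin n)) : RAM.State where
  reg := fun x => if x = 0 then n else 0
  mem := fun a i =>
    if a = 0 then (((List.ofFn adj).take i).map List.length).sum
    else if a = 1 then ((List.ofFn adj).flatten.map Fin.val).getD i 0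
    else 0
  coins := 0

/-- The first `k` entries of array `2` are the vertices, in cyclic order, of an induced cycle of
size `k` in `G`. -/
def OutputsInducedCycle {n : ℕ} (G : SimpleGraph (Fin n)) (k : ℕ) (σ : RAM.State) : Prop :=
  ∃ f : SimpleGraph.cycleGraph k ↪g G, ∀ i : Fin k, σ.mem 2 i = (f i : ℕ)

namespace RAM

/-! ### A total-correctness calculus for random access machines -/

instance (b : Test) (σ : State) : Decidable (b.Holds σ) := by
  cases b <;> unfold Test.Holds <;> infer_instance

/-- The register that an instruction may change is `x`. -/
def Instr.WritesReg : Instr → ℕ → Prop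
  | skip, _ => False
  | const x _, r => r = x
  | copy x _, r => r = x
  | inc x, r => r = x
  | dec x, r => r = x
  | load x _ _, r => r = x
  | store _ _ _, _ => False
  | toss x, r => r = x

/-- The array that an instruction may change is `a`. -/
def Instr.WritesMem : Instr → ℕ → Prop
  | store a _ _, r => r = a
  | _, _ => False

def Instr.Tosses : Instr → Prop
  | toss _ => True
  | _ => False

def Prog.WritesReg : Prog → ℕ → Prop
  | instr i, r => i.WritesReg r
  | seq p q, r => p.WritesReg r ∨ q.WritesReg r
  | cond _ p q, r => p.WritesReg r ∨ q.WritesReg r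
  | loop _ p, r => p.WritesReg r

def Prog.WritesMem : Prog → ℕ → Prop
  | instr i, r => i.WritesMem r
  | seq p q, r => p.WritesMem r ∨ q.WritesMem r
  | cond _ p q, r => p.WritesMem r ∨ q.WritesMem r
  | loop _ p, r => p.WritesMem r

def Prog.Tosses : Prog → Prop
  | instr i => i.Tosses
  | seq p q => p.Tosses ∨ q.Tosses
  | cond _ p q => p.Tosses ∨ q.Tosses
  | loop _ p => p.Tosses

/-- Two states agree outside the registers and arrays that the program may change. -/
structure Agree (p : Prog) (σ σ' : State) : Prop where
  reg : ∀ r, ¬ p.WritesReg r → σ'.reg r = σ.reg r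
  mem : ∀ a, ¬ p.WritesMem a → σ'.mem a = σ.mem a
  coins : ¬ p.Tosses → σ'.coins = σ.coins

theorem Agree.refl (p : Prog) (σ : State) : Agree p σ σ := ⟨fun _ _ => rfl, fun _ _ => rfl, fun _ => rfl⟩

theorem Agree.trans {p : Prog} {σ σ' σ'' : State} (h : Agree p σ σ') (h' : Agree p σ' σ'') :
    Agree p σ σ'' :=
  ⟨fun r hr => (h'.reg r hr).trans (h.reg r hr), fun r hr => (h'.mem r hr).trans (h.mem r hr),
    fun hc => (h'.coins hc).trans (h.coins hc)⟩

theorem Agree.mono {p q : Prog} {σ σ' : State} (h : Agree p σ σ')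
    (hr : ∀ r, p.WritesReg r → q.WritesReg r) (hm : ∀ r, p.WritesMem r → q.WritesMem r)
    (hc : p.Tosses → q.Tosses) : Agree q σ σ' :=
  ⟨fun r h1 => h.reg r fun h2 => h1 (hr r h2), fun r h1 => h.mem r fun h2 => h1 (hm r h2),
    fun h1 => h.coins fun h2 => h1 (hc h2)⟩

theorem Runs.agree {ω : ℕ → Bool} {p : Prog} {σ σ' : State} {t : ℕ}
    (h : Runs ω p σ σ' t) : Agree p σ σ' := by
  induction h with
  | instr i σ =>
    refine ⟨fun r hr => ?_, fun a ha => ?_, fun hc => ?_⟩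
    · cases i <;> simp_all [Prog.WritesReg, Instr.WritesReg, Instr.exec]
    · cases i <;> simp_all [Prog.WritesMem, Instr.WritesMem, Instr.exec]
    · cases i <;> simp_all [Prog.Tosses, Instr.Tosses, Instr.exec]
  | seq _ _ ihp ihq =>
    exact (ihp.mono (fun _ => Or.inl) (fun _ => Or.inl) Or.inl).trans
      (ihq.mono (fun _ => Or.inr) (fun _ => Or.inr) Or.inr)
  | condTrue _ _ ih => exact ih.mono (fun _ => Or.inl) (fun _ => Or.inl) Or.inl
  | condFalse _ _ ih => exact ih.mono (fun _ => Or.inr) (fun _ => Or.inr) Or.inr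
  | loopFalse _ => exact .refl _ _
  | loopTrue _ _ _ ihp ihl => exact Agree.trans ⟨ihp.reg, ihp.mem, ihp.coins⟩ ihl

/-- The program halts after at most `T` steps in a state that satisfies `Q`. -/
def Ends (ω : ℕ → Bool) (p : Prog) (σ : State) (T : ℕ) (Q : State → Prop) : Prop :=
  ∃ σ' t, Runs ω p σ σ' t ∧ t ≤ T ∧ Q σ'

theorem Ends.mono {ω : ℕ → Bool} {p : Prog} {σ : State} {T T' : ℕ} {Q Q' : State → Prop}
    (h : Ends ω p σ T Q) (hT : T ≤ T') (hQ : ∀ σ', Agree p σ σ' → Q σ' → Q' σ') :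
    Ends ω p σ T' Q' := by
  obtain ⟨σ', t, hr, ht, hQ'⟩ := h
  exact ⟨σ', t, hr, ht.trans hT, hQ _ hr.agree hQ'⟩

theorem Ends.seq {ω : ℕ → Bool} {p q : Prog} {σ : State} {T T' : ℕ} {Q R : State → Prop}
    (h : Ends ω p σ T Q) (h' : ∀ σ', Agree p σ σ' → Q σ' → Ends ω q σ' T' R) :
    Ends ω (.seq p q) σ (T + T') R := by
  obtain ⟨σ', t, hr, ht, hQ⟩ := h
  obtain ⟨σ'', t', hr', ht', hR⟩ := h' σ' hr.agree hQ
  exact ⟨σ'', t + t', hr.seq hr', by omega, hR⟩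

/-- Programs without loops. -/
def Prog.LoopFree : Prog → Prop
  | .instr _ => True
  | .seq p q => p.LoopFree ∧ q.LoopFree
  | .cond _ p q => p.LoopFree ∧ q.LoopFree
  | .loop _ _ => False

/-- The effect of a program without loops. -/
def Prog.eval (ω : ℕ → Bool) : Prog → State → State
  | .instr i, σ => i.exec ω σ
  | .seq p q, σ => q.eval ω (p.eval ω σ)
  | .cond b p q, σ => if b.Holds σ then p.eval ω σ else q.eval ω σ
  | .loop _ _, σ => σ

/-- A bound for the number of steps of a program without loops. -/
def Prog.size : Prog → ℕ
  | .instr _ => 1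
  | .seq p q => p.size + q.size
  | .cond _ p q => p.size + q.size + 1
  | .loop _ _ => 0

theorem Prog.LoopFree.ends {ω : ℕ → Bool} {p : Prog} (hp : p.LoopFree) {σ : State}
    {Q : State → Prop} (hQ : Q (p.eval ω σ)) : Ends ω p σ p.size Q := by
  suffices h : ∃ t ≤ p.size, Runs ω p σ (p.eval ω σ) t by
    obtain ⟨t, ht, hr⟩ := h
    exact ⟨_, t, hr, ht, hQ⟩
  clear hQ
  induction p generalizing σ with
  | instr i => exact ⟨1, le_rfl, .instr i σ⟩
  | seq p q ihp ihq =>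
    obtain ⟨s, hs, h⟩ := ihp hp.1 (σ := σ)
    obtain ⟨t, ht, h'⟩ := ihq hp.2 (σ := p.eval ω σ)
    exact ⟨s + t, by simp only [size]; omega, h.seq h'⟩
  | cond b p q ihp ihq =>
    by_cases hb : b.Holds σ
    · obtain ⟨s, hs, h⟩ := ihp hp.1 (σ := σ)
      refine ⟨s + 1, by simp only [size]; omega, ?_⟩
      simp only [eval, hb, if_true]
      exact .condTrue hb h
    · obtain ⟨s, hs, h⟩ := ihq hp.2 (σ := σ)
      refine ⟨s + 1, by simp only [size]; omega, ?_⟩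
      simp only [eval, hb, if_false]
      exact .condFalse hb h
  | loop b p => exact hp.elim

/-- Loops with a potential that pays for the running time. -/
theorem Ends.loop {ω : ℕ → Bool} {b : Test} {p : Prog} {σ : State} (I : State → Prop)
    (Φ : State → ℕ)
    (hstep : ∀ σ', Agree p σ σ' → I σ' → b.Holds σ' →
      ∃ T, Ends ω p σ' T fun σ'' => I σ'' ∧ T + 1 + Φ σ'' ≤ Φ σ')
    (h0 : I σ) : Ends ω (.loop b p) σ (Φ σ + 1) fun σ' => I σ' ∧ ¬ b.Holds σ' := by
  suffices h : ∀ m, ∀ σ', Agree p σ σ' → I σ' → Φ σ' ≤ m →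
      Ends ω (.loop b p) σ' (Φ σ' + 1) fun σ' => I σ' ∧ ¬ b.Holds σ' from
    h _ σ (.refl _ _) h0 le_rfl
  intro m
  induction m with
  | zero =>
    intro σ' ha hI hm
    by_cases hb : b.Holds σ'
    · obtain ⟨T, σ'', t, _, _, _, h⟩ := hstep σ' ha hI hb
      omega
    · exact ⟨σ', 1, .loopFalse hb, by omega, hI, hb⟩
  | succ m ih =>
    intro σ' ha hI hm
    by_cases hb : b.Holds σ'
    · obtain ⟨T, σ'', t, hr, ht, hI', h⟩ := hstep σ' ha hI hb
      obtain ⟨σ₃, t', hr', ht', hQ⟩ := ih σ'' (ha.trans hr.agree) hI' (by omega)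
      exact ⟨σ₃, t + t' + 1, .loopTrue hb hr hr', by omega, hQ⟩
    · exact ⟨σ', 1, .loopFalse hb, by omega, hI, hb⟩

infixr:60 " ;; " => Prog.seq

/-- `for i = 0, …, N - 1 do p`, where `i` and `N` are registers. -/
def forLoop (i N : ℕ) (p : Prog) : Prog :=
  .instr (.const i 0) ;; .loop (.lt i N) (p ;; .instr (.inc i))

/-- The state with another value in one register. -/
def State.setReg (σ : State) (i m : ℕ) : State := { σ with reg := Function.update σ.reg i m }

theorem Ends.forLoop {ω : ℕ → Bool} {i N : ℕ} {p : Prog} {σ : State} (I : ℕ → State → Prop)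
    (hp : p.LoopFree) (hi : ¬ p.WritesReg i) (hN : ¬ p.WritesReg N) (hiN : N ≠ i)
    (h0 : I 0 (σ.setReg i 0))
    (hstep : ∀ m σ', Agree (forLoop i N p) σ σ' → σ'.reg i = m → m < σ.reg N → I m σ' →
      I (m + 1) ((p.eval ω σ').setReg i (m + 1))) :
    Ends ω (forLoop i N p) σ ((p.size + 2) * σ.reg N + 2) (I (σ.reg N)) := by
  have hinit : Ends ω (.instr (.const i 0)) σ 1 fun σ' => σ' = σ.setReg i 0 :=
    Prog.LoopFree.ends (p := .instr (.const i 0)) trivial rfl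
  have hsub : ∀ σ', Agree (p ;; .instr (.inc i)) (σ.setReg i 0) σ' → Agree (RAM.forLoop i N p) σ σ' := by
    intro σ' h
    have h1 : Agree (RAM.forLoop i N p) σ (σ.setReg i 0) := by
      refine ⟨fun r hr => ?_, fun _ _ => rfl, fun _ => rfl⟩
      simp only [RAM.forLoop, Prog.WritesReg, Instr.WritesReg, not_or] at hr
      simp [State.setReg, hr.1]
    exact h1.trans (h.mono (fun _ => Or.inr) (fun _ => Or.inr) Or.inr)
  have hmain : Ends ω (.loop (.lt i N) (p ;; .instr (.inc i))) (σ.setReg i 0)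
      ((p.size + 2) * σ.reg N + 1) (I (σ.reg N)) := by
    have := Ends.loop (ω := ω) (b := .lt i N) (p := p ;; .instr (.inc i)) (σ := σ.setReg i 0)
      (fun σ' => I (σ'.reg i) σ' ∧ σ'.reg i ≤ σ.reg N)
      (fun σ' => (p.size + 2) * (σ.reg N - σ'.reg i)) ?_ ?_
    · refine this.mono ?_ ?_
      · simp [State.setReg]
      · rintro σ' ha ⟨⟨hI, hle⟩, hb⟩
        have hN' : σ'.reg N = σ.reg N := by
          rw [ha.reg N (by simp [Prog.WritesReg, Instr.WritesReg, hN, hiN])]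
          simp [State.setReg, hiN]
        have hb' : ¬ σ'.reg i < σ'.reg N := hb
        have : σ'.reg i = σ.reg N := by omega
        rwa [this] at hI
    · rintro σ' ha ⟨hI, hle⟩ hb
      have hN' : σ'.reg N = σ.reg N := by
        rw [ha.reg N (by simp [Prog.WritesReg, Instr.WritesReg, hN, hiN])]
        simp [State.setReg, hiN]
      have hb' : σ'.reg i < σ'.reg N := hb
      have hlt : σ'.reg i < σ.reg N := by omega
      refine ⟨p.size + 1, ?_⟩
      have hi' : (p.eval ω σ').reg i = σ'.reg i := by
        obtain ⟨s, t, hr, -, rfl⟩ := hp.ends (ω := ω) (σ := σ') (Q := fun s => s = p.eval ω σ') rfl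
        exact hr.agree.reg i hi
      have hev : (p ;; .instr (.inc i)).eval ω σ' = (p.eval ω σ').setReg i (σ'.reg i + 1) := by
        simp [Prog.eval, Instr.exec, State.setReg, hi']
      refine Prog.LoopFree.ends (p := p ;; .instr (.inc i)) ⟨hp, trivial⟩ ?_
      rw [hev]
      have h2 := hstep _ σ' (hsub σ' ha) rfl hlt hI
      refine ⟨⟨?_, ?_⟩, ?_⟩
      · simpa [State.setReg] using h2
      · simp [State.setReg]; omega
      · simp only [State.setReg, Function.update_self]
        obtain ⟨d, hd⟩ : ∃ d, σ.reg N = σ'.reg i + 1 + d := ⟨σ.reg N - (σ'.reg i + 1), by omega⟩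
        rw [hd]
        have e1 : σ'.reg i + 1 + d - (σ'.reg i + 1) = d := by omega
        have e2 : σ'.reg i + 1 + d - σ'.reg i = d + 1 := by omega
        rw [e1, e2]
        ring_nf; omega
    · simpa [State.setReg] using h0
  refine (hinit.seq fun σ' _ h => h ▸ hmain).mono (by omega) fun _ _ h => h

/-- Partial correctness of loops. -/
theorem Runs.loop_invariant {ω : ℕ → Bool} {b : Test} {p : Prog} (I : State → Prop)
    (hstep : ∀ σ σ' t, I σ → b.Holds σ → Runs ω p σ σ' t → I σ')
    {σ σ' : State} {t : ℕ} (h : Runs ω (.loop b p) σ σ' t) (hI : I σ) : I σ' ∧ ¬ b.Holds σ' := by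
  generalize hq : Prog.loop b p = q at h
  induction h with
  | loopFalse hb => cases hq; exact ⟨hI, hb⟩
  | loopTrue hb hp _ _ ih => cases hq; exact ih (hstep _ _ _ hI hb hp) rfl
  | _ => cases hq

end RAM

/-! ### Graphs without a given minor are sparse -/

theorem SimpleGraph.connected_induce_iff_reflTransGen {V : Type*} {G : SimpleGraph V} {s : Set V} :
    (G.induce s).Connected ↔ s.Nonempty ∧ ∀ u ∈ s, ∀ v ∈ s,
      Relation.ReflTransGen (fun a b => G.Adj a b ∧ a ∈ s ∧ b ∈ s) u v := by
  constructor
  · intro h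
    refine ⟨Set.nonempty_coe_sort.1 h.nonempty, fun u hu v hv => ?_⟩
    have h1 := (SimpleGraph.reachable_iff_reflTransGen _ _).1 (h.preconnected ⟨u, hu⟩ ⟨v, hv⟩)
    exact h1.lift Subtype.val fun a b hab => ⟨hab, a.2, b.2⟩
  · rintro ⟨⟨x, hx⟩, h⟩
    refine @SimpleGraph.Connected.mk _ _ ?_ ⟨⟨x, hx⟩⟩
    rintro ⟨u, hu⟩ ⟨v, hv⟩
    have h1 := h u hu v hv
    clear h
    induction h1 with
    | refl => exact SimpleGraph.Reachable.refl _
    | tail _ hab ih =>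
      refine (ih hab.2.1).trans (SimpleGraph.Adj.reachable ?_)
      exact hab.1

theorem IsGraphMinor.trans {W V U : Type*} {A : SimpleGraph W} {B : SimpleGraph V}
    {C : SimpleGraph U} (hAB : IsGraphMinor A B) (hBC : IsGraphMinor B C) : IsGraphMinor A C := by
  obtain ⟨f, hf1, hf2, hf3⟩ := hAB
  obtain ⟨g, hg1, hg2, hg3⟩ := hBC
  have hg : ∀ {v v' x}, x ∈ g v → x ∈ g v' → v = v' := fun {v v' x} hx hx' => by
    by_contra hne
    exact Set.disjoint_left.1 (hg2 v v' hne) hx hx'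
  refine ⟨fun w => ⋃ v ∈ f w, g v, fun w => ?_, fun w w' hne => ?_, fun w w' hww => ?_⟩
  · rw [SimpleGraph.connected_induce_iff_reflTransGen]
    obtain ⟨⟨v, hv⟩, hfw⟩ := SimpleGraph.connected_induce_iff_reflTransGen.1 (hf1 w)
    refine ⟨?_, fun x hx y hy => ?_⟩
    · obtain ⟨⟨x, hx⟩, -⟩ := SimpleGraph.connected_induce_iff_reflTransGen.1 (hg1 v)
      exact ⟨x, Set.mem_biUnion hv hx⟩
    · have hlift : ∀ v ∈ f w, ∀ x ∈ g v, ∀ y ∈ g v, Relation.ReflTransGen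
          (fun a b => C.Adj a b ∧ a ∈ (⋃ v ∈ f w, g v) ∧ b ∈ (⋃ v ∈ f w, g v)) x y := by
        intro v hv x hx y hy
        exact ((SimpleGraph.connected_induce_iff_reflTransGen.1 (hg1 v)).2 x hx y hy).lift id
          fun a b h => ⟨h.1, Set.mem_biUnion hv h.2.1, Set.mem_biUnion hv h.2.2⟩
      simp only [Set.mem_iUnion, exists_prop] at hx hy
      obtain ⟨v, hv, hx⟩ := hx
      obtain ⟨v', hv', hy⟩ := hy
      have h1 := hfw v hv v' hv'
      induction h1 generalizing y with
      | refl => exact hlift v hv x hx y hy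
      | tail _ hab ih =>
        obtain ⟨z, hz, z', hz', hzz⟩ := hg3 _ _ hab.1
        refine (ih z hab.2.1 hz).trans (.head ?_ (hlift _ hv' z' hz' y hy))
        exact ⟨hzz, Set.mem_biUnion hab.2.1 hz, Set.mem_biUnion hab.2.2 hz'⟩
  · rw [Set.disjoint_left]
    intro x hx hx'
    simp only [Set.mem_iUnion, exists_prop] at hx hx'
    obtain ⟨v, hv, hx⟩ := hx
    obtain ⟨v', hv', hx'⟩ := hx'
    obtain rfl := hg hx hx'
    exact Set.disjoint_left.1 (hf2 w w' hne) hv hv'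
  · obtain ⟨v, hv, v', hv', hvv⟩ := hf3 w w' hww
    obtain ⟨x, hx, x', hx', hxx⟩ := hg3 v v' hvv
    exact ⟨x, Set.mem_biUnion hv hx, x', Set.mem_biUnion hv' hx', hxx⟩

/-- A graph that embeds (not necessarily as an induced subgraph) is a minor. -/
theorem IsGraphMinor.of_injective {W V : Type*} {A : SimpleGraph W} {B : SimpleGraph V}
    (f : W → V) (hf : Function.Injective f) (h : ∀ w w', A.Adj w w' → B.Adj (f w) (f w')) :
    IsGraphMinor A B := by
  refine ⟨fun w => {f w}, fun w => ?_, fun w w' hne => ?_, fun w w' hww => ?_⟩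
  · rw [SimpleGraph.connected_induce_iff_reflTransGen]
    refine ⟨⟨f w, rfl⟩, ?_⟩
    rintro _ rfl _ rfl
    exact .refl
  · simpa using fun h => hne (hf h)
  · exact ⟨_, rfl, _, rfl, h _ _ hww⟩

/-- The graph obtained by the contraction of `v` to its neighbour `u`. -/
theorem SimpleGraph.exists_contract {V : Type} [Fintype V] (H : SimpleGraph V) {u v : V}
    (huv : H.Adj u v) : ∃ H' : SimpleGraph {x // x ≠ v}, IsGraphMinor H' H ∧
      H.edgeSet.ncard ≤ H'.edgeSet.ncard + 1 + {w | H.Adj u w ∧ H.Adj v w}.ncard := by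
  classical
  let φ : V → {x // x ≠ v} := fun x => if h : x = v then ⟨u, huv.ne⟩ else ⟨x, h⟩
  have hφv : ∀ x, x = v → (φ x : V) = u := fun x h => by simp [φ, h]
  have hφ : ∀ x, x ≠ v → (φ x : V) = x := fun x h => by simp [φ, h]
  let H' : SimpleGraph {x // x ≠ v} :=
    { Adj := fun a b => a ≠ b ∧ ∃ x y, φ x = a ∧ φ y = b ∧ H.Adj x y
      symm := ⟨fun a b ⟨h, x, y, hx, hy, hxy⟩ => ⟨h.symm, y, x, hy, hx, hxy.symm⟩⟩
      loopless := ⟨fun a h => h.1 rfl⟩ }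
  refine ⟨H', ⟨fun a => {x | φ x = a}, fun a => ?_, fun a b hab => ?_, fun a b hab => ?_⟩, ?_⟩
  · rw [SimpleGraph.connected_induce_iff_reflTransGen]
    refine ⟨⟨a, Subtype.ext (hφ a a.2)⟩, ?_⟩
    intro x hx y hy
    have hxy : (φ x : V) = φ y := by rw [hx.out, hy.out]
    by_cases hx' : x = v <;> by_cases hy' : y = v
    · subst hx'; subst hy'; exact .refl
    · rw [hφv x hx', hφ y hy'] at hxy
      subst hx'; subst hxy
      exact .single ⟨huv.symm, hx, hy⟩
    · rw [hφ x hx', hφv y hy'] at hxy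
      subst hy'; subst hxy
      exact .single ⟨huv, hx, hy⟩
    · rw [hφ x hx', hφ y hy'] at hxy
      subst hxy; exact .refl
  · rw [Set.disjoint_left]
    rintro x rfl h
    exact hab h
  · obtain ⟨-, x, y, hx, hy, hxy⟩ := hab
    exact ⟨x, hx, y, hy, hxy⟩
  · set R : Set (Sym2 V) := {s(u, v)} ∪ (fun w => s(v, w)) '' {w | H.Adj u w ∧ H.Adj v w} with hR
    have hRc : R.ncard ≤ 1 + {w | H.Adj u w ∧ H.Adj v w}.ncard := by
      refine (Set.ncard_union_le _ _).trans ?_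
      rw [Set.ncard_singleton]
      exact Nat.add_le_add_left (Set.ncard_image_le (Set.toFinite _)) _
    have hinj : (H.edgeSet \ R).ncard ≤ H'.edgeSet.ncard := by
      refine Set.ncard_le_ncard_of_injOn (Sym2.map φ) ?_ ?_ (Set.toFinite _)
      · intro e
        induction e with | h x y => ?_
        rintro ⟨hxy, hn⟩
        refine ⟨fun h => ?_, x, y, rfl, rfl, hxy⟩
        have hxy : H.Adj x y := hxy
        have h' : (φ x : V) = φ y := congrArg Subtype.val (show φ x = φ y from h)
        by_cases hx' : x = v <;> by_cases hy' : y = v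
        · exact hxy.ne (hx'.trans hy'.symm)
        · rw [hφv x hx', hφ y hy'] at h'
          apply hn; left; subst hx'; subst h'; exact Sym2.eq_swap
        · rw [hφ x hx', hφv y hy'] at h'
          apply hn; left; subst hy'; subst h'; rfl
        · rw [hφ x hx', hφ y hy'] at h'
          exact hxy.ne h'
      · have key : ∀ x y, φ x = φ y → x = y ∨ (x = u ∧ y = v) ∨ (x = v ∧ y = u) := by
          intro x y h
          have h' : (φ x : V) = φ y := by rw [h]
          by_cases hx' : x = v <;> by_cases hy' : y = v
          · exact .inl (hx'.trans hy'.symm)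
          · rw [hφv x hx', hφ y hy'] at h'; exact .inr (.inr ⟨hx', h'.symm⟩)
          · rw [hφ x hx', hφv y hy'] at h'; exact .inr (.inl ⟨h', hy'⟩)
          · rw [hφ x hx', hφ y hy'] at h'; exact .inl h'
        have main : ∀ x y x' y', H.Adj x y → H.Adj x' y' → s(x, y) ∉ R → s(x', y') ∉ R →
            φ x = φ x' → φ y = φ y' → s(x, y) = s(x', y') := by
          intro x y x' y' h h' hn hn' e1 e2
          simp only [hR, Set.mem_union, Set.mem_singleton_iff, Set.mem_image, Set.mem_ofPred_eq,
            not_or, not_exists, not_and, Sym2.eq_iff] at hn hn'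
          have := h.symm
          have := h'.symm
          have := h.ne
          have := h'.ne
          rcases key _ _ e1 with rfl | ⟨rfl, rfl⟩ | ⟨rfl, rfl⟩ <;>
            rcases key _ _ e2 with rfl | ⟨rfl, rfl⟩ | ⟨rfl, rfl⟩ <;> grind
        intro e he e' he' hee
        induction e with | h x y => ?_
        induction e' with | h x' y' => ?_
        simp only [Sym2.map_mk, Sym2.eq_iff] at hee
        rcases hee with ⟨e1, e2⟩ | ⟨e1, e2⟩
        · exact main x y x' y' he.1 he'.1 he.2 he'.2 e1 e2
        · rw [main x y y' x' he.1 (SimpleGraph.Adj.symm he'.1) he.2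
            (by rw [Sym2.eq_swap]; exact he'.2) e1 e2, Sym2.eq_swap]
    have := Set.ncard_le_ncard_sdiff_add_ncard H.edgeSet R (Set.toFinite _)
    omega

/-- Mader's theorem: a graph with many edges has a large complete minor. -/
theorem exists_isGraphMinor_top_of_le_ncard_edgeSet (t : ℕ) : ∃ d : ℕ, ∀ (V : Type) [Fintype V]
    [Nonempty V] (H : SimpleGraph V), d * Fintype.card V ≤ H.edgeSet.ncard →
      IsGraphMinor (⊤ : SimpleGraph (Fin t)) H := by
  classical
  induction t with
  | zero =>
    exact ⟨0, fun V _ _ H _ => ⟨fun w => w.elim0, fun w => w.elim0, fun w => w.elim0,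
      fun w => w.elim0⟩⟩
  | succ t ih =>
    obtain ⟨d, hd⟩ := ih
    refine ⟨2 * d + 1, fun V _ _ H hH => ?_⟩
    generalize hm : Fintype.card V = m at hH
    induction m generalizing V with
    | zero => exact absurd hm Fintype.card_ne_zero
    | succ m ihm =>
      by_cases hc : ∃ u v, H.Adj u v ∧ {w | H.Adj u w ∧ H.Adj v w}.ncard ≤ 2 * d
      · obtain ⟨u, v, huv, hc⟩ := hc
        obtain ⟨H', hmin, hcard⟩ := H.exists_contract huv
        have : Nonempty {x // x ≠ v} := ⟨⟨u, huv.ne⟩⟩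
        refine (ihm {x // x ≠ v} inferInstance this H' ?_ ?_).trans hmin
        · rw [Fintype.card_subtype_compl, hm, Fintype.card_subtype_eq]; omega
        · rw [Nat.mul_succ] at hH; omega
      · push Not at hc
        obtain ⟨e, he⟩ : H.edgeSet.Nonempty := by
          rw [Set.nonempty_iff_ne_empty]
          intro h
          rw [h, Set.ncard_empty] at hH
          have : 0 < (2 * d + 1) * (m + 1) := by positivity
          omega
        induction e with | h u v => ?_
        have huv : H.Adj u v := he
        let N : Set V := {w | H.Adj u w}
        have : Nonempty N := ⟨⟨v, huv⟩⟩
        have hdeg : ∀ w : N, 2 * d ≤ (H.induce N).degree w := by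
          intro w
          refine (hc u w w.2).le.trans ?_
          rw [← SimpleGraph.card_neighborSet_eq_degree, ← Nat.card_eq_fintype_card,
            ← Nat.card_coe_set_eq]
          exact Nat.card_le_card_of_injective
            (fun x => (⟨⟨x.1, x.2.1⟩, x.2.2⟩ : (H.induce N).neighborSet w))
            fun x y h => by simpa [Subtype.ext_iff] using h
        have hsum := (H.induce N).sum_degrees_eq_twice_card_edges
        have hle : Fintype.card N * (2 * d) ≤ ∑ w, (H.induce N).degree w := by
          simpa using Finset.card_nsmul_le_sum Finset.univ _ _ fun w _ => hdeg w
        have hcard : d * Fintype.card N ≤ (H.induce N).edgeSet.ncard := by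
          rw [← SimpleGraph.coe_edgeFinset, Set.ncard_coe_finset]
          nlinarith
        obtain ⟨B, hB1, hB2, hB3⟩ := hd N (H.induce N) hcard
        have hu : ∀ i, u ∉ Subtype.val '' B i := by
          rintro i ⟨x, -, hx⟩
          have h : H.Adj u x := x.2
          exact h.ne hx.symm
        refine ⟨fun i => Fin.cases (motive := fun _ => Set V) {u} (fun i => Subtype.val '' B i) i,
          fun i => ?_, fun i j hij => ?_,
          fun i j hij => ?_⟩
        · rw [SimpleGraph.connected_induce_iff_reflTransGen]
          cases i using Fin.cases with
          | zero =>
            refine ⟨⟨u, rfl⟩, ?_⟩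
            intro x hx y hy
            rw [show x = u from hx, show y = u from hy]
          | succ i =>
            obtain ⟨h0, h1⟩ := SimpleGraph.connected_induce_iff_reflTransGen.1 (hB1 i)
            refine ⟨h0.image _, ?_⟩
            rintro _ ⟨x, hx, rfl⟩ _ ⟨y, hy, rfl⟩
            exact (h1 x hx y hy).lift Subtype.val fun a b hab =>
              ⟨hab.1, ⟨a, hab.2.1, rfl⟩, ⟨b, hab.2.2, rfl⟩⟩
        · cases i using Fin.cases with
          | zero =>
            cases j using Fin.cases with
            | zero => exact absurd rfl hij
            | succ j => exact Set.disjoint_singleton_left.2 (hu j)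
          | succ i =>
            cases j using Fin.cases with
            | zero => exact Set.disjoint_singleton_right.2 (hu i)
            | succ j =>
              exact (Set.disjoint_image_iff Subtype.val_injective).2
                (hB2 i j fun h => hij (h ▸ rfl))
        · have hne : ∀ i, ∃ w, w ∈ B i := fun i =>
            (SimpleGraph.connected_induce_iff_reflTransGen.1 (hB1 i)).1
          cases i using Fin.cases with
          | zero =>
            cases j using Fin.cases with
            | zero => exact absurd rfl hij.ne
            | succ j =>
              obtain ⟨w, hw⟩ := hne j
              exact ⟨u, rfl, w, ⟨w, hw, rfl⟩, w.2⟩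
          | succ i =>
            cases j using Fin.cases with
            | zero =>
              obtain ⟨w, hw⟩ := hne i
              exact ⟨w, ⟨w, hw, rfl⟩, u, rfl, SimpleGraph.Adj.symm w.2⟩
            | succ j =>
              obtain ⟨x, hx, y, hy, hxy⟩ := hB3 i j fun h => hij.ne (h ▸ rfl)
              exact ⟨x, ⟨x, hx, rfl⟩, y, ⟨y, hy, rfl⟩, hxy⟩

theorem GraphFamily.exists_edge_bound {F : GraphFamily} (hF : F.MinorClosed) (hF' : F.Nontrivial) :
    ∃ d : ℕ, ∀ (n : ℕ) (G : SimpleGraph (Fin n)), G ∈ F n → ∀ (V : Type) [Fintype V]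
      (H : SimpleGraph V), IsGraphMinor H G → H.edgeSet.ncard ≤ d * Fintype.card V := by
  obtain ⟨m, H₀, hH₀⟩ := hF'
  obtain ⟨d, hd⟩ := exists_isGraphMinor_top_of_le_ncard_edgeSet m
  refine ⟨d, fun n G hG V _ H hH => ?_⟩
  by_contra! hlt
  have : Nonempty V := by
    by_contra hV
    rw [not_nonempty_iff] at hV
    rw [Set.eq_empty_of_isEmpty H.edgeSet, Set.ncard_empty] at hlt
    omega
  refine hH₀ (hF n m G H₀ hG ?_)
  exact ((IsGraphMinor.of_injective id Function.injective_id fun _ _ h => h.ne).trans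
    (hd V H hlt.le)).trans hH

namespace CycleSearch

/-! ### Lists of edges and their peeling -/

/-- An edge between the first two components; the third component is a piece of information that
is carried along. -/
abbrev Entry : Type := ℕ × ℕ × ℕ

def Entry.swap (t : Entry) : Entry := (t.2.1, t.1, t.2.2)

def deg (L : List Entry) (v : ℕ) : ℕ :=
  L.countP (fun t => t.1 = v) + L.countP (fun t => t.2.1 = v)

/-- The orientations of an edge whose tail has degree at most `D`. -/
def outStep (D : ℕ) (f : ℕ → ℕ) (t : Entry) : List Entry :=
  (if f t.1 ≤ D then [t] else []) ++ if f t.2.1 ≤ D then [t.swap] else []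

def core (D : ℕ) (f : ℕ → ℕ) (L : List Entry) : List Entry :=
  L.filter fun t => D < f t.1 ∧ D < f t.2.1

/-- Repeatedly remove all vertices of degree at most `D`, and list the edges at the time of their
removal, oriented away from a removed vertex. -/
def peel (D : ℕ) (L : List Entry) : List Entry :=
  if (core D (deg L) L).length < L.length then
    L.flatMap (outStep D (deg L)) ++ peel D (core D (deg L) L)
  else []
termination_by L.length

theorem mem_core {D : ℕ} {f : ℕ → ℕ} {L : List Entry} {t : Entry} :
    t ∈ core D f L ↔ t ∈ L ∧ D < f t.1 ∧ D < f t.2.1 := by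
  simp [core]

theorem mem_outStep {D : ℕ} {f : ℕ → ℕ} {s t : Entry} :
    s ∈ outStep D f t ↔ f s.1 ≤ D ∧ (s = t ∨ s = t.swap) := by
  simp only [outStep, List.mem_append, List.mem_ite_nil_right, List.mem_singleton]
  constructor
  · rintro (⟨h, rfl⟩ | ⟨h, rfl⟩)
    · exact ⟨h, .inl rfl⟩
    · exact ⟨h, .inr rfl⟩
  · rintro ⟨h, rfl | rfl⟩
    · exact .inl ⟨h, rfl⟩
    · exact .inr ⟨h, rfl⟩

theorem mem_of_mem_peel {D : ℕ} {L : List Entry} {t : Entry} (h : t ∈ peel D L) :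
    t ∈ L ∨ t.swap ∈ L := by
  induction hm : L.length using Nat.strong_induction_on generalizing L with
  | _ m ih =>
    rw [peel] at h
    split_ifs at h with hlt
    · rcases List.mem_append.1 h with h | h
      · obtain ⟨s, hs, hts⟩ := List.mem_flatMap.1 h
        rcases (mem_outStep.1 hts).2 with rfl | rfl
        · exact .inl hs
        · exact .inr hs
      · exact (ih _ (hm ▸ hlt) h rfl).imp (fun h => (mem_core.1 h).1) fun h => (mem_core.1 h).1
    · simp at h

theorem countP_flatMap_outStep (D : ℕ) (f : ℕ → ℕ) (L : List Entry) (u : ℕ) :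
    (L.flatMap (outStep D f)).countP (fun t => t.1 = u) = if f u ≤ D then deg L u else 0 := by
  induction L with
  | nil => simp [deg]
  | cons t L ih =>
    obtain ⟨x, l, b⟩ := t
    have h1 : (outStep D f (x, l, b)).countP (fun t => t.1 = u) =
        if f u ≤ D then (if x = u then 1 else 0) + (if l = u then 1 else 0) else 0 := by
      clear ih
      simp only [outStep, Entry.swap, List.countP_append]
      split_ifs <;> simp only [List.countP_cons, List.countP_nil, decide_eq_true_eq] <;> grind
    rw [List.flatMap_cons, List.countP_append, ih, h1]
    split_ifs <;> simp_all [deg] <;> omega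

/-- The orientation has small out-degrees. -/
theorem countP_peel_le (D : ℕ) (L : List Entry) (u : ℕ) :
    (peel D L).countP (fun t => t.1 = u) ≤ D := by
  induction hm : L.length using Nat.strong_induction_on generalizing L with
  | _ m ih =>
    rw [peel]
    split_ifs with hlt
    · rw [List.countP_append, countP_flatMap_outStep]
      split_ifs with hu
      · have : (peel D (core D (deg L) L)).countP (fun t => t.1 = u) = 0 := by
          rw [List.countP_eq_zero]
          intro t ht htu
          simp only [decide_eq_true_eq] at htu
          rcases mem_of_mem_peel ht with h | h
          · have h2 := (mem_core.1 h).2.1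
            rw [htu] at h2; omega
          · have h2 : D < deg L t.1 := (mem_core.1 h).2.2
            rw [htu] at h2; omega
        omega
      · rw [zero_add]; exact ih _ (hm ▸ hlt) _ rfl
    · simp

/-- The edges listed within a set of vertices are at most `d` times as many as the vertices. -/
def SparseList (d : ℕ) (L : List Entry) : Prop :=
  ∀ (X : Finset ℕ) (L' : List Entry), L'.Sublist L → (∀ t ∈ L', t.1 ∈ X ∧ t.2.1 ∈ X) →
    L'.length ≤ d * X.card

theorem SparseList.sublist {d : ℕ} {L L' : List Entry} (h : SparseList d L) (hL : L'.Sublist L) :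
    SparseList d L' :=
  fun X L'' hL'' hX => h X L'' (hL''.trans hL) hX

theorem sum_countP_le {α : Type*} (L : List α) (g : α → ℕ) (X : Finset ℕ) :
    ∑ v ∈ X, L.countP (fun t => g t = v) ≤ L.length := by
  induction L with
  | nil => simp
  | cons t L ih =>
    simp only [List.countP_cons, Finset.sum_add_distrib, decide_eq_true_eq, List.length_cons,
      Finset.sum_ite_eq]
    split_ifs <;> omega

theorem SparseList.two_mul_length_core_le {d D : ℕ} {L : List Entry} (h : SparseList d L)
    (hD : 4 * d ≤ D) : 2 * (core D (deg L) L).length ≤ L.length := by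
  classical
  set X : Finset ℕ := ((L.map (·.1) ++ L.map (·.2.1)).toFinset).filter (D < deg L ·) with hX
  have h1 : (core D (deg L) L).length ≤ d * X.card := by
    refine h X _ List.filter_sublist fun t ht => ?_
    obtain ⟨ht, h1, h2⟩ := mem_core.1 ht
    simp only [hX, Finset.mem_filter, List.mem_toFinset, List.mem_append, List.mem_map]
    exact ⟨⟨.inl ⟨t, ht, rfl⟩, h1⟩, ⟨.inr ⟨t, ht, rfl⟩, h2⟩⟩
  have h2 : X.card * D ≤ ∑ v ∈ X, deg L v := by
    simpa using Finset.card_nsmul_le_sum X (deg L) D fun v hv => (Finset.mem_filter.1 hv).2.le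
  have h3 : ∑ v ∈ X, deg L v ≤ 2 * L.length := by
    simp only [deg, Finset.sum_add_distrib]
    have := sum_countP_le L (fun t => t.1) X
    have := sum_countP_le L (fun t => t.2.1) X
    omega
  nlinarith [Nat.mul_le_mul_left X.card hD]

theorem SparseList.length_core_lt {d D : ℕ} {L : List Entry} (h : SparseList d L)
    (hD : 4 * d ≤ D) (hL : L ≠ []) : (core D (deg L) L).length < L.length := by
  have := h.two_mul_length_core_le hD
  have := List.length_pos_iff.2 hL
  omega

/-- Every edge of a sparse graph is oriented in at least one direction. -/
theorem SparseList.mem_peel {d D : ℕ} {L : List Entry} (h : SparseList d L) (hD : 4 * d ≤ D)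
    {t : Entry} (ht : t ∈ L) : t ∈ peel D L ∨ t.swap ∈ peel D L := by
  induction hm : L.length using Nat.strong_induction_on generalizing L with
  | _ m ih =>
    have hlt := h.length_core_lt hD (List.ne_nil_of_mem ht)
    rw [peel, if_pos hlt, List.mem_append, List.mem_append]
    by_cases h1 : deg L t.1 ≤ D
    · exact .inl (.inl (List.mem_flatMap.2 ⟨t, ht, mem_outStep.2 ⟨h1, .inl rfl⟩⟩))
    by_cases h2 : deg L t.2.1 ≤ D
    · exact .inr (.inl (List.mem_flatMap.2 ⟨t, ht, mem_outStep.2 ⟨h2, .inr rfl⟩⟩))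
    · exact (ih _ (hm ▸ hlt) (h.sublist List.filter_sublist)
        (mem_core.2 ⟨ht, not_le.1 h1, not_le.1 h2⟩) rfl).imp .inr .inr

/-! ### Contracted edges without repetition -/

def collectStep (cond : ℕ → ℕ → Bool) (rep : ℕ → ℕ) (L : List Entry) (e : ℕ × ℕ) : List Entry :=
  if cond e.1 e.2 ∧ ∀ t ∈ L, ¬ (t.1 = e.1 ∧ t.2.1 = rep e.2) then L ++ [(e.1, rep e.2, e.2)] else L

/-- The list of the edges `(x, rep b)`, for the arcs `(x, b)` that satisfy a condition. -/
def collect (cond : ℕ → ℕ → Bool) (rep : ℕ → ℕ) (arcs : List (ℕ × ℕ)) : List Entry :=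
  arcs.foldl (collectStep cond rep) []

theorem collect_concat (cond : ℕ → ℕ → Bool) (rep : ℕ → ℕ) (arcs : List (ℕ × ℕ)) (e : ℕ × ℕ) :
    collect cond rep (arcs ++ [e]) = collectStep cond rep (collect cond rep arcs) e := by
  simp [collect, List.foldl_append]

theorem of_mem_collect {cond : ℕ → ℕ → Bool} {rep : ℕ → ℕ} {arcs : List (ℕ × ℕ)} {t : Entry}
    (h : t ∈ collect cond rep arcs) :
    (t.1, t.2.2) ∈ arcs ∧ cond t.1 t.2.2 ∧ t.2.1 = rep t.2.2 := by
  induction arcs using List.reverseRecOn with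
  | nil => simp [collect] at h
  | append_singleton arcs e ih =>
    rw [collect_concat, collectStep] at h
    split_ifs at h with hc
    · rcases List.mem_append.1 h with h | h
      · obtain ⟨h1, h2⟩ := ih h
        exact ⟨List.mem_append_left _ h1, h2⟩
      · rw [List.mem_singleton] at h
        subst h
        exact ⟨by simp, hc.1, rfl⟩
    · obtain ⟨h1, h2⟩ := ih h
      exact ⟨List.mem_append_left _ h1, h2⟩

theorem exists_mem_collect {cond : ℕ → ℕ → Bool} {rep : ℕ → ℕ} {arcs : List (ℕ × ℕ)} {x b : ℕ}
    (h : (x, b) ∈ arcs) (hc : cond x b) : ∃ b', (x, rep b, b') ∈ collect cond rep arcs := by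
  induction arcs using List.reverseRecOn with
  | nil => simp at h
  | append_singleton arcs e ih =>
    rw [collect_concat, collectStep]
    rcases List.mem_append.1 h with h | h
    · obtain ⟨b', hb'⟩ := ih h
      refine ⟨b', ?_⟩
      split_ifs
      · exact List.mem_append_left _ hb'
      · exact hb'
    · rw [List.mem_singleton] at h
      subst h
      split_ifs with hc'
      · exact ⟨b, by simp⟩
      · simp only [hc, true_and, not_forall, not_not] at hc'
        obtain ⟨⟨x', l', b'⟩, ht, rfl, hl⟩ := hc'
        exact ⟨b', by simpa only [← hl] using ht⟩

theorem nodup_collect (cond : ℕ → ℕ → Bool) (rep : ℕ → ℕ) (arcs : List (ℕ × ℕ)) :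
    ((collect cond rep arcs).map fun t => (t.1, t.2.1)).Nodup := by
  induction arcs using List.reverseRecOn with
  | nil => simp [collect]
  | append_singleton arcs e ih =>
    rw [collect_concat, collectStep]
    split_ifs with hc
    · rw [List.map_append, List.nodup_append]
      refine ⟨ih, by simp, ?_⟩
      intro p hp q hq hpq
      obtain ⟨t, ht, rfl⟩ := List.mem_map.1 hp
      simp only [List.map_cons, List.map_nil, List.mem_singleton] at hq
      rw [hq, Prod.mk.injEq] at hpq
      exact hc.2 t ht hpq
    · exact ih

theorem length_collect_le (cond : ℕ → ℕ → Bool) (rep : ℕ → ℕ) (arcs : List (ℕ × ℕ)) :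
    (collect cond rep arcs).length ≤ arcs.length := by
  induction arcs using List.reverseRecOn with
  | nil => simp [collect]
  | append_singleton arcs e ih =>
    rw [collect_concat, collectStep]
    split_ifs <;> simp <;> omega

/-! ### Random pointers -/

def pointStep (mark : ℕ → Bool) (s : (ℕ → ℕ) × (ℕ → ℕ)) (t : Entry) : (ℕ → ℕ) × (ℕ → ℕ) :=
  if mark t.1 = false ∧ mark t.2.1 = true then
    (Function.update s.1 t.1 (t.2.1 + 1), Function.update s.2 t.1 (t.2.2 + 1))
  else s

/-- Unmarked vertices point to marked out-neighbours. The first function holds the successor of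
the out-neighbour, or zero if there is none, and the second one the successor of the information
carried by the edge. -/
def point (mark : ℕ → Bool) (L : List Entry) : (ℕ → ℕ) × (ℕ → ℕ) :=
  L.foldl (pointStep mark) (0, 0)

theorem point_concat (mark : ℕ → Bool) (L : List Entry) (t : Entry) :
    point mark (L ++ [t]) = pointStep mark (point mark L) t := by
  simp [point, List.foldl_append]

theorem point_spec (mark : ℕ → Bool) (L : List Entry) (u : ℕ) :
    ((point mark L).1 u = 0 ∧ (point mark L).2 u = 0) ∨
      ∃ w b, (u, w, b) ∈ L ∧ mark u = false ∧ mark w = true ∧ (point mark L).1 u = w + 1 ∧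
        (point mark L).2 u = b + 1 := by
  induction L using List.reverseRecOn with
  | nil => simp [point]
  | append_singleton L t ih =>
    rw [point_concat, pointStep]
    split_ifs with h
    · by_cases hu : u = t.1
      · subst hu
        exact .inr ⟨t.2.1, t.2.2, by simp, h.1, h.2, by simp, by simp⟩
      · simp only [ne_eq, hu, not_false_eq_true, Function.update_of_ne]
        refine ih.imp id ?_
        rintro ⟨w, b, hm, h⟩
        exact ⟨w, b, List.mem_append_left _ hm, h⟩
    · refine ih.imp id ?_
      rintro ⟨w, b, hm, h⟩
      exact ⟨w, b, List.mem_append_left _ hm, h⟩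

theorem point_ne_zero {mark : ℕ → Bool} {L : List Entry} {t : Entry} (ht : t ∈ L)
    (h1 : mark t.1 = false) (h2 : mark t.2.1 = true) : (point mark L).1 t.1 ≠ 0 := by
  induction L using List.reverseRecOn with
  | nil => simp at ht
  | append_singleton L s ih =>
    rw [point_concat, pointStep]
    rcases List.mem_append.1 ht with ht | ht
    · split_ifs with h
      · by_cases hu : t.1 = s.1
        · simp [hu]
        · simpa [Function.update_of_ne hu] using ih ht
      · exact ih ht
    · rw [List.mem_singleton] at ht
      subst ht
      simp [h1, h2]

theorem point_eq {mark : ℕ → Bool} {L : List Entry} {t : Entry} (ht : t ∈ L)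
    (h1 : mark t.1 = false) (h2 : mark t.2.1 = true)
    (h3 : ∀ s ∈ L, s.1 = t.1 → s.2.1 ≠ t.2.1 → mark s.2.1 = false) :
    (point mark L).1 t.1 = t.2.1 + 1 := by
  rcases point_spec mark L t.1 with h | ⟨w, b, hm, -, hw, h, -⟩
  · exact absurd h.1 (point_ne_zero ht h1 h2)
  · by_contra hne
    have := h3 _ hm rfl (fun h' => hne (by rw [h, ← h']))
    simp_all

def newRep (p r : ℕ → ℕ) (v : ℕ) : ℕ := if p (r v) = 0 then r v else p (r v) - 1

/-! ### Colours -/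

/-- Tails of edges whose ends have colours that do not fit together lose their colour. -/
def clean (bad : ℕ → ℕ → Bool) (c : ℕ → ℕ) (L : List Entry) : ℕ → ℕ :=
  L.foldl (fun c' t => if bad (c t.1) (c t.2.1) then Function.update c' t.1 0 else c') c

theorem clean_concat (bad : ℕ → ℕ → Bool) (c : ℕ → ℕ) (L : List Entry) (t : Entry) :
    clean bad c (L ++ [t]) =
      if bad (c t.1) (c t.2.1) then Function.update (clean bad c L) t.1 0 else clean bad c L := by
  simp [clean, List.foldl_append]

theorem clean_spec (bad : ℕ → ℕ → Bool) (c : ℕ → ℕ) (L : List Entry) (v : ℕ) :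
    (clean bad c L v = 0 ∧ ∃ t ∈ L, t.1 = v ∧ bad (c t.1) (c t.2.1)) ∨
      (clean bad c L v = c v ∧ ∀ t ∈ L, t.1 = v → ¬ bad (c t.1) (c t.2.1)) := by
  induction L using List.reverseRecOn with
  | nil => simp [clean]
  | append_singleton L t ih =>
    rw [clean_concat]
    split_ifs with h
    · by_cases hv : v = t.1
      · exact .inl ⟨by simp [hv], t, by simp, hv.symm, h⟩
      · rw [Function.update_of_ne hv]
        rcases ih with ⟨h1, s, hs, h2⟩ | ⟨h1, h2⟩
        · exact .inl ⟨h1, s, List.mem_append_left _ hs, h2⟩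
        · refine .inr ⟨h1, fun s hs hsv => ?_⟩
          rcases List.mem_append.1 hs with hs | hs
          · exact h2 s hs hsv
          · rw [List.mem_singleton] at hs; subst hs; exact absurd hsv.symm hv
    · rcases ih with ⟨h1, s, hs, h2⟩ | ⟨h1, h2⟩
      · exact .inl ⟨h1, s, List.mem_append_left _ hs, h2⟩
      · refine .inr ⟨h1, fun s hs hsv => ?_⟩
        rcases List.mem_append.1 hs with hs | hs
        · exact h2 s hs hsv
        · rw [List.mem_singleton] at hs; subst hs; exact h

/-- The colour of a vertex after `i` rows of bits: the last one whose bit is set. -/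
def colour (bits : ℕ → ℕ → Bool) : ℕ → ℕ → ℕ
  | 0, _ => 0
  | i + 1, v => if bits i v then i + 1 else colour bits i v

theorem colour_eq_zero {bits : ℕ → ℕ → Bool} {k v : ℕ} (h : ∀ i < k, bits i v = false) :
    colour bits k v = 0 := by
  induction k with
  | zero => rfl
  | succ k ih => simp [colour, h k (by omega), ih fun i hi => h i (by omega)]

theorem colour_eq {bits : ℕ → ℕ → Bool} {k v j : ℕ} (hj : j < k)
    (h : ∀ i < k, bits i v = decide (i = j)) : colour bits k v = j + 1 := by
  induction k with
  | zero => omega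
  | succ k ih =>
    rw [colour, h k (by omega)]
    by_cases hk : k = j
    · simp [hk]
    · simp [hk, ih (by omega) fun i hi => h i (by omega)]

theorem colour_congr {bits bits' : ℕ → ℕ → Bool} {k : ℕ} (h : ∀ i < k, bits i = bits' i) :
    colour bits k = colour bits' k := by
  induction k with
  | zero => rfl
  | succ k ih =>
    ext v
    rw [colour, colour, h k (by omega), ih fun i hi => h i (by omega)]

/-- Two colours among `1, …, k` are not cyclically consecutive. -/
def badPair (k a b : ℕ) : Bool :=
  decide (a ≠ 0 ∧ b ≠ 0 ∧ b ≠ a + 1 ∧ a ≠ b + 1 ∧ ¬ (a = 1 ∧ b = k) ∧ ¬ (a = k ∧ b = 1))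

/-! ### One trial of the algorithm, as a function of the random bits -/

section Trial

variable (k D : ℕ) (arcs : List (ℕ × ℕ)) (bits : ℕ → ℕ → Bool)

def orient : List Entry := peel D (collect (fun x b => decide (x < b)) id arcs)

def cleanColour : ℕ → ℕ := clean (badPair k) (colour bits k) (orient D arcs)

def stageCond (c : ℕ → ℕ) (j x b : ℕ) : Bool := decide (c x = j + 2 ∧ c b = j + 1)

def stageEdges (c r : ℕ → ℕ) (j : ℕ) : List Entry := collect (stageCond c j) r arcs

def stageOut (c r : ℕ → ℕ) (j : ℕ) : List Entry := peel D (stageEdges arcs c r j)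

/-- The vertex into which a vertex has been contracted after `j` stages. -/
def rep (c : ℕ → ℕ) : ℕ → ℕ → ℕ
  | 0 => id
  | j + 1 => newRep (point (bits (k + j)) (stageOut D arcs c (rep c j) j)).1 (rep c j)

def hist (c : ℕ → ℕ) (j v : ℕ) : ℕ :=
  (point (bits (k + j)) (stageOut D arcs c (rep k D arcs bits c j) j)).2 (rep k D arcs bits c j v)

/-- The arc `e` closes a cycle. -/
def Closes (e : ℕ × ℕ) : Prop :=
  cleanColour k D arcs bits e.1 = k ∧ cleanColour k D arcs bits e.2 = 1 ∧
    rep k D arcs bits (cleanColour k D arcs bits) (k - 1) e.1 =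
      rep k D arcs bits (cleanColour k D arcs bits) (k - 1) e.2

def Found : Prop := ∃ e ∈ arcs, Closes k D arcs bits e

/-- The vertex before `x` on a cycle that is closed by an arc to `a`. -/
def back (c : ℕ → ℕ) (a j x : ℕ) : ℕ :=
  (if hist k D arcs bits c j x = 0 then hist k D arcs bits c j a
    else hist k D arcs bits c j x) - 1

end Trial

theorem rep_congr {k D : ℕ} {arcs : List (ℕ × ℕ)} {bits bits' : ℕ → ℕ → Bool} {c : ℕ → ℕ} {j : ℕ}
    (h : ∀ i < k + j, bits i = bits' i) : rep k D arcs bits c j = rep k D arcs bits' c j := by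
  induction j with
  | zero => rfl
  | succ j ih => rw [rep, rep, ih fun i hi => h i (by omega), h (k + j) (by omega)]

theorem cleanColour_congr {k D : ℕ} {arcs : List (ℕ × ℕ)} {bits bits' : ℕ → ℕ → Bool}
    (h : ∀ i < k, bits i = bits' i) : cleanColour k D arcs bits = cleanColour k D arcs bits' := by
  rw [cleanColour, cleanColour, colour_congr h]

theorem found_congr {k D : ℕ} {arcs : List (ℕ × ℕ)} {bits bits' : ℕ → ℕ → Bool}
    (h : ∀ i < k + (k - 1), bits i = bits' i) : Found k D arcs bits ↔ Found k D arcs bits' := by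
  have h1 := cleanColour_congr (k := k) (D := D) (arcs := arcs) (fun i hi => h i (by omega))
  have h2 := rep_congr (D := D) (arcs := arcs) (c := cleanColour k D arcs bits') h
  simp only [Found, Closes, h1, h2]

section Stage

variable {k D : ℕ} {arcs : List (ℕ × ℕ)} {bits : ℕ → ℕ → Bool} {c : ℕ → ℕ}

theorem of_mem_stageEdges {r : ℕ → ℕ} {j : ℕ} {t : Entry} (h : t ∈ stageEdges arcs c r j) :
    (t.1, t.2.2) ∈ arcs ∧ c t.1 = j + 2 ∧ c t.2.2 = j + 1 ∧ t.2.1 = r t.2.2 := by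
  obtain ⟨h1, h2, h3⟩ := of_mem_collect h
  simp only [stageCond, decide_eq_true_eq] at h2
  exact ⟨h1, h2.1, h2.2, h3⟩

/-- Contracted vertices are in the first classes, and the other vertices are not contracted. -/
theorem rep_class (j v : ℕ) : (j + 1 < c v → rep k D arcs bits c j v = v) ∧
    (c v ≤ j + 1 → c (rep k D arcs bits c j v) ≤ j + 1) := by
  induction j generalizing v with
  | zero => exact ⟨fun _ => rfl, id⟩
  | succ j ih =>
    rw [rep, newRep]
    set r := rep k D arcs bits c j with hr
    have key : ∀ u, (point (bits (k + j)) (stageOut D arcs c r j)).1 u ≠ 0 → c u ≤ j + 2 ∧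
        c ((point (bits (k + j)) (stageOut D arcs c r j)).1 u - 1) ≤ j + 2 := by
      intro u hu
      rcases point_spec (bits (k + j)) (stageOut D arcs c r j) u with h | ⟨w, b, hm, -, -, h, -⟩
      · exact absurd h.1 hu
      · rw [h, Nat.add_sub_cancel]
        rcases mem_of_mem_peel hm with hm | hm
        · obtain ⟨-, h1, h2, h3⟩ := of_mem_stageEdges hm
          simp only at h1 h2 h3
          have := (ih b).2 h2.le
          rw [← h3] at this
          omega
        · obtain ⟨-, h1, h2, h3⟩ := of_mem_stageEdges hm
          simp only [Entry.swap] at h1 h2 h3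
          have := (ih b).2 h2.le
          rw [← h3] at this
          omega
    constructor
    · intro hv
      rw [(ih v).1 (by omega)]
      split_ifs with h
      · rfl
      · have := (key v h).1; omega
    · intro hv
      split_ifs with h
      · by_cases hv' : c v ≤ j + 1
        · have := (ih v).2 hv'; omega
        · rw [(ih v).1 (by omega)]; omega
      · exact (key _ h).2

/-- The edge along which a vertex is contracted in one stage. -/
theorem point_stage (j u : ℕ) :
    ((point (bits (k + j)) (stageOut D arcs c (rep k D arcs bits c j) j)).1 u = 0 ∧
      (point (bits (k + j)) (stageOut D arcs c (rep k D arcs bits c j) j)).2 u = 0) ∨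
    ∃ w b, (point (bits (k + j)) (stageOut D arcs c (rep k D arcs bits c j) j)).1 u = w + 1 ∧
      (point (bits (k + j)) (stageOut D arcs c (rep k D arcs bits c j) j)).2 u = b + 1 ∧
      (point (bits (k + j)) (stageOut D arcs c (rep k D arcs bits c j) j)).1 w = 0 ∧
      c b = j + 1 ∧
      ((c u = j + 2 ∧ (u, b) ∈ arcs ∧ w = rep k D arcs bits c j b ∧ c w ≤ j + 1) ∨
        (c w = j + 2 ∧ (w, b) ∈ arcs ∧ u = rep k D arcs bits c j b ∧ c u ≤ j + 1)) := by
  rcases point_spec (bits (k + j)) (stageOut D arcs c (rep k D arcs bits c j) j) u with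
    h | ⟨w, b, hm, hu, hw, h1, h2⟩
  · exact .inl h
  · refine .inr ⟨w, b, h1, h2, ?_, ?_⟩
    · rcases point_spec (bits (k + j)) (stageOut D arcs c (rep k D arcs bits c j) j) w with
        h | ⟨w', b', hm', hw', -⟩
      · exact h.1
      · rw [hw] at hw'; cases hw'
    · rcases mem_of_mem_peel hm with hm | hm
      · obtain ⟨h1, h2, h3, h4⟩ := of_mem_stageEdges hm
        simp only at h1 h2 h3 h4
        have := (rep_class (k := k) (D := D) (arcs := arcs) (bits := bits) j b).2 h3.le
        exact ⟨h3, .inl ⟨h2, h1, h4, h4 ▸ this⟩⟩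
      · obtain ⟨h1, h2, h3, h4⟩ := of_mem_stageEdges hm
        simp only [Entry.swap] at h1 h2 h3 h4
        have := (rep_class (k := k) (D := D) (arcs := arcs) (bits := bits) j b).2 h3.le
        exact ⟨h3, .inr ⟨h2, h1, h4, h4 ▸ this⟩⟩

theorem back_spec {a j x : ℕ} (hx : c x = j + 2) (ha : c a = 1)
    (h : rep k D arcs bits c (j + 1) x = rep k D arcs bits c (j + 1) a) :
    c (back k D arcs bits c a j x) = j + 1 ∧
      rep k D arcs bits c j (back k D arcs bits c a j x) = rep k D arcs bits c j a ∧
      (x, back k D arcs bits c a j x) ∈ arcs := by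
  have hrx : rep k D arcs bits c j x = x := (rep_class j x).1 (by omega)
  have hra : c (rep k D arcs bits c j a) ≤ j + 1 := (rep_class j a).2 (by omega)
  simp only [rep, newRep] at h
  have e1 : hist k D arcs bits c j x =
      (point (bits (k + j)) (stageOut D arcs c (rep k D arcs bits c j) j)).2 x := by
    rw [hist, hrx]
  rw [back, e1, hist]
  rw [hrx] at h
  rcases point_stage (k := k) (D := D) (arcs := arcs) (bits := bits) (c := c) j x with
    ⟨h1, h2⟩ | ⟨w, b, h1, h2, h3, h4, h5⟩ <;>
  rcases point_stage (k := k) (D := D) (arcs := arcs) (bits := bits) (c := c) j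
    (rep k D arcs bits c j a) with ⟨g1, g2⟩ | ⟨w', b', g1, g2, g3, g4, g5⟩
  · simp only [h1, g1, if_true] at h
    rw [← h] at hra; omega
  · simp only [h1, g1, if_true] at h
    simp only [h2, g2, if_true]
    grind
  · grind
  · grind

end Stage

end CycleSearch

namespace CycleSearch

/-! ### Graphs and their arcs -/

/-- The list contains exactly the pairs of adjacent vertices. -/
def IsArcs {n : ℕ} (G : SimpleGraph (Fin n)) (arcs : List (ℕ × ℕ)) : Prop :=
  ∀ e : ℕ × ℕ, e ∈ arcs ↔ ∃ u v : Fin n, G.Adj u v ∧ e = (u.1, v.1)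

/-- Vertices with the same representative are joined by a path of such vertices. -/
def FibresConnected {n : ℕ} (G : SimpleGraph (Fin n)) (r : ℕ → ℕ) : Prop :=
  ∀ u v : Fin n, r u = r v →
    Relation.ReflTransGen (fun a b : Fin n => G.Adj a b ∧ r a = r b) u v

/-- Every minor of the graph has at most `d` times as many edges as vertices. -/
def SparseMinors {n : ℕ} (d : ℕ) (G : SimpleGraph (Fin n)) : Prop :=
  ∀ (V : Type) [Fintype V] (H : SimpleGraph V), IsGraphMinor H G →
    H.edgeSet.ncard ≤ d * Fintype.card V

section

variable {n : ℕ} {G : SimpleGraph (Fin n)} {arcs : List (ℕ × ℕ)}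

theorem fibresConnected_id : FibresConnected G id := by
  intro u v h
  rw [Fin.ext h]

/-- A list of distinct edges of a contraction is sparse. -/
theorem SparseMinors.sparseList {d : ℕ} (hG : SparseMinors d G) (hA : IsArcs G arcs) {r : ℕ → ℕ}
    (hr : FibresConnected G r) {L : List Entry}
    (h1 : ∀ t ∈ L, (t.1, t.2.2) ∈ arcs ∧ r t.1 = t.1 ∧ r t.2.2 = t.2.1)
    (h2 : (L.map fun t => (t.1, t.2.1)).Nodup)
    (h3 : ∀ t ∈ L, ∀ t' ∈ L, ¬ (t.1 = t'.2.1 ∧ t.2.1 = t'.1)) : SparseList d L := by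
  classical
  intro X L' hL' hX
  set Y : Finset ℕ := X.filter fun a => ∃ v : Fin n, r v = a with hY
  have hend : ∀ t ∈ L', t.1 ∈ Y ∧ t.2.1 ∈ Y := by
    intro t ht
    obtain ⟨ha, hr1, hr2⟩ := h1 t (hL'.subset ht)
    obtain ⟨u, v, huv, he⟩ := (hA _).1 ha
    rw [Prod.mk.injEq] at he
    simp only [hY, Finset.mem_filter]
    exact ⟨⟨(hX t ht).1, u, by rw [← he.1, hr1]⟩, ⟨(hX t ht).2, v, by rw [← he.2, hr2]⟩⟩
  let H : SimpleGraph Y :=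
    { Adj := fun a b => a ≠ b ∧ ∃ t ∈ L', s(t.1, t.2.1) = s(a.1, b.1)
      symm := ⟨fun a b ⟨h, t, ht, e⟩ => ⟨h.symm, t, ht, e.trans Sym2.eq_swap⟩⟩
      loopless := ⟨fun a h => h.1 rfl⟩ }
  have hmin : IsGraphMinor H G := by
    refine ⟨fun a => {v | r v = a}, fun a => ?_, fun a b hab => ?_, ?_⟩
    · rw [SimpleGraph.connected_induce_iff_reflTransGen]
      refine ⟨(Finset.mem_filter.1 a.2).2, fun u hu v hv => ?_⟩
      have h := hr u v (hu.out.trans hv.out.symm)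
      clear hv
      induction h with
      | refl => exact .refl
      | tail hab h ih =>
        refine ih.tail ?_
        have hc : ∀ w, Relation.ReflTransGen (fun a b : Fin n => G.Adj a b ∧ r a = r b) u w →
            r w = a := by
          intro w hw
          induction hw with
          | refl => exact hu
          | tail _ h ih => exact h.2.symm.trans ih
        exact ⟨h.1, hc _ hab, hc _ (hab.tail h)⟩
    · rw [Set.disjoint_left]
      intro x hx hx'
      exact hab (Subtype.ext (hx.out.symm.trans hx'.out))
    · rintro a b ⟨-, t, ht, e⟩
      obtain ⟨ha, hr1, hr2⟩ := h1 t (hL'.subset ht)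
      obtain ⟨u, v, huv, he⟩ := (hA _).1 ha
      rw [Prod.mk.injEq] at he
      rw [he.1] at hr1
      rw [he.2] at hr2
      rcases Sym2.eq_iff.1 e with ⟨e1, e2⟩ | ⟨e1, e2⟩
      · exact ⟨u, hr1.trans (he.1.symm.trans e1), v, hr2.trans e2, huv⟩
      · exact ⟨v, hr2.trans e2, u, hr1.trans (he.1.symm.trans e1), huv.symm⟩
  have hcard := hG Y H hmin
  have hle : L'.length ≤ H.edgeSet.ncard := by
    have hnd : (L'.map fun t => s(t.1, t.2.1)).Nodup := by
      rw [List.nodup_map_iff_inj_on]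
      · intro t ht t' ht' e
        rcases Sym2.eq_iff.1 e with ⟨e1, e2⟩ | ⟨e1, e2⟩
        · exact List.inj_on_of_nodup_map h2 (hL'.subset ht) (hL'.subset ht')
            (Prod.ext e1 e2)
        · exact absurd ⟨e1, e2⟩ (h3 t (hL'.subset ht) t' (hL'.subset ht'))
      · exact (List.Nodup.of_map _ h2).sublist hL'
    have hsub : ((L'.map fun t => s(t.1, t.2.1)).toFinset : Set (Sym2 ℕ)) ⊆
        Sym2.map Subtype.val '' H.edgeSet := by
      intro e he
      simp only [List.coe_toFinset, List.mem_map, Set.mem_ofPred_eq] at he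
      obtain ⟨t, ht, rfl⟩ := he
      refine ⟨s(⟨t.1, (hend t ht).1⟩, ⟨t.2.1, (hend t ht).2⟩), ⟨?_, t, ht, rfl⟩, rfl⟩
      intro e
      have e' : t.1 = t.2.1 := congrArg Subtype.val e
      exact h3 t (hL'.subset ht) t (hL'.subset ht) ⟨e', e'.symm⟩
    have h4 := Set.ncard_le_ncard hsub (Set.toFinite _)
    rw [Set.ncard_coe_finset, List.toFinset_card_of_nodup hnd, List.length_map] at h4
    exact h4.trans (Set.ncard_image_le (Set.toFinite _))
  rw [Fintype.card_coe] at hcard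
  exact hle.trans (hcard.trans (Nat.mul_le_mul_left d (Finset.card_filter_le _ _)))

theorem SparseMinors.sparseList_orient {d : ℕ} (hG : SparseMinors d G) (hA : IsArcs G arcs) :
    SparseList d (collect (fun x b => decide (x < b)) id arcs) := by
  have h : ∀ t ∈ collect (fun x b => decide (x < b)) id arcs,
      (t.1, t.2.2) ∈ arcs ∧ t.1 < t.2.1 ∧ t.2.2 = t.2.1 := by
    intro t ht
    obtain ⟨h1, h2, h3⟩ := of_mem_collect ht
    simp only [decide_eq_true_eq, id] at h2 h3
    exact ⟨h1, by omega, h3.symm⟩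
  refine hG.sparseList hA fibresConnected_id (fun t ht => ?_) (nodup_collect _ _ _) ?_
  · obtain ⟨h1, -, h2⟩ := h t ht
    exact ⟨h1, rfl, h2⟩
  · intro t ht t' ht' e
    have h1 := (h t ht).2.1
    have h2 := (h t' ht').2.1
    omega

variable {k D : ℕ} {bits : ℕ → ℕ → Bool} {c : ℕ → ℕ}

theorem fibresConnected_rep (hA : IsArcs G arcs) (j : ℕ) :
    FibresConnected G (rep k D arcs bits c j) := by
  induction j with
  | zero => exact fibresConnected_id
  | succ j ih =>
    intro u v huv
    rw [rep] at huv ⊢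
    set r := rep k D arcs bits c j with hr
    set p := (point (bits (k + j)) (stageOut D arcs c r j)).1 with hp
    have hlift : ∀ u v : Fin n, r u = r v → Relation.ReflTransGen
        (fun a b : Fin n => G.Adj a b ∧ newRep p r a = newRep p r b) u v := by
      intro u v h
      refine (ih u v h).lift id fun a b hab => ⟨hab.1, ?_⟩
      rw [id, id, newRep, newRep, hab.2]
    have hgo : ∀ u : Fin n, ∃ z : Fin n, r z = newRep p r u ∧ Relation.ReflTransGen
        (fun a b : Fin n => G.Adj a b ∧ newRep p r a = newRep p r b) u z ∧ Relation.ReflTransGen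
        (fun a b : Fin n => G.Adj a b ∧ newRep p r a = newRep p r b) z u := by
      intro u
      rcases point_stage (k := k) (D := D) (arcs := arcs) (bits := bits) (c := c) j (r u) with
        ⟨h1, -⟩ | ⟨w, b, h1, -, h2, hb, h3⟩
      · have hpu : p (r u) = 0 := h1
        exact ⟨u, by rw [newRep]; simp [hpu], .refl, .refl⟩
      · obtain ⟨y, z, hyz, hy, hz⟩ : ∃ y z : Fin n, G.Adj y z ∧ r y = r u ∧ r z = w := by
          rcases h3 with ⟨h4, h5, h6, -⟩ | ⟨h4, h5, h6, -⟩
          · obtain ⟨x, b', hxb, he⟩ := (hA _).1 h5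
            rw [Prod.mk.injEq] at he
            refine ⟨x, b', hxb, ?_, by rw [h6, he.2]⟩
            rw [← he.1]
            exact (rep_class j (r u)).1 (by omega)
          · obtain ⟨x, b', hxb, he⟩ := (hA _).1 h5
            rw [Prod.mk.injEq] at he
            refine ⟨b', x, hxb.symm, by rw [h6, he.2], ?_⟩
            rw [← he.1]
            exact (rep_class j w).1 (by omega)
        have hpu : p (r u) = w + 1 := h1
        have hpw : p w = 0 := h2
        have e1 : newRep p r u = w := by rw [newRep]; simp [hpu]
        have e2 : newRep p r y = w := by rw [newRep, hy]; simp [hpu]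
        have e3 : newRep p r z = w := by rw [newRep, hz]; simp [hpw]
        exact ⟨z, by rw [hz, e1], (hlift u y hy.symm).tail ⟨hyz, e2.trans e3.symm⟩,
          .head ⟨hyz.symm, e3.trans e2.symm⟩ (hlift y u hy)⟩
    obtain ⟨z, hz, h1, -⟩ := hgo u
    obtain ⟨z', hz', -, h2⟩ := hgo v
    exact (h1.trans (hlift z z' (by rw [hz, hz', huv]))).trans h2

theorem SparseMinors.sparseList_stageEdges {d : ℕ} (hG : SparseMinors d G) (hA : IsArcs G arcs)
    (j : ℕ) : SparseList d (stageEdges arcs c (rep k D arcs bits c j) j) := by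
  refine hG.sparseList hA (fibresConnected_rep (k := k) (D := D) (bits := bits) (c := c) hA j)
    (fun t ht => ?_) (nodup_collect _ _ _) ?_
  · obtain ⟨h1, h2, h3, h4⟩ := of_mem_stageEdges ht
    exact ⟨h1, (rep_class j _).1 (by omega), h4.symm⟩
  · intro t ht t' ht' e
    obtain ⟨h1, h2, h3, h4⟩ := of_mem_stageEdges ht
    obtain ⟨h1', h2', h3', h4'⟩ := of_mem_stageEdges ht'
    have := (rep_class (k := k) (D := D) (arcs := arcs) (bits := bits) j _).2 h3'.le
    rw [← h4', ← e.1] at this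
    omega

theorem SparseMinors.length_le {d : ℕ} (hG : SparseMinors d G) : G.edgeSet.ncard ≤ d * n := by
  simpa using hG (Fin n) G (.of_injective id Function.injective_id fun _ _ h => h)

/-! ### Completeness of a trial -/

/-- The colours at the ends of an edge fit together. -/
theorem not_badPair_of_mem_arcs {d : ℕ} (hG : SparseMinors d G) (hA : IsArcs G arcs)
    (hD : 4 * d ≤ D) {e : ℕ × ℕ} (he : e ∈ arcs) :
    badPair k (cleanColour k D arcs bits e.1) (cleanColour k D arcs bits e.2) = false := by
  have hsymm : ∀ a b, badPair k a b = badPair k b a := by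
    intro a b
    simp only [badPair, decide_eq_decide]
    tauto
  have key : ∀ u v, (∃ b, (u, v, b) ∈ orient D arcs) →
      badPair k (cleanColour k D arcs bits u) (cleanColour k D arcs bits v) = false := by
    rintro u v ⟨b, hb⟩
    by_contra hbad
    rw [Bool.not_eq_false] at hbad
    have hu : cleanColour k D arcs bits u ≠ 0 := fun h => by simp [badPair, h] at hbad
    have hv : cleanColour k D arcs bits v ≠ 0 := fun h => by simp [badPair, h] at hbad
    rcases clean_spec (badPair k) (colour bits k) (orient D arcs) u with h | h
    · exact hu h.1
    rcases clean_spec (badPair k) (colour bits k) (orient D arcs) v with h' | h'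
    · exact hv h'.1
    have := h.2 _ hb rfl
    rw [cleanColour, h.1, h'.1] at hbad
    exact this hbad
  have key2 : ∀ u v, (u, v) ∈ arcs → u < v →
      badPair k (cleanColour k D arcs bits u) (cleanColour k D arcs bits v) = false := by
    intro u v huv hlt
    obtain ⟨b, hb⟩ := exists_mem_collect (cond := fun x b => decide (x < b)) (rep := id) huv
      (by simpa using hlt)
    rcases (hG.sparseList_orient hA).mem_peel hD hb with h | h
    · exact key u v ⟨b, h⟩
    · rw [hsymm]
      exact key v u ⟨b, h⟩
  obtain ⟨u, v, huv, rfl⟩ := (hA e).1 he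
  rcases lt_or_gt_of_ne (fun h => huv.ne (Fin.ext h) : (u : ℕ) ≠ v) with hlt | hlt
  · exact key2 _ _ he hlt
  · rw [hsymm]
    exact key2 _ _ ((hA _).2 ⟨v, u, huv.symm, rfl⟩) hlt

/-- The heads of the edges with a given tail. -/
noncomputable def heads (L : List Entry) (u : ℕ) : Finset ℕ :=
  ((L.filter fun t => t.1 = u).map fun t => t.2.1).toFinset

theorem mem_heads {L : List Entry} {t : Entry} (ht : t ∈ L) : t.2.1 ∈ heads L t.1 := by
  simp only [heads, List.mem_toFinset, List.mem_map, List.mem_filter, decide_eq_true_eq]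
  exact ⟨t, ⟨ht, rfl⟩, rfl⟩

theorem card_heads_le (D : ℕ) (L : List Entry) (u : ℕ) : (heads (peel D L) u).card ≤ D := by
  refine (List.toFinset_card_le _).trans ?_
  rw [List.length_map, ← List.countP_eq_length_filter]
  exact countP_peel_le D L u

/-- The vertices whose colours matter for a cycle. -/
noncomputable def critical (D : ℕ) (arcs : List (ℕ × ℕ)) (k : ℕ) (y : ℕ → ℕ) : Finset ℕ :=
  (Finset.range k).biUnion fun i => insert (y i) (heads (orient D arcs) (y i))

theorem card_critical_le (D : ℕ) (arcs : List (ℕ × ℕ)) (k : ℕ) (y : ℕ → ℕ) :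
    (critical D arcs k y).card ≤ k * (D + 1) := by
  simpa [critical] using Finset.card_biUnion_le_card_mul (Finset.range k)
    (fun i => insert (y i) (heads (orient D arcs) (y i))) (D + 1)
    fun i _ => (Finset.card_insert_le _ _).trans (Nat.succ_le_succ (card_heads_le D _ _))

/-- The colours are correct on the cycle `y` and avoid its surroundings. -/
theorem cleanColour_eq {y : ℕ → ℕ} (hy : ∀ i < k, ∀ j < k, y i = y j → i = j)
    (hind : ∀ i < k, ∀ j < k, (y i, y j) ∈ arcs → badPair k (i + 1) (j + 1) = false)
    (hA : ∀ t ∈ orient D arcs, (t.1, t.2.1) ∈ arcs)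
    (hbits : ∀ i < k, ∀ v ∈ critical D arcs k y, bits i v = decide (v = y i)) {i : ℕ} (hi : i < k) :
    cleanColour k D arcs bits (y i) = i + 1 := by
  have hcol : ∀ j < k, colour bits k (y j) = j + 1 := by
    intro j hj
    refine colour_eq hj fun i hi => ?_
    rw [hbits i hi (y j) (Finset.mem_biUnion.2 ⟨j, Finset.mem_range.2 hj,
      Finset.mem_insert_self _ _⟩), decide_eq_decide]
    exact ⟨fun h => (hy _ hj _ hi h).symm, fun h => h ▸ rfl⟩
  rcases clean_spec (badPair k) (colour bits k) (orient D arcs) (y i) with h | h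
  · obtain ⟨-, t, ht, hti, hbad⟩ := h
    have hmem : t.2.1 ∈ critical D arcs k y := Finset.mem_biUnion.2 ⟨i, Finset.mem_range.2 hi,
      Finset.mem_insert_of_mem (hti ▸ mem_heads ht)⟩
    by_cases hex : ∃ j < k, t.2.1 = y j
    · obtain ⟨j, hj, e⟩ := hex
      have harc := hA t ht
      rw [hti, e] at harc hbad
      rw [hcol i hi, hcol j hj, hind i hi j hj harc] at hbad
      cases hbad
    · have : colour bits k t.2.1 = 0 := colour_eq_zero fun j hj => by
        rw [hbits j hj _ hmem, decide_eq_false_iff_not]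
        exact fun h => hex ⟨j, hj, h⟩
      rw [this] at hbad
      simp [badPair] at hbad
  · rw [cleanColour, h.1, hcol i hi]

theorem IsArcs.lt (hA : IsArcs G arcs) {e : ℕ × ℕ} (he : e ∈ arcs) : e.1 < n ∧ e.2 < n := by
  obtain ⟨u, v, -, rfl⟩ := (hA e).1 he
  exact ⟨u.2, v.2⟩

theorem rep_lt (hA : IsArcs G arcs) (j : ℕ) {v : ℕ} (hv : v < n) :
    rep k D arcs bits c j v < n := by
  induction j generalizing v with
  | zero => exact hv
  | succ j ih =>
    rw [rep, newRep]
    rcases point_stage (k := k) (D := D) (arcs := arcs) (bits := bits) (c := c) j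
      (rep k D arcs bits c j v) with ⟨h1, -⟩ | ⟨w, b, h1, -, -, -, h⟩
    · rw [if_pos h1]
      exact ih hv
    · rw [if_neg (by omega), h1, Nat.add_sub_cancel]
      rcases h with ⟨-, h, h', -⟩ | ⟨-, h, -, -⟩
      · exact h' ▸ ih (hA.lt h).2
      · exact (hA.lt h).1

/-- With few random bits as prescribed, an edge is contracted. -/
theorem exists_good_marks {d : ℕ} (hG : SparseMinors d G) (hA : IsArcs G arcs) (hD : 4 * d ≤ D)
    {j x b a : ℕ} (hx : c x = j + 2) (hb : c b = j + 1) (hxb : (x, b) ∈ arcs)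
    (hr : rep k D arcs bits c j b = rep k D arcs bits c j a) :
    ∃ (S : Finset ℕ) (w : ℕ), S.card ≤ D + 1 ∧ w < n ∧ ∀ bits' : ℕ → ℕ → Bool,
      (∀ i < k + j, bits' i = bits i) → (∀ v ∈ S, bits' (k + j) v = decide (v = w)) →
      rep k D arcs bits' c (j + 1) x = rep k D arcs bits' c (j + 1) a := by
  have hrx : rep k D arcs bits c j x = x := (rep_class j x).1 (by omega)
  have hrb : c (rep k D arcs bits c j b) ≤ j + 1 := (rep_class j b).2 (by omega)
  have hbn : rep k D arcs bits c j b < n := rep_lt hA j (hA.lt hxb).2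
  have hcongr : ∀ bits' : ℕ → ℕ → Bool, (∀ i < k + j, bits' i = bits i) →
      rep k D arcs bits' c j = rep k D arcs bits c j := fun _ h => rep_congr h
  simp only [rep]
  set r := rep k D arcs bits c j with hrdef
  set L := stageOut D arcs c r j with hL
  have key : ∀ t ∈ L, t.1 ≠ t.2.1 → ∃ S : Finset ℕ, S.card ≤ D + 1 ∧ ∀ mark : ℕ → Bool,
      (∀ v ∈ S, mark v = decide (v = t.2.1)) →
        (point mark L).1 t.1 = t.2.1 + 1 ∧ (point mark L).1 t.2.1 = 0 := by
    intro t ht hne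
    refine ⟨insert t.1 (heads L t.1), (Finset.card_insert_le _ _).trans
      (Nat.succ_le_succ (card_heads_le D _ _)), fun mark h => ?_⟩
    have h2 : mark t.2.1 = true := by
      rw [h _ (Finset.mem_insert_of_mem (mem_heads ht))]; simp
    have h1 : mark t.1 = false := by
      rw [h _ (Finset.mem_insert_self _ _)]; simpa using hne
    refine ⟨point_eq ht h1 h2 fun s hs hst hne' => ?_, ?_⟩
    · rw [h _ (Finset.mem_insert_of_mem (hst ▸ mem_heads hs))]; simpa using hne'
    · rcases point_spec mark L t.2.1 with h | ⟨_, _, _, h, _⟩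
      · exact h.1
      · rw [h2] at h; cases h
  obtain ⟨b', hb'⟩ := exists_mem_collect (cond := stageCond c j) (rep := r) hxb
    (by simp [stageCond, hx, hb])
  have hne : x ≠ r b := fun h => by rw [← h] at hrb; omega
  have hsp := hG.sparseList_stageEdges (k := k) (D := D) (bits := bits) (c := c) hA j
  rcases hsp.mem_peel hD hb' with ht | ht
  · obtain ⟨S, hS, h⟩ := key _ ht hne
    refine ⟨S, r b, hS, hbn, fun bits' hc hm => ?_⟩
    obtain ⟨h1, h2⟩ := h _ hm
    rw [hcongr bits' hc]
    simp only [newRep, hrx, ← hr, ← hL, h2, h1]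
    simp
  · obtain ⟨S, hS, h⟩ := key _ ht hne.symm
    refine ⟨S, x, hS, (hA.lt hxb).1, fun bits' hc hm => ?_⟩
    obtain ⟨h1, h2⟩ := h _ hm
    rw [hcongr bits' hc]
    simp only [Entry.swap] at h1 h2
    simp only [newRep, hrx, ← hr, ← hL, h2, h1]
    simp

end

end CycleSearch

namespace CycleSearch

open RAM

attribute [simp] Prog.eval Instr.exec Test.Holds Prog.WritesReg Prog.WritesMem Prog.Tosses
  Prog.LoopFree Instr.WritesReg Instr.WritesMem Instr.Tosses State.setReg

/-! ### The machine programs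

Registers: `0` number of vertices, `1` number of arcs, `2` loop counter, `3` success flag, `4` zero,
`20` length of the current list of edges, `21` length of the list of oriented edges, `30` and `31`
the closing arc, `32` the current vertex of the cycle; the others are used for
intermediate results.

Arrays: `3` tails of the arcs, `4` colours, `5` stamps, `6` to `8` current list of edges, `9` to `11`
oriented edges, `12` degrees, `13` and `14` pointers, `15` representatives, `16` marks,
`17` cleaned colours, `20 + j` history of stage `j`. -/

theorem _root_.RAM.Prog.LoopFree.agree {ω : ℕ → Bool} {p : Prog} (hp : p.LoopFree) (σ : State) :
    Agree p σ (p.eval ω σ) := by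
  obtain ⟨s, t, hr, -, rfl⟩ := hp.ends (ω := ω) (σ := σ) (Q := fun s => s = p.eval ω σ) rfl
  exact hr.agree

/-- Three arrays hold the components of the entries of a list. -/
def Stores (σ : State) (a b c : ℕ) (L : List Entry) : Prop :=
  ∀ q t, L[q]? = some t → σ.mem a q = t.1 ∧ σ.mem b q = t.2.1 ∧ σ.mem c q = t.2.2

theorem Stores.congr {σ σ' : State} {a b c : ℕ} {L : List Entry} (h : Stores σ a b c L)
    (ha : σ'.mem a = σ.mem a) (hb : σ'.mem b = σ.mem b) (hc : σ'.mem c = σ.mem c) :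
    Stores σ' a b c L := by
  intro q t ht
  rw [ha, hb, hc]
  exact h q t ht

theorem Stores.nil (σ : State) (a b c : ℕ) : Stores σ a b c [] := by
  intro q t ht; simp at ht

theorem Stores.concat {σ σ' : State} {a b c : ℕ} {L : List Entry} {t : Entry}
    (h : Stores σ a b c L) (ha : σ'.mem a = Function.update (σ.mem a) L.length t.1)
    (hb : σ'.mem b = Function.update (σ.mem b) L.length t.2.1)
    (hc : σ'.mem c = Function.update (σ.mem c) L.length t.2.2) : Stores σ' a b c (L ++ [t]) := by
  intro q s hs
  rw [ha, hb, hc]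
  rcases lt_trichotomy q L.length with hq | rfl | hq
  · rw [List.getElem?_append_left hq] at hs
    simpa [Function.update_of_ne hq.ne] using h q s hs
  · simp at hs
    simp [hs]
  · rw [List.getElem?_eq_none (by simp; omega)] at hs
    cases hs

/-- The input of a trial. -/
structure Input (n : ℕ) (arcs : List (ℕ × ℕ)) (σ : State) : Prop where
  size : σ.reg 0 = n
  numArcs : σ.reg 1 = arcs.length
  zero : σ.reg 4 = 0
  ends : ∀ (q : ℕ) (e : ℕ × ℕ), arcs[q]? = some e → σ.mem 3 q = e.1 ∧ σ.mem 1 q = e.2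

theorem Input.agree {n : ℕ} {arcs : List (ℕ × ℕ)} {σ σ' : State} {p : Prog} (h : Input n arcs σ)
    (ha : Agree p σ σ') (h0 : ¬ p.WritesReg 0) (h1 : ¬ p.WritesReg 1) (h4 : ¬ p.WritesReg 4)
    (hm1 : ¬ p.WritesMem 1) (hm3 : ¬ p.WritesMem 3) : Input n arcs σ' := by
  refine ⟨?_, ?_, ?_, ?_⟩
  · rw [ha.reg 0 h0, h.size]
  · rw [ha.reg 1 h1, h.numArcs]
  · rw [ha.reg 4 h4, h.zero]
  · rw [ha.mem 1 hm1, ha.mem 3 hm3]; exact h.ends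

/-! #### Initialization and coin tosses -/

def initBody : Prog := .instr (.store 15 2 2) ;; .instr (.store 4 2 4)

def initProg : Prog := forLoop 2 0 initBody

theorem ends_initProg (ω : ℕ → Bool) {σ : State} (h4 : σ.reg 4 = 0) :
    Ends ω initProg σ ((initBody.size + 2) * σ.reg 0 + 2) fun σ' =>
      (∀ v < σ.reg 0, σ'.mem 15 v = v) ∧ ∀ v < σ.reg 0, σ'.mem 4 v = 0 := by
  refine Ends.forLoop (fun m σ' => (∀ v < m, σ'.mem 15 v = v) ∧ ∀ v < m, σ'.mem 4 v = 0)
    (by simp [initBody]) (by simp [initBody]) (by simp [initBody]) (by simp) (by simp) ?_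
  rintro m σ' ha hm hlt ⟨h1, h2⟩
  have h4' : σ'.reg 4 = 0 := by rw [ha.reg 4 (by simp [forLoop, initBody]), h4]
  simp only [initBody, Prog.eval, Instr.exec, State.setReg]
  refine ⟨fun v hv => ?_, fun v hv => ?_⟩
  · by_cases hvm : v = m
    · simp [hm, hvm]
    · simpa [hm, hvm] using h1 v (by omega)
  · by_cases hvm : v = m
    · simp [hm, hvm, h4']
    · simpa [hm, hvm] using h2 v (by omega)

def clearBody : Prog :=
  .instr (.store 5 2 4) ;; .instr (.store 13 2 4) ;; .instr (.store 14 2 4)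

def clearProg : Prog := forLoop 2 0 clearBody

theorem ends_clearProg (ω : ℕ → Bool) {σ : State} (h4 : σ.reg 4 = 0) :
    Ends ω clearProg σ ((clearBody.size + 2) * σ.reg 0 + 2) fun σ' =>
      ∀ v < σ.reg 0, σ'.mem 5 v = 0 ∧ σ'.mem 13 v = 0 ∧ σ'.mem 14 v = 0 := by
  refine Ends.forLoop (fun m σ' => ∀ v < m, σ'.mem 5 v = 0 ∧ σ'.mem 13 v = 0 ∧ σ'.mem 14 v = 0)
    (by simp [clearBody]) (by simp [clearBody]) (by simp [clearBody]) (by simp) (by simp) ?_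
  rintro m σ' ha hm hlt h1 v hv
  have h4' : σ'.reg 4 = 0 := by rw [ha.reg 4 (by simp [forLoop, clearBody]), h4]
  by_cases hvm : v = m
  · simp [clearBody, hm, hvm, h4']
  · simpa [clearBody, hm, hvm] using h1 v (by omega)

def markBody : Prog := .instr (.toss 5) ;; .instr (.store 16 2 5)

def markProg : Prog := forLoop 2 0 markBody

theorem ends_markProg (ω : ℕ → Bool) {σ : State} :
    Ends ω markProg σ ((markBody.size + 2) * σ.reg 0 + 2) fun σ' =>
      (∀ v < σ.reg 0, σ'.mem 16 v = (ω (σ.coins + v)).toNat) ∧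
        σ'.coins = σ.coins + σ.reg 0 := by
  refine Ends.forLoop (fun m σ' => (∀ v < m, σ'.mem 16 v = (ω (σ.coins + v)).toNat) ∧
    σ'.coins = σ.coins + m)
    (by simp [markBody]) (by simp [markBody]) (by simp [markBody]) (by simp) (by simp) ?_
  rintro m σ' ha hm hlt ⟨h1, h2⟩
  refine ⟨fun v hv => ?_, by simp [markBody, h2]; omega⟩
  by_cases hvm : v = m
  · simp [markBody, hm, hvm, h2]
  · simpa [markBody, hm, hvm] using h1 v (by omega)

def colourBody (i : ℕ) : Prog :=
  .instr (.toss 5) ;; .cond (.lt 4 5) (.instr (.const 6 (i + 1)) ;; .instr (.store 4 2 6)) (.instr .skip)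

/-- Colour the vertices with the colours up to `k`. -/
def colourProg : ℕ → Prog
  | 0 => .instr .skip
  | i + 1 => colourProg i ;; forLoop 2 0 (colourBody i)

theorem colourProg_writesReg (k r : ℕ) : (colourProg k).WritesReg r → r = 2 ∨ r = 5 ∨ r = 6 := by
  induction k with
  | zero => simp [colourProg]
  | succ k ih => simp [colourProg, forLoop, colourBody]; tauto

theorem colourProg_writesMem (k r : ℕ) : (colourProg k).WritesMem r → r = 4 := by
  induction k with
  | zero => simp [colourProg]
  | succ k ih => simp [colourProg, forLoop, colourBody]; tauto

/-- The bits that are tossed in a trial that starts after `c` tosses. -/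
def coinBits (ω : ℕ → Bool) (n c r v : ℕ) : Bool := decide (v < n) && ω (c + r * n + v)

theorem ends_colourRow (ω : ℕ → Bool) (i : ℕ) {σ : State} (h4 : σ.reg 4 = 0) (f : ℕ → ℕ)
    (hf : ∀ v < σ.reg 0, σ.mem 4 v = f v) :
    Ends ω (forLoop 2 0 (colourBody i)) σ (((colourBody i).size + 2) * σ.reg 0 + 2) fun σ' =>
      (∀ v < σ.reg 0, σ'.mem 4 v = if ω (σ.coins + v) then i + 1 else f v) ∧
        σ'.coins = σ.coins + σ.reg 0 := by
  refine Ends.forLoop (fun m σ' => (∀ v < m, σ'.mem 4 v = if ω (σ.coins + v) then i + 1 else f v) ∧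
    (∀ v < σ.reg 0, m ≤ v → σ'.mem 4 v = f v) ∧ σ'.coins = σ.coins + m)
    (by simp [colourBody]) (by simp [colourBody]) (by simp [colourBody]) (by simp) ?_ ?_ |>.mono
    le_rfl fun σ' _ h => ⟨h.1, h.2.2⟩
  · exact ⟨by simp, fun v hv _ => hf v hv, rfl⟩
  rintro m σ' ha hm hlt ⟨h1, h2, h3⟩
  have h4' : σ'.reg 4 = 0 := by rw [ha.reg 4 (by simp [forLoop, colourBody]), h4]
  cases hω : ω (σ.coins + m)
  · refine ⟨fun v hv => ?_, fun v hv hmv => ?_, ?_⟩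
    · by_cases hvm : v = m
      · subst hvm
        simpa [colourBody, hm, h3, hω, h4'] using h2 v hlt le_rfl
      · simpa [colourBody, hm, h3, hω, h4'] using h1 v (by omega)
    · simpa [colourBody, hm, h3, hω, h4'] using h2 v hv (by omega)
    · simp [colourBody, h3, hω, h4']; omega
  · refine ⟨fun v hv => ?_, fun v hv hmv => ?_, ?_⟩
    · by_cases hvm : v = m
      · simp [colourBody, hm, h3, hω, h4', hvm]
      · simpa [colourBody, hm, h3, hω, h4', hvm] using h1 v (by omega)
    · simpa [colourBody, hm, h3, hω, h4', show v ≠ m by omega] using h2 v hv (by omega)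
    · simp [colourBody, h3, hω, h4']; omega

theorem ends_colourProg (ω : ℕ → Bool) (k : ℕ) {σ : State} (h4 : σ.reg 4 = 0)
    (h0 : ∀ v < σ.reg 0, σ.mem 4 v = 0) :
    Ends ω (colourProg k) σ (k * (9 * (σ.reg 0 + 1)) + 1) fun σ' =>
      (∀ v < σ.reg 0, σ'.mem 4 v = colour (coinBits ω (σ.reg 0) σ.coins) k v) ∧
        σ'.coins = σ.coins + k * σ.reg 0 := by
  induction k with
  | zero =>
    refine (Prog.LoopFree.ends (p := .instr .skip) trivial ?_).mono (by simp [Prog.size])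
      fun _ _ h => h
    simpa [colour] using h0
  | succ k ih =>
    refine (ih.seq (T' := 9 * (σ.reg 0 + 1)) fun σ' ha h => ?_).mono
      (by rw [add_mul k 1]; omega) fun _ _ h => h
    have e0 : σ'.reg 0 = σ.reg 0 := ha.reg 0 fun h => by
      rcases colourProg_writesReg k 0 h with h | h | h <;> omega
    have e4 : σ'.reg 4 = 0 := (ha.reg 4 fun h => by
      rcases colourProg_writesReg k 4 h with h | h | h <;> omega).trans h4
    refine (ends_colourRow ω k e4 _ (by rw [e0]; exact h.1)).mono ?_ ?_
    · rw [e0]; simp [colourBody, Prog.size]; omega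
    · rw [e0, h.2]
      rintro σ'' - ⟨h1, h2⟩
      exact ⟨fun v hv => by simp [h1 v hv, colour, coinBits, hv], by rw [h2]; ring⟩

end CycleSearch

namespace CycleSearch

open RAM

theorem take_succ_eq {α : Type*} {L : List α} {m : ℕ} (h : m < L.length) :
    L.take (m + 1) = L.take m ++ [L[m]] := by
  simp

theorem rel_of_mem_take {α : Type*} {R : α → α → Prop} {L : List α} (h : L.Pairwise R) {m : ℕ}
    (hm : m < L.length) {a : α} (ha : a ∈ L.take m) : R a L[m] := by
  obtain ⟨i, hi, rfl⟩ := List.mem_iff_getElem.1 ha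
  rw [List.length_take] at hi
  rw [List.getElem_take]
  exact List.pairwise_iff_getElem.1 h i m _ hm (by omega)

/-! #### Collection of edges -/

def collectHead : Prog :=
  .instr (.load 5 3 2) ;; .instr (.load 6 1 2) ;; .instr (.load 7 15 6) ;; .instr (.load 8 5 7) ;;
    .instr (.copy 9 5) ;; .instr (.inc 9)

def collectTail : Prog :=
  .cond (.lt 4 10) (.cond (.eq 8 9) (.instr .skip) (.instr (.store 5 7 9) ;;
    .instr (.store 6 20 5) ;; .instr (.store 7 20 7) ;; .instr (.store 8 20 6) ;; .instr (.inc 20)))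
    (.instr .skip)

def collectBody (cp : Prog) : Prog := collectHead ;; cp ;; collectTail

/-- Collect the edges for which the program `cp` sets register `10`. -/
def collectProg (cp : Prog) : Prog := .instr (.const 20 0) ;; forLoop 2 1 (collectBody cp)

/-- The program `cp` decides the condition on the vertices in the registers `5` and `6`. -/
structure Decides (n : ℕ) (A : State → Prop) (cp : Prog) (cond : ℕ → ℕ → Bool) : Prop where
  loopFree : cp.LoopFree
  reg : ∀ r, cp.WritesReg r → 10 ≤ r ∧ r < 20
  mem : ∀ a, ¬ cp.WritesMem a
  coins : ¬ cp.Tosses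
  eval : ∀ ω σ, A σ → σ.reg 4 = 0 → σ.reg 5 < n → σ.reg 6 < n →
    (0 < (cp.eval ω σ).reg 10 ↔ cond (σ.reg 5) (σ.reg 6) = true)

theorem Decides.agree_collectProg {n : ℕ} {A : State → Prop} {cp : Prog} {cond : ℕ → ℕ → Bool}
    (h : Decides n A cp cond) :
    (∀ r, (collectProg cp).WritesReg r → r = 2 ∨ 5 ≤ r ∧ r ≤ 20) ∧
      (∀ a, (collectProg cp).WritesMem a → 5 ≤ a ∧ a ≤ 8) ∧ ¬ (collectProg cp).Tosses := by
  refine ⟨fun r hr => ?_, fun a hm => ?_, ?_⟩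
  · by_cases hq : cp.WritesReg r
    · have := h.reg r hq
      omega
    · simp [collectProg, forLoop, collectBody, collectHead, collectTail, hq] at hr
      omega
  · have := h.mem a
    simp [collectProg, forLoop, collectBody, collectHead, collectTail, this] at hm
    omega
  · have := h.coins
    simp [collectProg, forLoop, collectBody, collectHead, collectTail, this]

/-- The stamps of the heads in a list of edges: the successor of the tail of the last edge. -/
structure Stamps (f : ℕ → ℕ) (L : List Entry) : Prop where
  le : ∀ t ∈ L, t.1 + 1 ≤ f t.2.1
  mem : ∀ l, f l ≠ 0 → ∃ t ∈ L, t.1 + 1 = f l ∧ t.2.1 = l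

theorem ends_collectProg (ω : ℕ → Bool) {n : ℕ} {arcs : List (ℕ × ℕ)} {σ : State}
    {A : State → Prop} {cp : Prog} {cond : ℕ → ℕ → Bool} {r : ℕ → ℕ}
    (hcp : Decides n A cp cond)
    (hA : ∀ σ', (∀ a, a < 5 ∨ 8 < a → σ'.mem a = σ.mem a) → A σ')
    (hσ : Input n arcs σ) (hsort : arcs.Pairwise fun e e' => e.1 ≤ e'.1)
    (hlt : ∀ e ∈ arcs, e.1 < n ∧ e.2 < n) (hr : ∀ v < n, σ.mem 15 v = r v ∧ r v < n)
    (h5 : ∀ v < n, σ.mem 5 v = 0) :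
    Ends ω (collectProg cp) σ (((collectBody cp).size + 3) * (arcs.length + 1)) fun σ' =>
      Stores σ' 6 7 8 (collect cond r arcs) ∧ σ'.reg 20 = (collect cond r arcs).length := by
  have h1 : Ends ω (.instr (.const 20 0)) σ 1 fun σ' => σ' = σ.setReg 20 0 :=
    Prog.LoopFree.ends (p := .instr (.const 20 0)) trivial rfl
  obtain ⟨hR, hM, hC⟩ := hcp.agree_collectProg
  refine (h1.seq (T' := ((collectBody cp).size + 2) * arcs.length + 2)
    (R := fun σ' => Stores σ' 6 7 8 (collect cond r arcs) ∧
      σ'.reg 20 = (collect cond r arcs).length) ?_).mono (by ring_nf; omega) fun _ _ h => h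
  rintro σ₁ - rfl
  have hN : (σ.setReg 20 0).reg 1 = arcs.length := by simpa using hσ.numArcs
  have key : ∀ r', (collectBody cp).WritesReg r' → 5 ≤ r' ∧ r' ≤ 20 := by
    intro r' h
    by_cases hq : cp.WritesReg r'
    · have := hcp.reg r' hq
      omega
    · simp [collectBody, collectHead, collectTail, hq] at h
      omega
  have hmain := Ends.forLoop (ω := ω) (i := 2) (N := 1) (p := collectBody cp)
    (σ := σ.setReg 20 0)
    (fun m σ' => Stores σ' 6 7 8 (collect cond r (arcs.take m)) ∧
      σ'.reg 20 = (collect cond r (arcs.take m)).length ∧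
      ∃ f, Stamps f (collect cond r (arcs.take m)) ∧ ∀ v < n, σ'.mem 5 v = f v)
    (by simp [collectBody, collectHead, collectTail, hcp.loopFree])
    (fun h => by have := key _ h; omega) (fun h => by have := key _ h; omega) (by simp) ?_ ?_
  · rw [hN] at hmain
    exact hmain.mono le_rfl fun σ' _ h => by simpa using And.intro h.1 h.2.1
  · refine ⟨Stores.nil _ _ _ _, by simp [collect], fun _ => 0, ⟨?_, ?_⟩, by simpa using h5⟩
    · simp [collect]
    · simp
  · rintro m σ' ha hm hmlt ⟨hst, hlen, f, hf, hf5⟩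
    rw [hN] at hmlt
    obtain ⟨hlt1, hlt2⟩ := hlt _ (List.getElem_mem hmlt)
    set e := arcs[m] with he
    have hmem : ∀ a, a < 5 ∨ 8 < a → σ'.mem a = σ.mem a := by
      intro a ha'
      rw [ha.mem a fun h => by have := hM a (Or.inr h); omega]
      rfl
    have hz : σ'.reg 4 = 0 := by
      rw [ha.reg 4 fun h => by have := hR 4 (Or.inr h); omega]
      simpa using hσ.zero
    have e3 : σ'.mem 3 m = e.1 := by
      rw [hmem 3 (by omega)]; exact (hσ.ends m e (List.getElem?_eq_getElem hmlt)).1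
    have e1 : σ'.mem 1 m = e.2 := by
      rw [hmem 1 (by omega)]; exact (hσ.ends m e (List.getElem?_eq_getElem hmlt)).2
    have e15 : σ'.mem 15 e.2 = r e.2 := by rw [hmem 15 (by omega)]; exact (hr _ hlt2).1
    have e5 : σ'.mem 5 (r e.2) = f (r e.2) := hf5 _ (hr _ hlt2).2
    obtain ⟨τ, hτ⟩ : ∃ τ, τ = collectHead.eval ω σ' := ⟨_, rfl⟩
    have hτm : τ.mem = σ'.mem := by simp [hτ, collectHead]
    have hτ4 : τ.reg 4 = 0 := by simp [hτ, collectHead, hz]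
    have hτ5 : τ.reg 5 = e.1 := by simp [hτ, collectHead, hm, e3]
    have hτ6 : τ.reg 6 = e.2 := by simp [hτ, collectHead, hm, e1]
    have hτ7 : τ.reg 7 = r e.2 := by simp [hτ, collectHead, hm, e1, e15]
    have hτ8 : τ.reg 8 = f (r e.2) := by simp [hτ, collectHead, hm, e1, e15, e5]
    have hτ9 : τ.reg 9 = e.1 + 1 := by simp [hτ, collectHead, hm, e3]
    have hτ20 : τ.reg 20 = (collect cond r (arcs.take m)).length := by
      simp [hτ, collectHead, hlen]
    obtain ⟨ρ, hρ⟩ : ∃ ρ, ρ = cp.eval ω τ := ⟨_, rfl⟩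
    have hag : Agree cp τ ρ := hρ ▸ hcp.loopFree.agree τ
    have hρr : ∀ q, q < 10 ∨ 20 ≤ q → ρ.reg q = τ.reg q := fun q hq =>
      hag.reg q fun h => by have := hcp.reg q h; omega
    have hρm : ∀ a, ρ.mem a = σ'.mem a := fun a => by rw [hag.mem a (hcp.mem a), hτm]
    have hρ10 : 0 < ρ.reg 10 ↔ cond e.1 e.2 = true := by
      have := hcp.eval ω τ (hA τ fun a ha => by rw [hτm, hmem a ha]) hτ4 (by omega) (by omega)
      rw [hρ, this, hτ5, hτ6]
    have ρ4 : ρ.reg 4 = 0 := by rw [hρr 4 (by omega), hτ4]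
    have ρ5 : ρ.reg 5 = e.1 := by rw [hρr 5 (by omega), hτ5]
    have ρ6 : ρ.reg 6 = e.2 := by rw [hρr 6 (by omega), hτ6]
    have ρ7 : ρ.reg 7 = r e.2 := by rw [hρr 7 (by omega), hτ7]
    have ρ8 : ρ.reg 8 = f (r e.2) := by rw [hρr 8 (by omega), hτ8]
    have ρ9 : ρ.reg 9 = e.1 + 1 := by rw [hρr 9 (by omega), hτ9]
    have ρ20 : ρ.reg 20 = (collect cond r (arcs.take m)).length := by
      rw [hρr 20 (by omega), hτ20]
    have heval : (collectBody cp).eval ω σ' = collectTail.eval ω ρ := by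
      simp [collectBody, ← hτ, ← hρ]
    rw [heval, take_succ_eq hmlt, collect_concat, ← he]
    set L := collect cond r (arcs.take m) with hL
    have hstamp : f (r e.2) = e.1 + 1 ↔ ∃ t ∈ L, t.1 = e.1 ∧ t.2.1 = r e.2 := by
      constructor
      · intro h
        obtain ⟨t, ht, h1, h2⟩ := hf.mem (r e.2) (by omega)
        exact ⟨t, ht, by omega, h2⟩
      · rintro ⟨t, ht, h1, h2⟩
        have hle := hf.le t ht
        obtain ⟨s, hs, h3, h4⟩ := hf.mem (r e.2) (by rw [← h2]; omega)
        have hs1 : s.1 ≤ e.1 := by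
          exact rel_of_mem_take hsort hmlt (of_mem_collect hs).1
        rw [h2] at hle
        omega
    by_cases hc : cond e.1 e.2 = true
    · by_cases hd : f (r e.2) = e.1 + 1
      · have hstep : collectStep cond r L e = L := by
          rw [collectStep, if_neg]
          rintro ⟨-, h⟩
          obtain ⟨t, ht, h'⟩ := hstamp.1 hd
          exact h t ht h'
        have hev : collectTail.eval ω ρ = ρ := by
          simp [collectTail, ρ4, hρ10, hc, ρ8, ρ9, hd]
        rw [hstep, hev]
        refine ⟨hst.congr (hρm 6) (hρm 7) (hρm 8), by simpa using ρ20, f, hf, fun v hv => ?_⟩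
        simpa [hρm] using hf5 v hv
      · have hstep : collectStep cond r L e = L ++ [(e.1, r e.2, e.2)] := by
          rw [collectStep, if_pos]
          exact ⟨hc, fun t ht h => hd (hstamp.2 ⟨t, ht, h⟩)⟩
        rw [hstep]
        refine ⟨hst.concat ?_ ?_ ?_, ?_, Function.update f (r e.2) (e.1 + 1), ⟨?_, ?_⟩, ?_⟩
        · simp [collectTail, ρ4, hρ10, hc, ρ5, ρ7, ρ8, ρ9, hd, ρ20, hρm]
        · simp [collectTail, ρ4, hρ10, hc, ρ5, ρ7, ρ8, ρ9, hd, ρ20, hρm]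
        · simp [collectTail, ρ4, hρ10, hc, ρ6, ρ7, ρ8, ρ9, hd, ρ20, hρm]
        · simp [collectTail, ρ4, hρ10, hc, ρ8, ρ9, hd, ρ20]
        · intro t ht
          rcases List.mem_append.1 ht with ht | ht
          · by_cases htl : t.2.1 = r e.2
            · rw [htl, Function.update_self]
              have : t.1 ≤ e.1 := rel_of_mem_take hsort hmlt (of_mem_collect ht).1
              omega
            · rw [Function.update_of_ne htl]
              exact hf.le t ht
          · rw [List.mem_singleton] at ht
            subst ht
            simp
        · intro l hl
          by_cases hle : l = r e.2
          · subst hle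
            exact ⟨(e.1, r e.2, e.2), by simp, by simp, rfl⟩
          · rw [Function.update_of_ne hle] at hl ⊢
            obtain ⟨t, ht, h⟩ := hf.mem l hl
            exact ⟨t, List.mem_append_left _ ht, h⟩
        · intro v hv
          by_cases hvl : v = r e.2
          · simp [collectTail, ρ4, hρ10, hc, ρ7, ρ8, ρ9, hd, hvl]
          · simpa [collectTail, ρ4, hρ10, hc, ρ7, ρ8, ρ9, hd, hvl, hρm] using hf5 v hv
    · have hstep : collectStep cond r L e = L := by
        rw [collectStep, if_neg]
        exact fun h => hc h.1
      have hev : collectTail.eval ω ρ = ρ := by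
        simp [collectTail, ρ4, hρ10, hc]
      rw [hstep, hev]
      refine ⟨hst.congr (hρm 6) (hρm 7) (hρm 8), by simpa using ρ20, f, hf, fun v hv => ?_⟩
      simpa [hρm] using hf5 v hv

/-! #### Peeling -/

def resetBody : Prog :=
  .instr (.load 5 6 2) ;; .instr (.load 6 7 2) ;; .instr (.store 12 5 4) ;; .instr (.store 12 6 4)

def countBody : Prog :=
  .instr (.load 5 6 2) ;; .instr (.load 7 12 5) ;; .instr (.inc 7) ;; .instr (.store 12 5 7) ;;
    .instr (.load 6 7 2) ;; .instr (.load 7 12 6) ;; .instr (.inc 7) ;; .instr (.store 12 6 7)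

def splitHead : Prog :=
  .instr (.load 5 6 2) ;; .instr (.load 6 7 2) ;; .instr (.load 7 8 2) ;; .instr (.load 8 12 5) ;;
    .instr (.load 9 12 6)

def splitTail : Prog :=
  .cond (.lt 23 8)
    (.cond (.lt 23 9) (.instr (.store 6 22 5) ;; .instr (.store 7 22 6) ;; .instr (.store 8 22 7) ;;
      .instr (.inc 22)) (.instr .skip))
    (.instr (.store 9 21 5) ;; .instr (.store 10 21 6) ;; .instr (.store 11 21 7) ;;
      .instr (.inc 21)) ;;
  .cond (.lt 23 9) (.instr .skip)
    (.instr (.store 9 21 6) ;; .instr (.store 10 21 5) ;; .instr (.store 11 21 7) ;;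
      .instr (.inc 21))

def splitBody : Prog := splitHead ;; splitTail

def roundProg : Prog :=
  forLoop 2 20 resetBody ;; forLoop 2 20 countBody ;; .instr (.const 22 0) ;;
    forLoop 2 20 splitBody ;; .instr (.copy 20 22)

/-- Orient the current list of edges. -/
def peelProg (D : ℕ) : Prog :=
  .instr (.const 21 0) ;; .instr (.const 23 D) ;; .loop (.lt 4 20) roundProg

theorem ends_reset (ω : ℕ → Bool) {σ : State} {L : List Entry} (hL : Stores σ 6 7 8 L)
    (h20 : σ.reg 20 = L.length) (h4 : σ.reg 4 = 0) :
    Ends ω (forLoop 2 20 resetBody) σ ((resetBody.size + 2) * L.length + 2) fun σ' =>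
      ∀ t ∈ L, σ'.mem 12 t.1 = 0 ∧ σ'.mem 12 t.2.1 = 0 := by
  have hmain := Ends.forLoop (ω := ω) (i := 2) (N := 20) (p := resetBody) (σ := σ)
    (fun m σ' => ∀ t ∈ L.take m, σ'.mem 12 t.1 = 0 ∧ σ'.mem 12 t.2.1 = 0)
    (by simp [resetBody]) (by simp [resetBody]) (by simp [resetBody]) (by simp) (by simp) ?_
  · rw [h20] at hmain
    exact hmain.mono le_rfl fun σ' _ h => by simpa using h
  · intro m σ' ha hm hmlt h
    rw [h20] at hmlt
    obtain ⟨e6, e7, -⟩ := hL m _ (List.getElem?_eq_getElem hmlt)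
    have h4' : σ'.reg 4 = 0 := by rw [ha.reg 4 (by simp [forLoop, resetBody]), h4]
    have m6 : σ'.mem 6 = σ.mem 6 := ha.mem 6 (by simp [forLoop, resetBody])
    have m7 : σ'.mem 7 = σ.mem 7 := ha.mem 7 (by simp [forLoop, resetBody])
    rw [take_succ_eq hmlt]
    intro t ht
    simp only [resetBody, Prog.eval, Instr.exec, State.setReg]
    simp [hm, m6, m7, e6, e7, h4', Function.update_apply]
    rcases List.mem_append.1 ht with ht | ht
    · exact ⟨fun _ _ => (h t ht).1, fun _ _ => (h t ht).2⟩
    · rw [List.mem_singleton] at ht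
      simp [ht]

theorem deg_concat (L : List Entry) (t : Entry) (v : ℕ) :
    deg (L ++ [t]) v = deg L v + ((if t.1 = v then 1 else 0) + if t.2.1 = v then 1 else 0) := by
  simp only [deg, List.countP_append, List.countP_singleton, decide_eq_true_eq]
  omega

theorem ends_count (ω : ℕ → Bool) {σ : State} {L : List Entry} (hL : Stores σ 6 7 8 L)
    (h20 : σ.reg 20 = L.length)
    (h12 : ∀ t ∈ L, σ.mem 12 t.1 = 0 ∧ σ.mem 12 t.2.1 = 0) :
    Ends ω (forLoop 2 20 countBody) σ ((countBody.size + 2) * L.length + 2) fun σ' =>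
      ∀ t ∈ L, σ'.mem 12 t.1 = deg L t.1 ∧ σ'.mem 12 t.2.1 = deg L t.2.1 := by
  have hmain := Ends.forLoop (ω := ω) (i := 2) (N := 20) (p := countBody) (σ := σ)
    (fun m σ' => ∀ v, σ.mem 12 v = 0 → σ'.mem 12 v = deg (L.take m) v)
    (by simp [countBody]) (by simp [countBody]) (by simp [countBody]) (by simp) ?_ ?_
  · rw [h20] at hmain
    refine hmain.mono le_rfl fun σ' _ h t ht => ?_
    rw [List.take_length] at h
    exact ⟨h _ (h12 t ht).1, h _ (h12 t ht).2⟩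
  · intro v hv
    simpa [deg] using hv
  · intro m σ' ha hm hmlt h v hv
    rw [h20] at hmlt
    obtain ⟨e6, e7, -⟩ := hL m _ (List.getElem?_eq_getElem hmlt)
    have m6 : σ'.mem 6 = σ.mem 6 := ha.mem 6 (by simp [forLoop, countBody])
    have m7 : σ'.mem 7 = σ.mem 7 := ha.mem 7 (by simp [forLoop, countBody])
    rw [take_succ_eq hmlt, deg_concat, ← h v hv]
    simp only [countBody, Prog.eval, Instr.exec, State.setReg]
    simp [hm, m6, m7, e6, e7, Function.update_apply]
    grind

theorem ends_split (ω : ℕ → Bool) {D : ℕ} {σ : State} {L K : List Entry} {f : ℕ → ℕ}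
    (hL : Stores σ 6 7 8 L) (h20 : σ.reg 20 = L.length) (h23 : σ.reg 23 = D)
    (h12 : ∀ t ∈ L, σ.mem 12 t.1 = f t.1 ∧ σ.mem 12 t.2.1 = f t.2.1)
    (hK : Stores σ 9 10 11 K) (h21 : σ.reg 21 = K.length) (h22 : σ.reg 22 = 0) :
    Ends ω (forLoop 2 20 splitBody) σ ((splitBody.size + 2) * L.length + 2) fun σ' =>
      Stores σ' 6 7 8 (core D f L) ∧ σ'.reg 22 = (core D f L).length ∧
        Stores σ' 9 10 11 (K ++ L.flatMap (outStep D f)) ∧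
        σ'.reg 21 = (K ++ L.flatMap (outStep D f)).length := by
  have hmain := Ends.forLoop (ω := ω) (i := 2) (N := 20) (p := splitBody) (σ := σ)
    (fun m σ' => Stores σ' 6 7 8 (core D f (L.take m)) ∧
      σ'.reg 22 = (core D f (L.take m)).length ∧
      Stores σ' 9 10 11 (K ++ (L.take m).flatMap (outStep D f)) ∧
      σ'.reg 21 = (K ++ (L.take m).flatMap (outStep D f)).length ∧
      ∀ q ≥ m, σ'.mem 6 q = σ.mem 6 q ∧ σ'.mem 7 q = σ.mem 7 q ∧ σ'.mem 8 q = σ.mem 8 q)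
    (by simp [splitBody, splitHead, splitTail]) (by simp [splitBody, splitHead, splitTail])
    (by simp [splitBody, splitHead, splitTail]) (by simp) ?_ ?_
  · rw [h20] at hmain
    refine hmain.mono le_rfl fun σ' _ h => ?_
    rw [List.take_length] at h
    exact ⟨h.1, h.2.1, h.2.2.1, h.2.2.2.1⟩
  · refine ⟨Stores.nil _ _ _ _, by simpa [core] using h22, ?_, by simpa using h21, by simp⟩
    simpa using hK.congr (σ' := σ.setReg 2 0) rfl rfl rfl
  · rintro m σ' ha hm hmlt ⟨i1, i2, i3, i4, i5⟩
    rw [h20] at hmlt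
    obtain ⟨e6, e7, e8⟩ := hL m _ (List.getElem?_eq_getElem hmlt)
    obtain ⟨d1, d2⟩ := h12 _ (List.getElem_mem hmlt)
    have r23 : σ'.reg 23 = D := by rw [ha.reg 23 (by simp [forLoop, splitBody, splitHead, splitTail]), h23]
    have m12 : σ'.mem 12 = σ.mem 12 := ha.mem 12 (by simp [forLoop, splitBody, splitHead, splitTail])
    obtain ⟨m6, m7, m8⟩ := i5 m le_rfl
    rw [e6] at m6
    rw [e7] at m7
    rw [e8] at m8
    obtain ⟨τ, hτ⟩ : ∃ τ, τ = splitHead.eval ω σ' := ⟨_, rfl⟩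
    have hev : splitBody.eval ω σ' = splitTail.eval ω τ := by rw [splitBody, Prog.eval, ← hτ]
    rw [hev]
    have hτm : τ.mem = σ'.mem := by simp [hτ, splitHead]
    set t := L[m] with ht
    have t5 : τ.reg 5 = t.1 := by simp [hτ, splitHead, hm, m6]
    have t6 : τ.reg 6 = t.2.1 := by simp [hτ, splitHead, hm, m7]
    have t7 : τ.reg 7 = t.2.2 := by simp [hτ, splitHead, hm, m8]
    have t8 : τ.reg 8 = f t.1 := by simp [hτ, splitHead, hm, m6, m12, d1]
    have t9 : τ.reg 9 = f t.2.1 := by simp [hτ, splitHead, hm, m7, m12, d2]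
    have t21 : τ.reg 21 = (K ++ (L.take m).flatMap (outStep D f)).length := by
      simp only [hτ, splitHead, Prog.eval, Instr.exec]; simpa using i4
    have t22 : τ.reg 22 = (core D f (L.take m)).length := by
      simp only [hτ, splitHead, Prog.eval, Instr.exec]; simpa using i2
    have t23 : τ.reg 23 = D := by simp [hτ, splitHead, r23]
    have hlen : (core D f (L.take m)).length ≤ m :=
      (List.length_filter_le _ _).trans (by simp)
    replace i1 : Stores τ 6 7 8 (core D f (L.take m)) := i1.congr (by rw [hτm]) (by rw [hτm]) (by rw [hτm])
    replace i3 : Stores τ 9 10 11 (K ++ (L.take m).flatMap (outStep D f)) :=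
      i3.congr (by rw [hτm]) (by rw [hτm]) (by rw [hτm])
    rw [← hτm] at i5
    have hcore : core D f (L.take (m + 1)) = core D f (L.take m) ++
        if D < f t.1 ∧ D < f t.2.1 then [t] else [] := by
      rw [take_succ_eq hmlt, core, core, List.filter_append, ← ht]
      simp only [List.filter_cons, List.filter_nil, decide_eq_true_eq]
    have hout : K ++ (L.take (m + 1)).flatMap (outStep D f) =
        (K ++ (L.take m).flatMap (outStep D f)) ++ outStep D f t := by
      rw [take_succ_eq hmlt, List.flatMap_append, ← ht]
      simp
    rw [hcore, hout]
    clear hev hτ hτm i2 i4 hcore hout m6 m7 m8 m12 hm ha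
    generalize core D f (L.take m) = X at *
    generalize K ++ (L.take m).flatMap (outStep D f) = Y at *
    clear_value t
    have hne : ∀ q ≥ m + 1, q ≠ X.length := fun q hq => by omega
    by_cases c1 : f t.1 ≤ D <;> by_cases c2 : f t.2.1 ≤ D
    · have hX : (if D < f t.1 ∧ D < f t.2.1 then [t] else []) = [] := if_neg (by omega)
      have hY : outStep D f t = [t] ++ [t.swap] := by simp [outStep, c1, c2]
      rw [hX, hY, List.append_nil, ← List.append_assoc]
      refine ⟨i1.congr ?_ ?_ ?_, ?_, (i3.concat (σ' := { τ with
        mem := Function.update (Function.update (Function.update τ.mem 9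
          (Function.update (τ.mem 9) Y.length t.1)) 10 (Function.update (τ.mem 10) Y.length t.2.1))
          11 (Function.update (τ.mem 11) Y.length t.2.2) }) ?_ ?_ ?_).concat ?_ ?_ ?_, ?_, ?_⟩ <;>
      simp [splitTail, t5, t6, t7, t8, t9, t21, t22, t23, not_lt.2 c1, not_lt.2 c2,
        Entry.swap]
      exact fun q hq => i5 q (by omega)
    · have hX : (if D < f t.1 ∧ D < f t.2.1 then [t] else []) = [] := if_neg (by omega)
      have hY : outStep D f t = [t] := by simp [outStep, c1, c2]
      rw [not_le] at c2
      rw [hX, hY, List.append_nil]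
      refine ⟨i1.congr ?_ ?_ ?_, ?_, i3.concat ?_ ?_ ?_, ?_, ?_⟩ <;>
      simp [splitTail, t5, t6, t7, t8, t9, t21, t22, t23, c2, not_lt.2 c1]
      exact fun q hq => i5 q (by omega)
    · have hX : (if D < f t.1 ∧ D < f t.2.1 then [t] else []) = [] := if_neg (by omega)
      have hY : outStep D f t = [t.swap] := by simp [outStep, c1, c2]
      rw [not_le] at c1
      rw [hX, hY, List.append_nil]
      refine ⟨i1.congr ?_ ?_ ?_, ?_, i3.concat ?_ ?_ ?_, ?_, ?_⟩ <;>
      simp [splitTail, t5, t6, t7, t8, t9, t21, t22, t23, c1, not_lt.2 c2, Entry.swap]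
      exact fun q hq => i5 q (by omega)
    · have hX : (if D < f t.1 ∧ D < f t.2.1 then [t] else []) = [t] := if_pos (by omega)
      have hY : outStep D f t = [] := by simp [outStep, c1, c2]
      rw [not_le] at c1 c2
      rw [hX, hY, List.append_nil]
      refine ⟨i1.concat ?_ ?_ ?_, ?_, i3.congr ?_ ?_ ?_, ?_, ?_⟩ <;>
      simp [splitTail, t5, t6, t7, t8, t9, t21, t22, t23, c1, c2]
      intro q hq
      simp only [ne_eq, hne q hq, not_false_eq_true, Function.update_of_ne]
      exact i5 q (by omega)

end CycleSearch

namespace CycleSearch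

open RAM

def roundTime : ℕ := resetBody.size + countBody.size + splitBody.size + 14

theorem ends_roundProg (ω : ℕ → Bool) {D : ℕ} {σ : State} {L K : List Entry}
    (hL : Stores σ 6 7 8 L) (h20 : σ.reg 20 = L.length) (h23 : σ.reg 23 = D) (h4 : σ.reg 4 = 0)
    (hK : Stores σ 9 10 11 K) (h21 : σ.reg 21 = K.length) (hne : L ≠ []) :
    Ends ω roundProg σ (roundTime * L.length) fun σ' =>
      Stores σ' 6 7 8 (core D (deg L) L) ∧ σ'.reg 20 = (core D (deg L) L).length ∧
        Stores σ' 9 10 11 (K ++ L.flatMap (outStep D (deg L))) ∧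
        σ'.reg 21 = (K ++ L.flatMap (outStep D (deg L))).length := by
  have hpos := List.length_pos_iff.2 hne
  refine (Ends.seq (ends_reset ω hL h20 h4) fun σ₁ a₁ h₁ => ?_).mono
    (T := ((resetBody.size + 2) * L.length + 2) + (((countBody.size + 2) * L.length + 2) +
      (1 + (((splitBody.size + 2) * L.length + 2) + 1)))) ?_ fun _ _ h => h
  · have e6 : σ₁.mem 6 = σ.mem 6 := a₁.mem 6 (by simp [forLoop, resetBody])
    have e7 : σ₁.mem 7 = σ.mem 7 := a₁.mem 7 (by simp [forLoop, resetBody])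
    have e8 : σ₁.mem 8 = σ.mem 8 := a₁.mem 8 (by simp [forLoop, resetBody])
    refine Ends.seq (ends_count ω (hL.congr e6 e7 e8)
      (by rw [a₁.reg 20 (by simp [forLoop, resetBody]), h20]) h₁) fun σ₂ a₂ h₂ => ?_
    refine Ends.seq (Q := fun σ' => σ' = σ₂.setReg 22 0)
      (Prog.LoopFree.ends (p := .instr (.const 22 0)) trivial rfl) ?_
    rintro _ - rfl
    refine Ends.seq (ends_split ω (D := D) (L := L) (K := K) (f := deg L) ?_ ?_ ?_ ?_ ?_ ?_ ?_)
      fun σ₃ a₃ h₃ => ?_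
    · refine hL.congr ?_ ?_ ?_
      · rw [← e6]; exact a₂.mem 6 (by simp [forLoop, countBody])
      · rw [← e7]; exact a₂.mem 7 (by simp [forLoop, countBody])
      · rw [← e8]; exact a₂.mem 8 (by simp [forLoop, countBody])
    · have : σ₂.reg 20 = L.length := by
        rw [a₂.reg 20 (by simp [forLoop, countBody]), a₁.reg 20 (by simp [forLoop, resetBody]), h20]
      simpa using this
    · have : σ₂.reg 23 = D := by
        rw [a₂.reg 23 (by simp [forLoop, countBody]), a₁.reg 23 (by simp [forLoop, resetBody]), h23]
      simpa using this
    · exact h₂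
    · refine hK.congr ?_ ?_ ?_
      · rw [← a₁.mem 9 (by simp [forLoop, resetBody])]
        exact a₂.mem 9 (by simp [forLoop, countBody])
      · rw [← a₁.mem 10 (by simp [forLoop, resetBody])]
        exact a₂.mem 10 (by simp [forLoop, countBody])
      · rw [← a₁.mem 11 (by simp [forLoop, resetBody])]
        exact a₂.mem 11 (by simp [forLoop, countBody])
    · have : σ₂.reg 21 = K.length := by
        rw [a₂.reg 21 (by simp [forLoop, countBody]), a₁.reg 21 (by simp [forLoop, resetBody]), h21]
      simpa using this
    · simp
    · refine Prog.LoopFree.ends (p := .instr (.copy 20 22)) trivial ?_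
      obtain ⟨g1, g2, g3, g4⟩ := h₃
      exact ⟨g1.congr rfl rfl rfl, by simpa using g2, g3.congr rfl rfl rfl, by simpa using g4⟩
  · have : roundTime * L.length = resetBody.size * L.length + countBody.size * L.length +
        splitBody.size * L.length + 14 * L.length := by rw [roundTime]; ring
    simp only [add_mul]
    omega

theorem peel_nil (D : ℕ) : peel D [] = [] := by
  rw [peel]
  simp

theorem length_peel_le (D : ℕ) (L : List Entry) : (peel D L).length ≤ 2 * L.length := by
  have key : ∀ (f : ℕ → ℕ) (L : List Entry),
      (L.flatMap (outStep D f)).length + 2 * (core D f L).length ≤ 2 * L.length := by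
    intro f L
    induction L with
    | nil => simp [core]
    | cons t L ih =>
      have : (outStep D f t).length + 2 * (if D < f t.1 ∧ D < f t.2.1 then 1 else 0) ≤ 2 := by
        rw [outStep, List.length_append]
        split_ifs <;> simp <;> omega
      rw [List.flatMap_cons, List.length_append, core, List.filter_cons, ← core, List.length_cons]
      simp only [decide_eq_true_eq]
      split_ifs at this ⊢ <;> (try simp only [List.length_cons]) <;> omega
  induction hm : L.length using Nat.strong_induction_on generalizing L with
  | _ m ih =>
    rw [peel]
    split_ifs with hlt
    · rw [List.length_append]
      have h1 := ih _ (hm ▸ hlt) (core D (deg L) L) rfl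
      have h2 := key (deg L) L
      omega
    · simp

theorem ends_peelProg (ω : ℕ → Bool) {d D : ℕ} {σ : State} {L : List Entry}
    (hD : 4 * d ≤ D) (hs : SparseList d L) (hL : Stores σ 6 7 8 L) (h20 : σ.reg 20 = L.length)
    (h4 : σ.reg 4 = 0) :
    Ends ω (peelProg D) σ (2 * (roundTime + 1) * L.length + 3) fun σ' =>
      Stores σ' 9 10 11 (peel D L) ∧ σ'.reg 21 = (peel D L).length := by
  refine (Ends.seq (T := 1) (Q := fun σ' => σ' = σ.setReg 21 0)
    (Prog.LoopFree.ends (p := .instr (.const 21 0)) trivial rfl) ?_).mono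
    (T := 1 + (1 + (2 * (roundTime + 1) * L.length + 1))) (by omega) fun _ _ h => h
  rintro _ - rfl
  refine Ends.seq (Q := fun σ' => σ' = (σ.setReg 21 0).setReg 23 D)
    (Prog.LoopFree.ends (p := .instr (.const 23 D)) trivial rfl) ?_
  rintro _ - rfl
  set σ₀ := (σ.setReg 21 0).setReg 23 D with hσ₀
  have hmain := Ends.loop (ω := ω) (b := .lt 4 20) (p := roundProg) (σ := σ₀)
    (fun σ' => ∃ L' K', Stores σ' 6 7 8 L' ∧ σ'.reg 20 = L'.length ∧ Stores σ' 9 10 11 K' ∧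
      σ'.reg 21 = K'.length ∧ K' ++ peel D L' = peel D L ∧ SparseList d L')
    (fun σ' => 2 * (roundTime + 1) * σ'.reg 20) ?_ ?_
  · have e : σ₀.reg 20 = L.length := by simpa [hσ₀] using h20
    rw [e] at hmain
    refine hmain.mono le_rfl ?_
    rintro σ' ha ⟨⟨L', K', g1, g2, g3, g4, g5, -⟩, hb⟩
    have r4 : σ'.reg 4 = 0 := by
      rw [ha.reg 4 (by simp [roundProg, forLoop, resetBody, countBody, splitBody, splitHead,
        splitTail])]
      simpa [hσ₀] using h4
    have hL' : L' = [] := by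
      rw [← List.length_eq_zero_iff, ← g2]
      simpa [r4] using hb
    rw [hL', peel_nil, List.append_nil] at g5
    rw [← g5]
    exact ⟨g3, g4⟩
  · rintro σ' ha ⟨L', K', g1, g2, g3, g4, g5, g6⟩ hb
    have r4 : σ'.reg 4 = 0 := by
      rw [ha.reg 4 (by simp [roundProg, forLoop, resetBody, countBody, splitBody, splitHead,
        splitTail])]
      simpa [hσ₀] using h4
    have r23 : σ'.reg 23 = D := by
      rw [ha.reg 23 (by simp [roundProg, forLoop, resetBody, countBody, splitBody, splitHead,
        splitTail])]
      simp [hσ₀]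
    have hb' : 0 < L'.length := by simpa [r4, g2] using hb
    have hne : L' ≠ [] := List.length_pos_iff.1 hb'
    have hlt := g6.length_core_lt hD hne
    have hhalf := g6.two_mul_length_core_le hD
    refine ⟨roundTime * L'.length, (ends_roundProg ω g1 g2 r23 r4 g3 g4 hne).mono le_rfl ?_⟩
    rintro σ'' - ⟨k1, k2, k3, k4⟩
    refine ⟨⟨_, _, k1, k2, k3, k4, ?_, g6.sublist List.filter_sublist⟩, ?_⟩
    · rw [← g5, peel.eq_1 D L', if_pos hlt, List.append_assoc]
    · rw [k2, g2]
      have := Nat.mul_le_mul_left (roundTime + 1) hhalf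
      have e1 : (roundTime + 1) * L'.length = roundTime * L'.length + L'.length := by ring
      have e2 : 2 * (roundTime + 1) * L'.length =
        (roundTime + 1) * L'.length + (roundTime + 1) * L'.length := by ring
      have e3 : 2 * (roundTime + 1) * (core D (deg L') L').length =
        (roundTime + 1) * (2 * (core D (deg L') L').length) := by ring
      omega
  · exact ⟨L, [], hL.congr rfl rfl rfl, by simpa [hσ₀] using h20, Stores.nil _ _ _ _,
      by simp [hσ₀], rfl, hs⟩

/-! #### Cleaning the colours -/

def copyBody : Prog := .instr (.load 5 4 2) ;; .instr (.store 17 2 5)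

def cleanHead (k : ℕ) : Prog :=
  .instr (.load 5 9 2) ;; .instr (.load 6 10 2) ;; .instr (.load 7 4 5) ;; .instr (.load 8 4 6) ;;
    .instr (.copy 9 7) ;; .instr (.inc 9) ;; .instr (.copy 10 8) ;; .instr (.inc 10) ;;
    .instr (.const 11 1) ;; .instr (.const 12 k)

def cleanTail : Prog :=
  .cond (.lt 4 7) (.cond (.lt 4 8) (.cond (.eq 8 9) (.instr .skip) (.cond (.eq 7 10) (.instr .skip)
    (.cond (.eq 7 11) (.cond (.eq 8 12) (.instr .skip) (.instr (.store 17 5 4)))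
      (.cond (.eq 7 12) (.cond (.eq 8 11) (.instr .skip) (.instr (.store 17 5 4)))
        (.instr (.store 17 5 4))))))
    (.instr .skip)) (.instr .skip)

def cleanBody (k : ℕ) : Prog := cleanHead k ;; cleanTail

def cleanProg (k : ℕ) : Prog := forLoop 2 0 copyBody ;; forLoop 2 21 (cleanBody k)

theorem ends_cleanProg (ω : ℕ → Bool) {n k : ℕ} {σ : State} {L : List Entry} {c : ℕ → ℕ}
    (h0 : σ.reg 0 = n) (h4 : σ.reg 4 = 0) (hL : Stores σ 9 10 11 L) (h21 : σ.reg 21 = L.length)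
    (hc : ∀ v < n, σ.mem 4 v = c v) (hlt : ∀ t ∈ L, t.1 < n ∧ t.2.1 < n) :
    Ends ω (cleanProg k) σ (((copyBody.size + 2) * n + 2) + (((cleanBody k).size + 2) * L.length + 2))
      fun σ' => ∀ v < n, σ'.mem 17 v = clean (badPair k) c L v := by
  have h1 := Ends.forLoop (ω := ω) (i := 2) (N := 0) (p := copyBody) (σ := σ)
    (fun m σ' => ∀ v < m, σ'.mem 17 v = c v)
    (by simp [copyBody]) (by simp [copyBody]) (by simp [copyBody]) (by simp) (by simp) ?_
  · rw [h0] at h1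
    refine Ends.seq h1 fun σ₁ a₁ g₁ => ?_
    have h2 := Ends.forLoop (ω := ω) (i := 2) (N := 21) (p := cleanBody k) (σ := σ₁)
      (fun m σ' => ∀ v < n, σ'.mem 17 v = clean (badPair k) c (L.take m) v)
      (by simp [cleanBody, cleanHead, cleanTail]) (by simp [cleanBody, cleanHead, cleanTail])
      (by simp [cleanBody, cleanHead, cleanTail]) (by simp) (by simpa [clean] using g₁) ?_
    · have e21 : σ₁.reg 21 = L.length := by rw [a₁.reg 21 (by simp [forLoop, copyBody]), h21]
      rw [e21] at h2
      exact h2.mono le_rfl fun σ' _ h => by simpa using h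
    · intro m σ' ha hm hmlt h
      have hmlt : m < L.length := by
        rwa [a₁.reg 21 (by simp [forLoop, copyBody]), h21] at hmlt
      obtain ⟨e9, e10, -⟩ := hL m _ (List.getElem?_eq_getElem hmlt)
      obtain ⟨hlt1, hlt2⟩ := hlt _ (List.getElem_mem hmlt)
      have hM : ∀ a, a ≠ 17 → σ'.mem a = σ.mem a := fun a ha' => by
        rw [ha.mem a (by simp [forLoop, cleanBody, cleanHead, cleanTail, ha']),
          a₁.mem a (by simp [forLoop, copyBody, ha'])]
      have r4 : σ'.reg 4 = 0 := by
        rw [ha.reg 4 (by simp [forLoop, cleanBody, cleanHead, cleanTail]),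
          a₁.reg 4 (by simp [forLoop, copyBody]), h4]
      rw [← hM 9 (by simp)] at e9
      rw [← hM 10 (by simp)] at e10
      set t := L[m] with ht
      have c1 : σ'.mem 4 t.1 = c t.1 := by rw [hM 4 (by simp), hc _ hlt1]
      have c2 : σ'.mem 4 t.2.1 = c t.2.1 := by rw [hM 4 (by simp), hc _ hlt2]
      obtain ⟨τ, hτ⟩ : ∃ τ, τ = (cleanHead k).eval ω σ' := ⟨_, rfl⟩
      have hev : (cleanBody k).eval ω σ' = cleanTail.eval ω τ := by rw [cleanBody, Prog.eval, ← hτ]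
      have hτm : τ.mem = σ'.mem := by simp [hτ, cleanHead]
      have t4 : τ.reg 4 = 0 := by simp [hτ, cleanHead, r4]
      have t5 : τ.reg 5 = t.1 := by simp [hτ, cleanHead, hm, e9]
      have t7 : τ.reg 7 = c t.1 := by simp [hτ, cleanHead, hm, e9, c1]
      have t8 : τ.reg 8 = c t.2.1 := by simp [hτ, cleanHead, hm, e10, c2]
      have t9 : τ.reg 9 = c t.1 + 1 := by simp [hτ, cleanHead, hm, e9, c1]
      have t10 : τ.reg 10 = c t.2.1 + 1 := by simp [hτ, cleanHead, hm, e10, c2]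
      have t11 : τ.reg 11 = 1 := by simp [hτ, cleanHead]
      have t12 : τ.reg 12 = k := by simp [hτ, cleanHead]
      have hstep : (cleanTail.eval ω τ).mem 17 =
          if badPair k (c t.1) (c t.2.1) then Function.update (σ'.mem 17) t.1 0 else σ'.mem 17 := by
        rw [← hτm]
        simp only [cleanTail, Prog.eval, Test.Holds, t4, t7, t8, t9, t10, t11, t12, Instr.exec, t5,
          badPair, decide_eq_true_eq]
        clear_value t
        clear * -
        split_ifs <;> first | rfl | (exfalso; omega)
      intro v hv
      rw [take_succ_eq hmlt, clean_concat, hev, ← ht]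
      simp only [State.setReg, hstep]
      split_ifs with hb
      · by_cases hvt : v = t.1
        · simp [hvt]
        · simp [hvt, h v hv]
      · exact h v hv
  · intro m σ' ha hm hmlt h v hv
    have e4 : σ'.mem 4 = σ.mem 4 := ha.mem 4 (by simp [forLoop, copyBody])
    rw [h0] at hmlt
    by_cases hvm : v = m
    · simp [copyBody, hm, hvm, e4, hc m hmlt]
    · simpa [copyBody, hm, hvm] using h v (by omega)

/-! #### Contraction -/

def pointHead : Prog :=
  .instr (.load 5 9 2) ;; .instr (.load 6 10 2) ;; .instr (.load 7 11 2) ;; .instr (.load 8 16 5) ;;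
    .instr (.load 9 16 6) ;; .instr (.inc 6) ;; .instr (.inc 7)

def pointTail : Prog :=
  .cond (.eq 4 8) (.cond (.lt 4 9) (.instr (.store 13 5 6) ;; .instr (.store 14 5 7))
    (.instr .skip)) (.instr .skip)

def pointBody : Prog := pointHead ;; pointTail

def pointProg : Prog := forLoop 2 21 pointBody

theorem ends_pointProg (ω : ℕ → Bool) {n : ℕ} {σ : State} {L : List Entry} {mark : ℕ → Bool}
    (h4 : σ.reg 4 = 0) (hL : Stores σ 9 10 11 L) (h21 : σ.reg 21 = L.length)
    (hmark : ∀ v < n, σ.mem 16 v = (mark v).toNat) (hlt : ∀ t ∈ L, t.1 < n ∧ t.2.1 < n)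
    (h13 : ∀ v < n, σ.mem 13 v = 0 ∧ σ.mem 14 v = 0) :
    Ends ω pointProg σ ((pointBody.size + 2) * L.length + 2) fun σ' =>
      ∀ v < n, σ'.mem 13 v = (point mark L).1 v ∧ σ'.mem 14 v = (point mark L).2 v := by
  have h2 := Ends.forLoop (ω := ω) (i := 2) (N := 21) (p := pointBody) (σ := σ)
    (fun m σ' => ∀ v < n, σ'.mem 13 v = (point mark (L.take m)).1 v ∧
      σ'.mem 14 v = (point mark (L.take m)).2 v)
    (by simp [pointBody, pointHead, pointTail]) (by simp [pointBody, pointHead, pointTail])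
    (by simp [pointBody, pointHead, pointTail]) (by simp) (by simpa [point] using h13) ?_
  · rw [h21] at h2
    exact h2.mono le_rfl fun σ' _ h => by simpa using h
  · intro m σ' ha hm hmlt h
    rw [h21] at hmlt
    obtain ⟨e9, e10, e11⟩ := hL m _ (List.getElem?_eq_getElem hmlt)
    obtain ⟨hlt1, hlt2⟩ := hlt _ (List.getElem_mem hmlt)
    have hM : ∀ a, a ≠ 13 → a ≠ 14 → σ'.mem a = σ.mem a := fun a ha' ha'' =>
      ha.mem a (by simp [forLoop, pointBody, pointHead, pointTail, ha', ha''])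
    have r4 : σ'.reg 4 = 0 := by
      rw [ha.reg 4 (by simp [forLoop, pointBody, pointHead, pointTail]), h4]
    rw [← hM 9 (by simp) (by simp)] at e9
    rw [← hM 10 (by simp) (by simp)] at e10
    rw [← hM 11 (by simp) (by simp)] at e11
    set t := L[m] with ht
    have c1 : σ'.mem 16 t.1 = (mark t.1).toNat := by rw [hM 16 (by simp) (by simp), hmark _ hlt1]
    have c2 : σ'.mem 16 t.2.1 = (mark t.2.1).toNat := by
      rw [hM 16 (by simp) (by simp), hmark _ hlt2]
    obtain ⟨τ, hτ⟩ : ∃ τ, τ = pointHead.eval ω σ' := ⟨_, rfl⟩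
    have hev : pointBody.eval ω σ' = pointTail.eval ω τ := by rw [pointBody, Prog.eval, ← hτ]
    have hτm : τ.mem = σ'.mem := by simp [hτ, pointHead]
    have t4 : τ.reg 4 = 0 := by simp [hτ, pointHead, r4]
    have t5 : τ.reg 5 = t.1 := by simp [hτ, pointHead, hm, e9]
    have t6 : τ.reg 6 = t.2.1 + 1 := by simp [hτ, pointHead, hm, e10]
    have t7 : τ.reg 7 = t.2.2 + 1 := by simp [hτ, pointHead, hm, e11]
    have t8 : τ.reg 8 = (mark t.1).toNat := by simp [hτ, pointHead, hm, e9, c1]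
    have t9 : τ.reg 9 = (mark t.2.1).toNat := by simp [hτ, pointHead, hm, e10, c2]
    intro v hv
    rw [take_succ_eq hmlt, point_concat, hev, ← ht, pointStep]
    have := h v hv
    cases hm1 : mark t.1 <;> cases hm2 : mark t.2.1 <;> by_cases hvt : v = t.1 <;>
      simp_all [pointTail]

def updateBody (j : ℕ) : Prog :=
  .instr (.load 5 15 2) ;; .instr (.load 6 13 5) ;; .instr (.load 7 14 5) ;;
    .instr (.store (20 + j) 2 7) ;; .cond (.lt 4 6) (.instr (.dec 6) ;; .instr (.store 15 2 6))
      (.instr .skip)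

def updateProg (j : ℕ) : Prog := forLoop 2 0 (updateBody j)

theorem ends_updateProg (ω : ℕ → Bool) (j : ℕ) {n : ℕ} {σ : State} {p q r : ℕ → ℕ}
    (h0 : σ.reg 0 = n) (h4 : σ.reg 4 = 0) (h13 : ∀ v < n, σ.mem 13 v = p v ∧ σ.mem 14 v = q v)
    (h15 : ∀ v < n, σ.mem 15 v = r v ∧ r v < n) :
    Ends ω (updateProg j) σ (((updateBody j).size + 2) * n + 2) fun σ' =>
      ∀ v < n, σ'.mem 15 v = newRep p r v ∧ σ'.mem (20 + j) v = q (r v) := by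
  have hj13 : (13 : ℕ) ≠ 20 + j := by omega
  have hj14 : (14 : ℕ) ≠ 20 + j := by omega
  have hj15 : (15 : ℕ) ≠ 20 + j := by omega
  have h2 := Ends.forLoop (ω := ω) (i := 2) (N := 0) (p := updateBody j) (σ := σ)
    (fun m σ' => (∀ v < m, σ'.mem 15 v = newRep p r v ∧ σ'.mem (20 + j) v = q (r v)) ∧
      ∀ v < n, m ≤ v → σ'.mem 15 v = r v)
    (by simp [updateBody]) (by simp [updateBody]) (by simp [updateBody]) (by simp) ?_ ?_
  · rw [h0] at h2
    exact h2.mono le_rfl fun σ' _ h => h.1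
  · exact ⟨by simp, fun v hv _ => (h15 v hv).1⟩
  · rintro m σ' ha hm hmlt ⟨h, h'⟩
    rw [h0] at hmlt
    have r4 : σ'.reg 4 = 0 := by rw [ha.reg 4 (by simp [forLoop, updateBody]), h4]
    have e13 : σ'.mem 13 = σ.mem 13 := ha.mem 13 (by simp [forLoop, updateBody]; omega)
    have e14 : σ'.mem 14 = σ.mem 14 := ha.mem 14 (by simp [forLoop, updateBody]; omega)
    have e15 := h' m hmlt le_rfl
    have g13 := (h13 _ (h15 m hmlt).2).1
    have g14 := (h13 _ (h15 m hmlt).2).2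
    rw [← e13] at g13
    rw [← e14] at g14
    have hs1 : ((updateBody j).eval ω σ').mem 15 =
        Function.update (σ'.mem 15) m (newRep p r m) := by
      by_cases hp : p (r m) = 0
      · simp [updateBody, hm, e15, g13, g14, hp, r4, newRep, hj15]
      · simp [updateBody, hm, e15, g13, g14, hp, r4, newRep, hj15, Nat.pos_of_ne_zero hp]
    have hs2 : ((updateBody j).eval ω σ').mem (20 + j) =
        Function.update (σ'.mem (20 + j)) m (q (r m)) := by
      by_cases hp : p (r m) = 0
      · simp [updateBody, hm, e15, g13, g14, hp, r4]
      · simp [updateBody, hm, e15, g13, g14, r4, hj15.symm, Nat.pos_of_ne_zero hp]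
    simp only [State.setReg, hs1, hs2]
    refine ⟨fun v hv => ?_, fun v hv hmv => ?_⟩
    · by_cases hvm : v = m
      · simp [hvm]
      · simpa [hvm] using h v (by omega)
    · rw [Function.update_of_ne (by omega)]
      exact h' v hv (by omega)

/-! #### The closing arc and the recovery of the cycle -/

def closeHead (k : ℕ) : Prog :=
  .instr (.load 5 3 2) ;; .instr (.load 6 1 2) ;; .instr (.load 7 17 5) ;; .instr (.load 8 17 6) ;;
    .instr (.const 9 k) ;; .instr (.const 10 1) ;; .instr (.load 11 15 5) ;; .instr (.load 12 15 6)

def closeTail : Prog :=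
  .cond (.eq 7 9) (.cond (.eq 8 10) (.cond (.eq 11 12) (.instr (.copy 30 5) ;; .instr (.copy 31 6) ;;
    .instr (.const 3 1)) (.instr .skip)) (.instr .skip)) (.instr .skip)

def closeBody (k : ℕ) : Prog := closeHead k ;; closeTail

def closeProg (k : ℕ) : Prog := forLoop 2 1 (closeBody k)

theorem ends_closeProg (ω : ℕ → Bool) (k : ℕ) {n : ℕ} {arcs : List (ℕ × ℕ)} {σ : State}
    {c r : ℕ → ℕ} (hσ : Input n arcs σ) (hlt : ∀ e ∈ arcs, e.1 < n ∧ e.2 < n)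
    (h3 : σ.reg 3 = 0) (h17 : ∀ v < n, σ.mem 17 v = c v) (h15 : ∀ v < n, σ.mem 15 v = r v) :
    Ends ω (closeProg k) σ (((closeBody k).size + 2) * arcs.length + 2) fun σ' =>
      (σ'.reg 3 = 0 ∧ ∀ e ∈ arcs, ¬ (c e.1 = k ∧ c e.2 = 1 ∧ r e.1 = r e.2)) ∨
      (σ'.reg 3 = 1 ∧ ∃ e ∈ arcs, c e.1 = k ∧ c e.2 = 1 ∧ r e.1 = r e.2 ∧ σ'.reg 30 = e.1 ∧
        σ'.reg 31 = e.2) := by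
  have h2 := Ends.forLoop (ω := ω) (i := 2) (N := 1) (p := closeBody k) (σ := σ)
    (fun m σ' => (σ'.reg 3 = 0 ∧ ∀ e ∈ arcs.take m, ¬ (c e.1 = k ∧ c e.2 = 1 ∧ r e.1 = r e.2)) ∨
      (σ'.reg 3 = 1 ∧ ∃ e ∈ arcs.take m, c e.1 = k ∧ c e.2 = 1 ∧ r e.1 = r e.2 ∧
        σ'.reg 30 = e.1 ∧ σ'.reg 31 = e.2))
    (by simp [closeBody, closeHead, closeTail]) (by simp [closeBody, closeHead, closeTail])
    (by simp [closeBody, closeHead, closeTail]) (by simp) (by simpa using h3) ?_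
  · rw [hσ.numArcs] at h2
    exact h2.mono le_rfl fun σ' _ h => by simpa only [List.take_length] using h
  · intro m σ' ha hm hmlt h
    rw [hσ.numArcs] at hmlt
    obtain ⟨hlt1, hlt2⟩ := hlt _ (List.getElem_mem hmlt)
    obtain ⟨e3, e1⟩ := hσ.ends m _ (List.getElem?_eq_getElem hmlt)
    have hM : σ'.mem = σ.mem := funext fun a =>
      ha.mem a (by simp [forLoop, closeBody, closeHead, closeTail])
    rw [← hM] at e3 e1 h17 h15
    rw [take_succ_eq hmlt]
    set e := arcs[m] with he
    obtain ⟨τ, hτ⟩ : ∃ τ, τ = (closeHead k).eval ω σ' := ⟨_, rfl⟩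
    have hev : (closeBody k).eval ω σ' = closeTail.eval ω τ := by rw [closeBody, Prog.eval, ← hτ]
    have t3 : τ.reg 3 = σ'.reg 3 := by simp [hτ, closeHead]
    have t30 : τ.reg 30 = σ'.reg 30 := by simp [hτ, closeHead]
    have t31 : τ.reg 31 = σ'.reg 31 := by simp [hτ, closeHead]
    have t5 : τ.reg 5 = e.1 := by simp [hτ, closeHead, hm, e3]
    have t6 : τ.reg 6 = e.2 := by simp [hτ, closeHead, hm, e1]
    have t7 : τ.reg 7 = c e.1 := by simp [hτ, closeHead, hm, e3, h17 _ hlt1]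
    have t8 : τ.reg 8 = c e.2 := by simp [hτ, closeHead, hm, e1, h17 _ hlt2]
    have t9 : τ.reg 9 = k := by simp [hτ, closeHead]
    have t10 : τ.reg 10 = 1 := by simp [hτ, closeHead]
    have t11 : τ.reg 11 = r e.1 := by simp [hτ, closeHead, hm, e3, h15 _ hlt1]
    have t12 : τ.reg 12 = r e.2 := by simp [hτ, closeHead, hm, e1, h15 _ hlt2]
    rw [← t3, ← t30, ← t31] at h
    rw [hev]
    by_cases hc : c e.1 = k ∧ c e.2 = 1 ∧ r e.1 = r e.2
    · refine .inr ⟨?_, e, by simp, hc.1, hc.2.1, hc.2.2, ?_, ?_⟩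
      · simp [closeTail, t7, t8, t9, t10, t11, t12, hc.1, hc.2.1, hc.2.2]
      · simp [closeTail, t7, t8, t9, t10, t11, t12, hc.1, hc.2.1, hc.2.2, t5]
      · simp [closeTail, t7, t8, t9, t10, t11, t12, hc.1, hc.2.1, hc.2.2, t6]
    · have hid : closeTail.eval ω τ = τ := by
        simp only [closeTail, Prog.eval, Test.Holds, t7, t8, t9, t10, t11, t12, Instr.exec]
        split_ifs <;> first | rfl | (exfalso; tauto)
      rw [hid]
      rcases h with ⟨h, h'⟩ | ⟨h, e', he', h'⟩
      · refine .inl ⟨by simpa using h, fun e' he' => ?_⟩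
        rcases List.mem_append.1 he' with he' | he'
        · exact h' e' he'
        · rw [List.mem_singleton] at he'; subst he'; exact hc
      · exact .inr ⟨by simpa using h, e', List.mem_append_left _ he', by simpa using h'⟩

def walkStep (j : ℕ) : Prog :=
  .instr (.load 5 (20 + j) 32) ;; .cond (.eq 5 4) (.instr (.load 5 (20 + j) 31)) (.instr .skip) ;;
    .instr (.dec 5) ;; .instr (.copy 32 5) ;; .instr (.const 6 j) ;; .instr (.store 2 6 32)

/-- Write the vertices of the cycle before the vertex in register `32`. -/
def walkProg : ℕ → Prog
  | 0 => .instr .skip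
  | j + 1 => walkStep j ;; walkProg j

def recoverProg (k : ℕ) : Prog :=
  .cond (.lt 4 3) (.instr (.copy 32 30) ;; .instr (.const 6 (k - 1)) ;; .instr (.store 2 6 32) ;;
    walkProg (k - 1)) (.instr .skip)

theorem walkProg_loopFree (j : ℕ) : (walkProg j).LoopFree := by
  induction j with
  | zero => simp [walkProg]
  | succ j ih => simp [walkProg, walkStep, ih]

theorem walkProg_writesReg (j r : ℕ) : (walkProg j).WritesReg r → r = 5 ∨ r = 6 ∨ r = 32 := by
  induction j with
  | zero => simp [walkProg]
  | succ j ih => simp [walkProg, walkStep]; tauto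

theorem walkProg_writesMem (j r : ℕ) : (walkProg j).WritesMem r → r = 2 := by
  induction j with
  | zero => simp [walkProg]
  | succ j ih => simp [walkProg, walkStep]; tauto

theorem walkProg_tosses (j : ℕ) : ¬ (walkProg j).Tosses := by
  induction j with
  | zero => simp [walkProg]
  | succ j ih => simp [walkProg, walkStep, ih]

end CycleSearch

namespace CycleSearch

open RAM

/-! #### One trial -/

theorem walkProg_spec (ω : ℕ → Bool) {k D n : ℕ} {arcs : List (ℕ × ℕ)} {bits : ℕ → ℕ → Bool}
    {c : ℕ → ℕ} {a : ℕ} (hlt : ∀ e ∈ arcs, e.1 < n ∧ e.2 < n) (ha : a < n) (hca : c a = 1)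
    (j : ℕ) {x : ℕ} {σ : State} (hx : x < n) (hcx : c x = j + 1)
    (hr : rep k D arcs bits c j x = rep k D arcs bits c j a) (h4 : σ.reg 4 = 0)
    (h31 : σ.reg 31 = a) (h32 : σ.reg 32 = x)
    (hh : ∀ i < j, ∀ v < n, σ.mem (20 + i) v = hist k D arcs bits c i v) (h2 : σ.mem 2 j = x) :
    (∀ i ≥ j, ((walkProg j).eval ω σ).mem 2 i = σ.mem 2 i) ∧
      ((walkProg j).eval ω σ).mem 2 0 = a ∧
      ∀ i < j, (((walkProg j).eval ω σ).mem 2 (i + 1), ((walkProg j).eval ω σ).mem 2 i) ∈ arcs ∧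
        c (((walkProg j).eval ω σ).mem 2 i) = i + 1 := by
  induction j generalizing x σ with
  | zero =>
    refine ⟨fun _ _ => rfl, ?_, by simp⟩
    simp only [rep, id] at hr
    simpa [walkProg, ← hr] using h2
  | succ j ih =>
    obtain ⟨h5, h6, h7⟩ := back_spec (k := k) (D := D) (arcs := arcs) (bits := bits) hcx hca hr
    have hbn := (hlt _ h7).2
    set b := back k D arcs bits c a j x with hb
    obtain ⟨τ, hτ⟩ : ∃ τ, τ = (walkStep j).eval ω σ := ⟨_, rfl⟩
    have e1 := hh j (by omega) x hx
    have e2 := hh j (by omega) a ha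
    have hj2 : 20 + j ≠ 2 := by omega
    have t32 : τ.reg 32 = b := by
      by_cases h0 : hist k D arcs bits c j x = 0
      · simp [hτ, walkStep, h32, h31, e1, e2, h0, h4, hb, back]
      · simp [hτ, walkStep, h32, e1, h0, h4, hb, back]
    have tm2 : τ.mem 2 = Function.update (σ.mem 2) j b := by
      by_cases h0 : hist k D arcs bits c j x = 0
      · simp [hτ, walkStep, h32, h31, e1, e2, h0, h4, hb, back]
      · simp [hτ, walkStep, h32, e1, h0, h4, hb, back]
    have hag : Agree (walkStep j) σ τ :=
      hτ ▸ Prog.LoopFree.agree (by simp [walkStep]) σ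
    have t4 : τ.reg 4 = 0 := by rw [hag.reg 4 (by simp [walkStep]), h4]
    have t31 : τ.reg 31 = a := by rw [hag.reg 31 (by simp [walkStep]), h31]
    have hev : (walkProg (j + 1)).eval ω σ = (walkProg j).eval ω τ := by
      rw [walkProg, Prog.eval, hτ]
    rw [hev]
    obtain ⟨g1, g2, g3⟩ := ih hbn h5 h6 t4 t31 t32
      (fun i hi v hv => by
        rw [hag.mem (20 + i) (by simp [walkStep]; omega), hh i (by omega) v hv])
      (by simp [tm2])
    refine ⟨fun i hi => ?_, g2, fun i hi => ?_⟩
    · rw [g1 i (by omega), tm2, Function.update_of_ne (by omega)]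
    · by_cases hij : i = j
      · subst hij
        rw [g1 (i + 1) (by omega), g1 i le_rfl, tm2, Function.update_of_ne (by omega),
          Function.update_self, h2]
        exact ⟨h7, h5⟩
      · exact g3 i (by omega)

def orientCond : Prog :=
  .instr (.const 10 0) ;; .cond (.lt 5 6) (.instr (.const 10 1)) (.instr .skip)

theorem decides_orientCond (n : ℕ) (A : State → Prop) :
    Decides n A orientCond fun x b => decide (x < b) := by
  refine ⟨by simp [orientCond], ?_, by simp [orientCond], by simp [orientCond], ?_⟩
  · intro r hr
    simp [orientCond] at hr
    omega
  · intro ω σ _ _ _ _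
    by_cases h : σ.reg 5 < σ.reg 6 <;> simp [orientCond, h]

def stageCondProg (j : ℕ) : Prog :=
  .instr (.const 10 0) ;; .instr (.load 11 17 5) ;; .instr (.load 12 17 6) ;;
    .instr (.const 13 (j + 2)) ;; .instr (.const 14 (j + 1)) ;;
    .cond (.eq 11 13) (.cond (.eq 12 14) (.instr (.const 10 1)) (.instr .skip)) (.instr .skip)

theorem decides_stageCondProg (n j : ℕ) (c : ℕ → ℕ) :
    Decides n (fun σ => ∀ v < n, σ.mem 17 v = c v) (stageCondProg j) (stageCond c j) := by
  refine ⟨by simp [stageCondProg], ?_, by simp [stageCondProg], by simp [stageCondProg], ?_⟩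
  · intro r hr
    simp [stageCondProg] at hr
    omega
  · intro ω σ h _ h5 h6
    have e5 := h _ h5
    have e6 := h _ h6
    by_cases c1 : c (σ.reg 5) = j + 2 <;> by_cases c2 : c (σ.reg 6) = j + 1 <;>
      simp [stageCondProg, stageCond, e5, e6, c1, c2]

def orientProg (cp : Prog) (D : ℕ) : Prog := collectProg cp ;; peelProg D

theorem Decides.orientProg_writes {n : ℕ} {A : State → Prop} {cp : Prog} {cond : ℕ → ℕ → Bool}
    (h : Decides n A cp cond) (D : ℕ) :
    (∀ r, (orientProg cp D).WritesReg r → r = 2 ∨ 5 ≤ r ∧ r ≤ 23) ∧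
      (∀ a, (orientProg cp D).WritesMem a → 5 ≤ a ∧ a ≤ 12) ∧ ¬ (orientProg cp D).Tosses := by
  obtain ⟨h1, h2, h3⟩ := h.agree_collectProg
  refine ⟨fun r hr => ?_, fun a ha => ?_, ?_⟩
  · rcases hr with hr | hr
    · have := h1 r hr; omega
    · simp [peelProg, roundProg, resetBody, countBody, splitBody, splitHead, splitTail,
        forLoop] at hr
      omega
  · rcases ha with ha | ha
    · have := h2 a ha; omega
    · simp [peelProg, roundProg, resetBody, countBody, splitBody, splitHead, splitTail,
        forLoop] at ha
      omega
  · rintro (h | h)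
    · exact h3 h
    · simp [peelProg, roundProg, resetBody, countBody, splitBody, splitHead, splitTail,
        forLoop] at h

def stageProg (D j : ℕ) : Prog :=
  clearProg ;; markProg ;; orientProg (stageCondProg j) D ;; pointProg ;; updateProg j

theorem stageProg_writes (D j : ℕ) :
    (∀ r, (stageProg D j).WritesReg r → r = 2 ∨ 5 ≤ r ∧ r ≤ 23) ∧
      ∀ a, (stageProg D j).WritesMem a → 5 ≤ a ∧ a ≤ 16 ∨ a = 20 + j := by
  obtain ⟨h1, h2, -⟩ := (decides_stageCondProg 0 j id).orientProg_writes D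
  constructor
  · intro r hr
    by_cases hq : (orientProg (stageCondProg j) D).WritesReg r
    · exact h1 r hq
    · simp [stageProg, clearProg, clearBody, markProg, markBody, pointProg, pointBody, pointHead,
        pointTail, updateProg, updateBody, forLoop, hq] at hr
      omega
  · intro a ha
    by_cases hq : (orientProg (stageCondProg j) D).WritesMem a
    · have := h2 a hq; omega
    · simp [stageProg, clearProg, clearBody, markProg, markBody, pointProg, pointBody, pointHead,
        pointTail, updateProg, updateBody, forLoop, hq] at ha
      omega

/-- What the lists of arcs have to satisfy. -/
structure ArcList (n : ℕ) (arcs : List (ℕ × ℕ)) : Prop where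
  sorted : arcs.Pairwise fun e e' => e.1 ≤ e'.1
  lt : ∀ e ∈ arcs, e.1 < n ∧ e.2 < n

theorem ArcList.lt_of_mem_peel {n D : ℕ} {arcs : List (ℕ × ℕ)} (h : ArcList n arcs)
    {cond : ℕ → ℕ → Bool} {r : ℕ → ℕ} (hr : ∀ v < n, r v < n) {t : Entry}
    (ht : t ∈ peel D (collect cond r arcs)) : t.1 < n ∧ t.2.1 < n := by
  have key : ∀ s ∈ collect cond r arcs, s.1 < n ∧ s.2.1 < n := by
    intro s hs
    obtain ⟨h1, -, h2⟩ := of_mem_collect hs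
    exact ⟨(h.lt _ h1).1, h2 ▸ hr _ (h.lt _ h1).2⟩
  rcases mem_of_mem_peel ht with h | h
  · exact key _ h
  · exact (key _ h).symm

/-- Collecting and orienting edges takes linear time. -/
theorem exists_ends_orient (cp : Prog) (D : ℕ) : ∃ C : ℕ, ∀ (ω : ℕ → Bool) (d n : ℕ)
    (arcs : List (ℕ × ℕ)) (σ : State) (A : State → Prop) (cond : ℕ → ℕ → Bool) (r : ℕ → ℕ),
    Decides n A cp cond → (∀ σ', (∀ a, a < 5 ∨ 8 < a → σ'.mem a = σ.mem a) → A σ') →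
    Input n arcs σ → ArcList n arcs → (∀ v < n, σ.mem 15 v = r v ∧ r v < n) →
    (∀ v < n, σ.mem 5 v = 0) → 4 * d ≤ D → SparseList d (collect cond r arcs) →
    Ends ω (orientProg cp D) σ (C * (arcs.length + 1)) fun σ' =>
      Stores σ' 9 10 11 (peel D (collect cond r arcs)) ∧
        σ'.reg 21 = (peel D (collect cond r arcs)).length ∧
        (peel D (collect cond r arcs)).length ≤ 2 * arcs.length := by
  refine ⟨(collectBody cp).size + 3 + (2 * (roundTime + 1) + 3), ?_⟩
  intro ω d n arcs σ A cond r hcp hA hσ harcs hr h5 hD hs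
  have hlen := length_collect_le cond r arcs
  refine (Ends.seq (ends_collectProg ω hcp hA hσ harcs.sorted harcs.lt hr h5)
    fun σ₁ a₁ h₁ => ends_peelProg ω hD hs h₁.1 h₁.2 ?_).mono ?_ fun σ' _ h => ⟨h.1, h.2, ?_⟩
  · rw [a₁.reg 4 fun h => by have := hcp.agree_collectProg.1 4 h; omega, hσ.zero]
  · rw [add_mul ((collectBody cp).size + 3)]
    have := Nat.mul_le_mul_left (2 * (roundTime + 1)) hlen
    have e : (2 * (roundTime + 1) + 3) * (arcs.length + 1) =
      2 * (roundTime + 1) * arcs.length + 3 * arcs.length + 2 * (roundTime + 1) + 3 := by ring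
    omega
  · have := length_peel_le D (collect cond r arcs)
    omega

theorem exists_ends_stageProg (D j : ℕ) : ∃ C : ℕ, ∀ (ω : ℕ → Bool) (d n : ℕ)
    (arcs : List (ℕ × ℕ)) (σ : State) (c r : ℕ → ℕ) (mark : ℕ → Bool),
    Input n arcs σ → ArcList n arcs →
    (∀ v < n, σ.mem 17 v = c v) → (∀ v < n, σ.mem 15 v = r v ∧ r v < n) → 4 * d ≤ D →
    SparseList d (stageEdges arcs c r j) → (∀ v < n, ω (σ.coins + v) = mark v) →
    Ends ω (stageProg D j) σ (C * (n + arcs.length + 1)) fun σ' =>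
      σ'.coins = σ.coins + n ∧ ∀ v < n,
        σ'.mem 15 v = newRep (point mark (stageOut D arcs c r j)).1 r v ∧
        newRep (point mark (stageOut D arcs c r j)).1 r v < n ∧
        σ'.mem (20 + j) v = (point mark (stageOut D arcs c r j)).2 (r v) := by
  obtain ⟨C, hC⟩ := exists_ends_orient (stageCondProg j) D
  refine ⟨clearBody.size + markBody.size + C + 2 * pointBody.size + (updateBody j).size + 16, ?_⟩
  intro ω d n arcs σ c r mark hσ harcs h17 h15 hD hs hmark
  set L := stageOut D arcs c r j with hL
  have hlt : ∀ t ∈ L, t.1 < n ∧ t.2.1 < n := fun t ht =>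
    harcs.lt_of_mem_peel (fun v hv => (h15 v hv).2) ht
  have hnew : ∀ v < n, newRep (point mark L).1 r v < n := by
    intro v hv
    rw [newRep]
    split_ifs with h
    · exact (h15 v hv).2
    · rcases point_spec mark L (r v) with h' | ⟨w, b, hm, -, -, h', -⟩
      · exact absurd h'.1 h
      · rw [h', Nat.add_sub_cancel]
        exact (hlt _ hm).2
  have e1 := ends_clearProg ω hσ.zero
  rw [hσ.size] at e1
  obtain ⟨w1, w2, w3⟩ := (decides_stageCondProg n j c).orientProg_writes D
  refine (e1.seq fun σ₁ a₁ h₁ => ?_).mono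
    (T := ((clearBody.size + 2) * n + 2) + (((markBody.size + 2) * n + 2) +
      (C * (arcs.length + 1) + (((pointBody.size + 2) * (2 * arcs.length) + 2) +
        (((updateBody j).size + 2) * n + 2))))) ?_
    (Q := fun σ' => σ'.coins = σ.coins + n ∧ ∀ v < n,
        σ'.mem 15 v = newRep (point mark L).1 r v ∧
        σ'.mem (20 + j) v = (point mark L).2 (r v)) fun σ' _ h =>
      ⟨h.1, fun v hv => ⟨(h.2 v hv).1, hnew v hv, (h.2 v hv).2⟩⟩
  · have i₁ : Input n arcs σ₁ := hσ.agree a₁ (by simp [clearProg, forLoop, clearBody])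
      (by simp [clearProg, forLoop, clearBody]) (by simp [clearProg, forLoop, clearBody])
      (by simp [clearProg, forLoop, clearBody]) (by simp [clearProg, forLoop, clearBody])
    have m₁ : ∀ a, a ≠ 5 → a ≠ 13 → a ≠ 14 → σ₁.mem a = σ.mem a := fun a h h' h'' =>
      a₁.mem a (by simp [clearProg, forLoop, clearBody, h, h', h''])
    have c₁ : σ₁.coins = σ.coins := a₁.coins (by simp [clearProg, forLoop, clearBody])
    have e2 := ends_markProg ω (σ := σ₁)
    rw [i₁.size, c₁] at e2
    refine e2.seq fun σ₂ a₂ h₂ => ?_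
    have i₂ : Input n arcs σ₂ := i₁.agree a₂ (by simp [markProg, forLoop, markBody])
      (by simp [markProg, forLoop, markBody]) (by simp [markProg, forLoop, markBody])
      (by simp [markProg, forLoop, markBody]) (by simp [markProg, forLoop, markBody])
    have m₂ : ∀ a, a ≠ 16 → σ₂.mem a = σ₁.mem a := fun a h =>
      a₂.mem a (by simp [markProg, forLoop, markBody, h])
    refine (hC ω d n arcs σ₂ _ _ r (decides_stageCondProg n j c) ?_ i₂ harcs ?_ ?_ hD hs).seq
      fun σ₃ a₃ h₃ => ?_
    · intro σ' hm v hv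
      rw [hm 17 (by simp), m₂ 17 (by simp), m₁ 17 (by simp) (by simp) (by simp)]
      exact h17 v hv
    · intro v hv
      rw [m₂ 15 (by simp), m₁ 15 (by simp) (by simp) (by simp)]
      exact h15 v hv
    · intro v hv
      rw [m₂ 5 (by simp)]
      exact (h₁ v hv).1
    have i₃ : Input n arcs σ₃ := i₂.agree a₃ (fun h => by have := w1 _ h; omega)
      (fun h => by have := w1 _ h; omega) (fun h => by have := w1 _ h; omega)
      (fun h => by have := w2 _ h; omega) (fun h => by have := w2 _ h; omega)
    have m₃ : ∀ a, 12 < a → σ₃.mem a = σ₂.mem a := fun a h =>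
      a₃.mem a fun h => by have := w2 _ h; omega
    have c₃ : σ₃.coins = σ₂.coins := a₃.coins w3
    refine (Ends.seq (ends_pointProg ω (n := n) (mark := mark) i₃.zero h₃.1 h₃.2.1 ?_ hlt ?_)
      fun σ₄ a₄ h₄ => ?_).mono (T := ((pointBody.size + 2) * L.length + 2) +
        (((updateBody j).size + 2) * n + 2)) ?_ fun _ _ h => h
    · intro v hv
      rw [m₃ 16 (by simp), ← hmark v hv]
      exact h₂.1 v hv
    · intro v hv
      rw [m₃ 13 (by simp), m₃ 14 (by simp), m₂ 13 (by simp), m₂ 14 (by simp)]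
      exact (h₁ v hv).2
    · have i₄ : Input n arcs σ₄ := i₃.agree a₄
        (by simp [pointProg, forLoop, pointBody, pointHead, pointTail])
        (by simp [pointProg, forLoop, pointBody, pointHead, pointTail])
        (by simp [pointProg, forLoop, pointBody, pointHead, pointTail])
        (by simp [pointProg, forLoop, pointBody, pointHead, pointTail])
        (by simp [pointProg, forLoop, pointBody, pointHead, pointTail])
      have c₄ : σ₄.coins = σ₃.coins :=
        a₄.coins (by simp [pointProg, forLoop, pointBody, pointHead, pointTail])
      refine (ends_updateProg ω j i₄.size i₄.zero h₄ (r := r) ?_).mono le_rfl fun σ₅ a₅ h₅ => ?_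
      · intro v hv
        rw [a₄.mem 15 (by simp [pointProg, forLoop, pointBody, pointHead, pointTail]),
          m₃ 15 (by simp), m₂ 15 (by simp), m₁ 15 (by simp) (by simp) (by simp)]
        exact h15 v hv
      · refine ⟨?_, h₅⟩
        rw [a₅.coins (by simp [updateProg, forLoop, updateBody]), c₄, c₃, h₂.2]
    · have := Nat.mul_le_mul_left (pointBody.size + 2) h₃.2.2
      exact Nat.add_le_add_right (Nat.add_le_add_right this 2) _
  · nlinarith [Nat.zero_le ((clearBody.size) * arcs.length), Nat.zero_le (markBody.size * arcs.length),
      Nat.zero_le (C * n), Nat.zero_le (pointBody.size * n),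
      Nat.zero_le ((updateBody j).size * arcs.length), Nat.zero_le clearBody.size,
      Nat.zero_le markBody.size, Nat.zero_le pointBody.size, Nat.zero_le (updateBody j).size]

end CycleSearch

namespace CycleSearch

open RAM

def stagesProg (D : ℕ) : ℕ → Prog
  | 0 => .instr .skip
  | m + 1 => stagesProg D m ;; stageProg D m

theorem stagesProg_writes (D m : ℕ) :
    (∀ r, (stagesProg D m).WritesReg r → r = 2 ∨ 5 ≤ r ∧ r ≤ 23) ∧
      ∀ a, (stagesProg D m).WritesMem a → 5 ≤ a ∧ a ≤ 16 ∨ 20 ≤ a ∧ a < 20 + m := by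
  induction m with
  | zero => simp [stagesProg]
  | succ m ih =>
    obtain ⟨h1, h2⟩ := stageProg_writes D m
    constructor
    · rintro r (h | h)
      · exact ih.1 r h
      · exact h1 r h
    · rintro a (h | h)
      · have := ih.2 a h; omega
      · have := h2 a h; omega

theorem exists_ends_stagesProg (k D m : ℕ) : ∃ C : ℕ, ∀ (ω : ℕ → Bool) (d n : ℕ)
    (arcs : List (ℕ × ℕ)) (σ : State) (c : ℕ → ℕ) (c₀ : ℕ), Input n arcs σ → ArcList n arcs →
    (∀ v < n, σ.mem 17 v = c v) → (∀ v < n, σ.mem 15 v = v) → 4 * d ≤ D →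
    (∀ j, SparseList d (stageEdges arcs c (rep k D arcs (coinBits ω n c₀) c j) j)) →
    σ.coins = c₀ + k * n →
    Ends ω (stagesProg D m) σ (C * (n + arcs.length + 1)) fun σ' =>
      σ'.coins = c₀ + (k + m) * n ∧
      (∀ v < n, σ'.mem 15 v = rep k D arcs (coinBits ω n c₀) c m v ∧
        rep k D arcs (coinBits ω n c₀) c m v < n) ∧
      ∀ i < m, ∀ v < n, σ'.mem (20 + i) v = hist k D arcs (coinBits ω n c₀) c i v := by
  induction m with
  | zero =>
    refine ⟨1, fun ω d n arcs σ c c₀ _ _ _ h15 _ _ hc => ?_⟩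
    refine (Prog.LoopFree.ends (p := .instr .skip) trivial ?_).mono (by simp [Prog.size])
      fun _ _ h => h
    exact ⟨hc, fun v hv => ⟨h15 v hv, hv⟩, by simp⟩
  | succ m ih =>
    obtain ⟨C, hC⟩ := ih
    obtain ⟨C', hC'⟩ := exists_ends_stageProg D m
    obtain ⟨w1, w2⟩ := stagesProg_writes D m
    refine ⟨C + C', fun ω d n arcs σ c c₀ hσ harcs h17 h15 hD hs hc => ?_⟩
    rw [add_mul]
    refine (hC ω d n arcs σ c c₀ hσ harcs h17 h15 hD hs hc).seq fun σ₁ a₁ h₁ => ?_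
    have i₁ : Input n arcs σ₁ := hσ.agree a₁ (fun h => by have := w1 _ h; omega)
      (fun h => by have := w1 _ h; omega) (fun h => by have := w1 _ h; omega)
      (fun h => by have := w2 _ h; omega) (fun h => by have := w2 _ h; omega)
    refine (hC' ω d n arcs σ₁ c _ (coinBits ω n c₀ (k + m)) i₁ harcs ?_ h₁.2.1 hD (hs m) ?_).mono le_rfl fun σ₂ a₂ h₂ => ?_
    · intro v hv
      rw [a₁.mem 17 fun h => by have := w2 _ h; omega]
      exact h17 v hv
    · intro v hv
      simp [coinBits, h₁.1, hv]
    · refine ⟨by rw [h₂.1, h₁.1]; ring, fun v hv => ⟨(h₂.2 v hv).1, (h₂.2 v hv).2.1⟩,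
        fun i hi v hv => ?_⟩
      by_cases him : i = m
      · subst him
        exact (h₂.2 v hv).2.2
      · rw [a₂.mem (20 + i) fun h => by have := (stageProg_writes D m).2 _ h; omega]
        exact h₁.2.2 i (by omega) v hv

/-- One trial of the algorithm. -/
def trialProg (k D : ℕ) : Prog :=
  initProg ;; colourProg k ;; clearProg ;; orientProg orientCond D ;; cleanProg k ;;
    stagesProg D (k - 1) ;; closeProg k ;; recoverProg k

theorem trialProg_writes (k D : ℕ) :
    (∀ r, (trialProg k D).WritesReg r → r = 2 ∨ r = 3 ∨ 5 ≤ r) ∧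
      ∀ a, (trialProg k D).WritesMem a → a = 2 ∨ 4 ≤ a := by
  obtain ⟨h1, h2, -⟩ := (decides_orientCond 0 fun _ => True).orientProg_writes D
  constructor
  · rintro r (h | h | h | h | h | h | h | h)
    · simp [initProg, initBody, forLoop] at h; omega
    · have := colourProg_writesReg k r h; omega
    · simp [clearProg, clearBody, forLoop] at h; omega
    · have := h1 r h; omega
    · simp [cleanProg, copyBody, cleanBody, cleanHead, cleanTail, forLoop] at h; omega
    · have := (stagesProg_writes D (k - 1)).1 r h; omega
    · simp [closeProg, closeBody, closeHead, closeTail, forLoop] at h; omega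
    · have := walkProg_writesReg (k - 1) r
      simp [recoverProg] at h
      rcases h with h | h | h
      · omega
      · omega
      · have := this h; omega
  · rintro a (h | h | h | h | h | h | h | h)
    · simp [initProg, initBody, forLoop] at h; omega
    · have := colourProg_writesMem k a h; omega
    · simp [clearProg, clearBody, forLoop] at h; omega
    · have := h2 a h; omega
    · simp [cleanProg, copyBody, cleanBody, cleanHead, cleanTail, forLoop] at h; omega
    · have := (stagesProg_writes D (k - 1)).2 a h; omega
    · simp [closeProg, closeBody, closeHead, closeTail, forLoop] at h
    · have := walkProg_writesMem (k - 1) a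
      simp [recoverProg] at h
      rcases h with h | h
      · omega
      · have := this h; omega

/-- The vertices `y 0, …, y (k - 1)` form a cycle, and their colours are `1, …, k`. -/
structure ColouredCycle (k : ℕ) (arcs : List (ℕ × ℕ)) (c y : ℕ → ℕ) : Prop where
  colour : ∀ i < k, c (y i) = i + 1
  arc : ∀ i, i + 1 < k → (y (i + 1), y i) ∈ arcs
  closing : (y (k - 1), y 0) ∈ arcs

theorem exists_ends_trialProg (k D : ℕ) (hk : 1 ≤ k) : ∃ C : ℕ, ∀ (ω : ℕ → Bool) (d n : ℕ)
    (arcs : List (ℕ × ℕ)) (σ : State), Input n arcs σ → ArcList n arcs → σ.reg 3 = 0 → 4 * d ≤ D →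
    SparseList d (collect (fun x b => decide (x < b)) id arcs) →
    (∀ bits c j, SparseList d (stageEdges arcs c (rep k D arcs bits c j) j)) →
    Ends ω (trialProg k D) σ (C * (n + arcs.length + 1)) fun σ' =>
      σ'.coins = σ.coins + (k + (k - 1)) * n ∧
      ((σ'.reg 3 = 0 ∧ ¬ Found k D arcs (coinBits ω n σ.coins)) ∨
        (σ'.reg 3 = 1 ∧ Found k D arcs (coinBits ω n σ.coins) ∧
          ColouredCycle k arcs (cleanColour k D arcs (coinBits ω n σ.coins)) (σ'.mem 2))) := by
  obtain ⟨C₁, hC₁⟩ := exists_ends_orient orientCond D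
  obtain ⟨C₂, hC₂⟩ := exists_ends_stagesProg k D (k - 1)
  refine ⟨(initBody.size + 2) + (9 * k + 1) + (clearBody.size + 2) + C₁ +
    ((copyBody.size + 2) + 2 * ((cleanBody k).size + 2)) + C₂ + ((closeBody k).size + 2) +
      (recoverProg k).size + 8, ?_⟩
  intro ω d n arcs σ hσ harcs h3 hD hs hs'
  set bits := coinBits ω n σ.coins with hbits
  obtain ⟨w1, w2, w3⟩ := (decides_orientCond 0 fun _ => True).orientProg_writes D
  have e1 := ends_initProg ω hσ.zero
  rw [hσ.size] at e1
  refine (e1.seq (T' := (k * (9 * (n + 1)) + 1) + (((clearBody.size + 2) * n + 2) +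
    (C₁ * (arcs.length + 1) + ((((copyBody.size + 2) * n + 2) +
      (((cleanBody k).size + 2) * (2 * arcs.length) + 2)) + (C₂ * (n + arcs.length + 1) +
        (((closeBody k).size + 2) * arcs.length + 2 + (recoverProg k).size))))))
    fun σ₁ a₁ h₁ => ?_).mono ?_ fun _ _ h => h
  · have r₁ : ∀ r, r ≠ 2 → σ₁.reg r = σ.reg r := fun r h =>
      a₁.reg r (by simp [initProg, initBody, forLoop, h])
    have i₁ : Input n arcs σ₁ := hσ.agree a₁ (by simp [initProg, initBody, forLoop])
      (by simp [initProg, initBody, forLoop]) (by simp [initProg, initBody, forLoop])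
      (by simp [initProg, initBody, forLoop]) (by simp [initProg, initBody, forLoop])
    have c₁ : σ₁.coins = σ.coins := a₁.coins (by simp [initProg, initBody, forLoop])
    have e2 := ends_colourProg ω k (σ := σ₁) i₁.zero (by rw [i₁.size]; exact h₁.2)
    rw [i₁.size, c₁, ← hbits] at e2
    refine e2.seq fun σ₂ a₂ h₂ => ?_
    have r₂ : ∀ r, r ≠ 2 → r ≠ 5 → r ≠ 6 → σ₂.reg r = σ₁.reg r := fun r h h' h'' =>
      a₂.reg r fun hw => by rcases colourProg_writesReg k r hw with h | h | h <;> omega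
    have m₂ : ∀ a, a ≠ 4 → σ₂.mem a = σ₁.mem a := fun a h =>
      a₂.mem a fun hw => h (colourProg_writesMem k a hw)
    have i₂ : Input n arcs σ₂ := i₁.agree a₂
      (fun h => by have := colourProg_writesReg _ _ h; omega)
      (fun h => by have := colourProg_writesReg _ _ h; omega)
      (fun h => by have := colourProg_writesReg _ _ h; omega)
      (fun h => by have := colourProg_writesMem _ _ h; omega)
      (fun h => by have := colourProg_writesMem _ _ h; omega)
    have e3 := ends_clearProg ω i₂.zero
    rw [i₂.size] at e3
    refine e3.seq fun σ₃ a₃ h₃ => ?_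
    have i₃ : Input n arcs σ₃ := i₂.agree a₃ (by simp [clearProg, clearBody, forLoop])
      (by simp [clearProg, clearBody, forLoop]) (by simp [clearProg, clearBody, forLoop])
      (by simp [clearProg, clearBody, forLoop]) (by simp [clearProg, clearBody, forLoop])
    have r₃ : ∀ r, r ≠ 2 → σ₃.reg r = σ₂.reg r := fun r h =>
      a₃.reg r (by simp [clearProg, clearBody, forLoop, h])
    have m₃ : ∀ a, a ≠ 5 → a ≠ 13 → a ≠ 14 → σ₃.mem a = σ₂.mem a := fun a h h' h'' =>
      a₃.mem a (by simp [clearProg, clearBody, forLoop, h, h', h''])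
    have c₃ : σ₃.coins = σ₂.coins := a₃.coins (by simp [clearProg, clearBody, forLoop])
    refine (hC₁ ω d n arcs σ₃ (fun _ => True) _ id (decides_orientCond n _) (fun _ _ => trivial) i₃
      harcs ?_ (fun v hv => (h₃ v hv).1) hD hs).seq fun σ₄ a₄ h₄ => ?_
    · intro v hv
      rw [m₃ 15 (by simp) (by simp) (by simp), m₂ 15 (by simp)]
      exact ⟨h₁.1 v hv, hv⟩
    have i₄ : Input n arcs σ₄ := i₃.agree a₄ (fun h => by have := w1 _ h; omega)
      (fun h => by have := w1 _ h; omega) (fun h => by have := w1 _ h; omega)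
      (fun h => by have := w2 _ h; omega) (fun h => by have := w2 _ h; omega)
    have m₄ : ∀ a, a < 5 ∨ 12 < a → σ₄.mem a = σ₃.mem a := fun a h =>
      a₄.mem a fun hw => by have := w2 _ hw; omega
    have c₄ : σ₄.coins = σ₃.coins := a₄.coins w3
    have r₄ : σ₄.reg 3 = σ₃.reg 3 := a₄.reg 3 fun hw => by have := w1 _ hw; omega
    refine (Ends.mono (ends_cleanProg ω (k := k) (c := colour bits k) i₄.size i₄.zero h₄.1 h₄.2.1 ?_
      fun t ht => harcs.lt_of_mem_peel (fun v hv => hv) ht) ?_ fun _ _ h => h).seq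
      fun σ₅ a₅ h₅ => ?_
    · intro v hv
      rw [m₄ 4 (by simp), m₃ 4 (by simp) (by simp) (by simp)]
      exact h₂.1 v hv
    · have := Nat.mul_le_mul_left ((cleanBody k).size + 2) h₄.2.2
      omega
    have h17 : ∀ v < n, σ₅.mem 17 v = cleanColour k D arcs bits v := h₅
    have w5 : ∀ r, (cleanProg k).WritesReg r → r = 2 ∨ 5 ≤ r := by
      intro r h
      simp [cleanProg, copyBody, cleanBody, cleanHead, cleanTail, forLoop] at h
      omega
    have w5' : ∀ a, (cleanProg k).WritesMem a → a = 17 := by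
      intro a h
      simp [cleanProg, copyBody, cleanBody, cleanHead, cleanTail, forLoop] at h
      omega
    have i₅ : Input n arcs σ₅ := i₄.agree a₅ (fun h => by have := w5 _ h; omega)
      (fun h => by have := w5 _ h; omega) (fun h => by have := w5 _ h; omega)
      (fun h => by have := w5' _ h; omega) (fun h => by have := w5' _ h; omega)
    have c₅ : σ₅.coins = σ₄.coins :=
      a₅.coins (by simp [cleanProg, copyBody, cleanBody, cleanHead, cleanTail, forLoop])
    have r₅ : σ₅.reg 3 = σ₄.reg 3 := a₅.reg 3 fun h => by have := w5 _ h; omega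
    refine (hC₂ ω d n arcs σ₅ _ σ.coins i₅ harcs h17 ?_ hD (fun j => hs' _ _ j) ?_).seq
      fun σ₆ a₆ h₆ => ?_
    · intro v hv
      rw [a₅.mem 15 (fun h => by have := w5' _ h; omega), m₄ 15 (by simp),
        m₃ 15 (by simp) (by simp) (by simp), m₂ 15 (by simp)]
      exact h₁.1 v hv
    · rw [c₅, c₄, c₃, h₂.2]
    rw [← hbits] at h₆
    obtain ⟨w6, w6'⟩ := stagesProg_writes D (k - 1)
    have i₆ : Input n arcs σ₆ := i₅.agree a₆ (fun h => by have := w6 _ h; omega)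
      (fun h => by have := w6 _ h; omega) (fun h => by have := w6 _ h; omega)
      (fun h => by have := w6' _ h; omega) (fun h => by have := w6' _ h; omega)
    have r₆ : σ₆.reg 3 = 0 := by
      rw [a₆.reg 3 fun h => by have := w6 _ h; omega, r₅, r₄, r₃ 3 (by simp),
        r₂ 3 (by simp) (by simp) (by simp), r₁ 3 (by simp), h3]
    have h17' : ∀ v < n, σ₆.mem 17 v = cleanColour k D arcs bits v := by
      intro v hv
      rw [a₆.mem 17 fun h => by have := w6' _ h; omega]
      exact h17 v hv
    refine (ends_closeProg ω k i₆ harcs.lt r₆ h17' fun v hv => (h₆.2.1 v hv).1).seq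
      fun σ₇ a₇ h₇ => ?_
    have w7 : ∀ r, (closeProg k).WritesReg r → r ≠ 4 := by
      rintro r h rfl
      simp [closeProg, closeBody, closeHead, closeTail, forLoop] at h
    have z₇ : σ₇.reg 4 = 0 := by rw [a₇.reg 4 fun h => w7 _ h rfl, i₆.zero]
    have M₇ : ∀ a, σ₇.mem a = σ₆.mem a := fun a =>
      a₇.mem a (by simp [closeProg, closeBody, closeHead, closeTail, forLoop])
    have c₇ : σ₇.coins = σ.coins + (k + (k - 1)) * n := by
      rw [a₇.coins (by simp [closeProg, closeBody, closeHead, closeTail, forLoop]), h₆.1]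
    have hlf : (recoverProg k).LoopFree := by simp [recoverProg, walkProg_loopFree]
    refine hlf.ends ?_
    have hag := hlf.agree (ω := ω) σ₇
    refine ⟨by rw [hag.coins (by simp [recoverProg, walkProg_tosses]), c₇], ?_⟩
    have hrec3 : ((recoverProg k).eval ω σ₇).reg 3 = σ₇.reg 3 := hag.reg 3 (by
      have := walkProg_writesReg (k - 1) 3
      simp [recoverProg]
      intro h
      have := this h
      omega)
    rw [hrec3]
    rcases h₇ with ⟨h, hn⟩ | ⟨h, e, he, hc1, hc2, hr, h30, h31⟩
    · left
      refine ⟨h, ?_⟩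
      rintro ⟨e, he, hcl⟩
      exact hn e he hcl
    · right
      refine ⟨h, ⟨e, he, hc1, hc2, hr⟩, ?_⟩
      obtain ⟨hlt1, hlt2⟩ := harcs.lt e he
      obtain ⟨τ, hτ⟩ : ∃ τ, τ = (Prog.instr (.copy 32 30) ;; .instr (.const 6 (k - 1)) ;;
        .instr (.store 2 6 32)).eval ω σ₇ := ⟨_, rfl⟩
      have hev : (recoverProg k).eval ω σ₇ = (walkProg (k - 1)).eval ω τ := by
        rw [hτ]
        simp [recoverProg, z₇, h]
      rw [hev]
      obtain ⟨g1, g2, g3⟩ := walkProg_spec ω (k := k) (D := D) (bits := bits) (σ := τ) harcs.lt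
        hlt2 hc2 (k - 1) hlt1 (by omega) hr (by simp [hτ, z₇]) (by simp [hτ, h31])
        (by simp [hτ, h30]) (fun i hi v hv => by
          have : 20 + i ≠ 2 := by omega
          simp [hτ, this, M₇]
          exact h₆.2.2 i hi v hv) (by simp [hτ, h30])
      have hlast : ((walkProg (k - 1)).eval ω τ).mem 2 (k - 1) = e.1 := by
        rw [g1 _ le_rfl]
        simp [hτ, h30]
      refine ⟨fun i hi => ?_, fun i hi => (g3 i (by omega)).1, by rw [g2, hlast]; exact he⟩
      by_cases hik : i = k - 1
      · rw [hik, hlast, hc1]; omega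
      · exact (g3 i (by omega)).2
  · generalize initBody.size = x1
    generalize clearBody.size = x2
    generalize copyBody.size = x3
    generalize (cleanBody k).size = x4
    generalize (closeBody k).size = x5
    generalize (recoverProg k).size = x6
    generalize arcs.length = M
    have := Nat.zero_le ((x1 + x2 + x3 + 9 * k) * M)
    have := Nat.zero_le ((C₁ + 2 * x4 + x5 + x6) * n)
    have := Nat.zero_le (x6 * M)
    have := Nat.zero_le (x1 + x2 + x3 + 2 * x4 + x5)
    nlinarith

end CycleSearch

namespace CycleSearch

open RAM

/-! ### The output -/

theorem cycleGraph_adj_iff {k : ℕ} (hk : 3 ≤ k) (i j : Fin k) :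
    (SimpleGraph.cycleGraph k).Adj i j ↔ badPair k (i + 1) (j + 1) = false := by
  have hsub : ∀ i j : Fin k, (i - j).val = 1 ↔ i.val = j + 1 ∨ (i.val = 0 ∧ j.val + 1 = k) := by
    intro i j
    have hi := i.2
    have hj := j.2
    rcases le_or_gt j i with h | h
    · rw [Fin.sub_val_of_le h]
      have : j.val ≤ i.val := h
      omega
    · rw [Fin.coe_sub_iff_lt.2 h]
      have : i.val < j.val := h
      omega
  have hi := i.2
  have hj := j.2
  rw [SimpleGraph.cycleGraph_adj', hsub, hsub, badPair, decide_eq_false_iff_not]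
  omega

variable {n : ℕ} {G : SimpleGraph (Fin n)} {arcs : List (ℕ × ℕ)}

theorem IsArcs.mem_iff (hA : IsArcs G arcs) (u v : Fin n) : (u.1, v.1) ∈ arcs ↔ G.Adj u v := by
  rw [hA]
  constructor
  · rintro ⟨u', v', h, e⟩
    rw [Prod.mk.injEq] at e
    rwa [Fin.ext e.1, Fin.ext e.2]
  · exact fun h => ⟨u, v, h, rfl⟩

theorem ColouredCycle.outputs {d k D : ℕ} (hG : SparseMinors d G) (hA : IsArcs G arcs)
    (hD : 4 * d ≤ D) (hk : 3 ≤ k) {bits : ℕ → ℕ → Bool} {σ : State}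
    (h : ColouredCycle k arcs (cleanColour k D arcs bits) (σ.mem 2)) :
    OutputsInducedCycle G k σ := by
  have hlt : ∀ i < k, σ.mem 2 i < n := by
    intro i hi
    by_cases h0 : i = 0
    · obtain ⟨u, v, -, e⟩ := (hA _).1 h.closing
      rw [Prod.mk.injEq] at e
      rw [h0, e.2]
      exact v.2
    · obtain ⟨u, v, -, e⟩ := (hA _).1 (h.arc (i - 1) (by omega))
      rw [Prod.mk.injEq] at e
      rw [show i = i - 1 + 1 by omega, e.1]
      exact u.2
  let f : Fin k → Fin n := fun i => ⟨σ.mem 2 i, hlt i i.2⟩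
  have hf : Function.Injective f := by
    intro i j hij
    have h1 := h.colour i i.2
    have h2 := h.colour j j.2
    rw [show σ.mem 2 i = σ.mem 2 j from congrArg Fin.val hij] at h1
    exact Fin.ext (by omega)
  have hsucc : ∀ i j : Fin k, (j : ℕ) = i + 1 → G.Adj (f j) (f i) := by
    intro i j hij
    rw [← hA.mem_iff]
    have := h.arc i (by have := j.2; omega)
    rwa [← hij] at this
  have hlast : ∀ i j : Fin k, (j : ℕ) = 0 → (i : ℕ) + 1 = k → G.Adj (f i) (f j) := by
    intro i j hj hi
    rw [← hA.mem_iff]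
    have := h.closing
    rwa [show k - 1 = i by omega, ← hj] at this
  refine ⟨⟨⟨f, hf⟩, fun {i j} => ?_⟩, fun i => rfl⟩
  change G.Adj (f i) (f j) ↔ _
  rw [cycleGraph_adj_iff hk]
  constructor
  · intro hadj
    have := not_badPair_of_mem_arcs (k := k) (bits := bits) hG hA hD ((hA.mem_iff _ _).2 hadj)
    rwa [show cleanColour k D arcs bits (f i) = i + 1 from h.colour i i.2,
      show cleanColour k D arcs bits (f j) = j + 1 from h.colour j j.2] at this
  · intro hb
    rw [badPair, decide_eq_false_iff_not] at hb
    by_cases h1 : (j : ℕ) = i + 1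
    · exact (hsucc i j h1).symm
    by_cases h2 : (i : ℕ) = j + 1
    · exact hsucc j i h2
    by_cases h3 : (i : ℕ) = 0 ∧ (j : ℕ) + 1 = k
    · exact (hlast j i h3.1 h3.2).symm
    · exact hlast i j (by omega) (by omega)

/-! ### The input -/

/-- The arcs of a graph that is given by adjacency lists. -/
def arcsOf (adj : Fin n → List (Fin n)) : List (ℕ × ℕ) :=
  (List.ofFn fun v => (adj v).map fun w => (v.1, w.1)).flatten

variable {adj : Fin n → List (Fin n)}

theorem _root_.IsAdjacencyList.isArcs (h : IsAdjacencyList G adj) : IsArcs G (arcsOf adj) := by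
  rintro e
  simp only [arcsOf, List.mem_flatten, List.mem_ofFn]
  constructor
  · rintro ⟨_, ⟨v, rfl⟩, he⟩
    obtain ⟨w, hw, rfl⟩ := List.mem_map.1 he
    exact ⟨v, w, ((h v).2 w).1 hw, rfl⟩
  · rintro ⟨u, v, huv, rfl⟩
    exact ⟨_, ⟨u, rfl⟩, List.mem_map.2 ⟨v, ((h u).2 v).2 huv, rfl⟩⟩

theorem arcList_arcsOf (adj : Fin n → List (Fin n)) : ArcList n (arcsOf adj) := by
  constructor
  · rw [arcsOf, List.pairwise_flatten]
    constructor
    · intro l hl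
      obtain ⟨v, rfl⟩ := List.mem_ofFn.1 hl
      rw [List.pairwise_map]
      exact List.pairwise_of_forall fun _ _ => le_rfl
    · rw [List.pairwise_ofFn]
      intro v w hvw x hx y hy
      obtain ⟨x, -, rfl⟩ := List.mem_map.1 hx
      obtain ⟨y, -, rfl⟩ := List.mem_map.1 hy
      exact hvw.le
  · intro e he
    obtain ⟨_, hl, he⟩ := List.mem_flatten.1 he
    obtain ⟨v, rfl⟩ := List.mem_ofFn.1 hl
    obtain ⟨w, -, rfl⟩ := List.mem_map.1 he
    exact ⟨v.2, w.2⟩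

theorem sum_length_take_ofFn (adj : Fin n → List (Fin n)) (i : ℕ) :
    ((((List.ofFn fun v => (adj v).map fun w => (v.1, w.1))).take i).map List.length).sum =
      (inputState adj).mem 0 i := by
  have : (List.ofFn fun v => (adj v).map fun w => (v.1, w.1)).map List.length =
      (List.ofFn adj).map List.length := by
    simp [List.map_ofFn, Function.comp_def]
  rw [List.map_take, this, ← List.map_take]
  simp [inputState]

theorem inputState_mem_zero_last (adj : Fin n → List (Fin n)) :
    (inputState adj).mem 0 n = (arcsOf adj).length := by
  rw [← sum_length_take_ofFn, arcsOf, List.length_flatten, List.take_of_length_le (by simp)]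

theorem inputState_mem_one (adj : Fin n → List (Fin n)) {q : ℕ} {e : ℕ × ℕ}
    (h : (arcsOf adj)[q]? = some e) : (inputState adj).mem 1 q = e.2 := by
  have hm : (arcsOf adj).map Prod.snd = (List.ofFn adj).flatten.map Fin.val := by
    simp [arcsOf, List.map_flatten, List.map_ofFn, Function.comp_def]
  have : ((List.ofFn adj).flatten.map Fin.val)[q]? = some e.2 := by
    rw [← hm, List.getElem?_map, h]
    rfl
  simp only [inputState]
  simp only [one_ne_zero, if_false, if_true]
  rw [List.getD_eq_getElem?_getD, this]
  rfl

theorem fst_eq_of_getElem?_arcsOf (adj : Fin n → List (Fin n)) {q : ℕ} {e : ℕ × ℕ} {v : ℕ}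
    (h : (arcsOf adj)[q]? = some e) (hv : v < n) (h1 : (inputState adj).mem 0 v ≤ q)
    (h2 : q < (inputState adj).mem 0 (v + 1)) : e.1 = v := by
  have hd := List.drop_take_succ_flatten_eq_getElem
    (List.ofFn fun v => (adj v).map fun w => (v.1, w.1)) v (by simpa using hv)
  rw [← List.map_take, ← List.map_take, sum_length_take_ofFn, sum_length_take_ofFn] at hd
  have : e ∈ (List.ofFn fun v => (adj v).map fun w => (v.1, w.1))[v]'(by simpa using hv) := by
    rw [← hd]
    refine List.mem_of_getElem? (i := q - (inputState adj).mem 0 v) ?_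
    rw [List.getElem?_drop, Nat.add_sub_cancel' h1, List.getElem?_take_of_lt h2]
    exact h
  rw [List.getElem_ofFn] at this
  obtain ⟨w, -, rfl⟩ := List.mem_map.1 this
  rfl

theorem _root_.IsAdjacencyList.length_arcsOf (h : IsAdjacencyList G adj) :
    (arcsOf adj).length = 2 * G.edgeSet.ncard := by
  classical
  have hdeg : ∀ v, (adj v).length = G.degree v := by
    intro v
    rw [← SimpleGraph.card_neighborFinset_eq_degree, ← List.toFinset_card_of_nodup (h v).1]
    congr 1
    ext w
    simp [(h v).2 w]
  have := SimpleGraph.sum_degrees_eq_twice_card_edges G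
  rw [Set.ncard_eq_toFinset_card', ← SimpleGraph.edgeFinset, ← this, arcsOf, List.length_flatten,
    List.map_ofFn, List.sum_ofFn]
  simp [hdeg]

def prepBody : Prog :=
  .instr (.load 8 0 7) ;; .cond (.lt 6 8) (.instr (.store 3 6 5) ;; .instr (.inc 6))
    (.instr (.inc 5) ;; .instr (.inc 7))

/-- Compute the number and the tails of the arcs. -/
def prepProg : Prog :=
  .instr (.load 1 0 0) ;; .instr (.const 7 1) ;; .loop (.lt 5 0) prepBody

theorem ends_prepProg (ω : ℕ → Bool) (adj : Fin n → List (Fin n)) :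
    Ends ω prepProg (inputState adj) (8 * (n + (arcsOf adj).length) + 3) fun σ =>
      Input n (arcsOf adj) σ ∧ σ.reg 3 = 0 ∧ σ.coins = 0 := by
  set off := (inputState adj).mem 0 with hoff
  set M := (arcsOf adj).length with hM
  have hn : off n = M := inputState_mem_zero_last adj
  have hmono : ∀ v, off v ≤ off (v + 1) := by
    intro v
    simp only [hoff, ← sum_length_take_ofFn]
    refine List.Sublist.sum_le_sum ?_ (by simp)
    exact (List.take_sublist_take_left (by omega)).map _
  have hle : ∀ v ≤ n, off v ≤ M := fun v hv => hn ▸ monotone_nat_of_le_succ hmono hv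
  have e1 : Ends ω (.instr (.load 1 0 0) ;; .instr (.const 7 1)) (inputState adj) 2 fun σ =>
      σ = (Prog.instr (.load 1 0 0) ;; .instr (.const 7 1)).eval ω (inputState adj) :=
    Prog.LoopFree.ends (by simp) rfl
  have hloop : ∀ σ, σ = (Prog.instr (.load 1 0 0) ;; .instr (.const 7 1)).eval ω (inputState adj) →
      Ends ω (.loop (.lt 5 0) prepBody) σ (8 * (n + M) + 1) fun σ =>
        Input n (arcsOf adj) σ ∧ σ.reg 3 = 0 ∧ σ.coins = 0 := by
    intro σ hσ
    have s0 : σ.reg 0 = n := by simp [hσ, inputState]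
    have s1 : σ.reg 1 = M := by
      have : (inputState adj).reg 0 = n := rfl
      simp [hσ, this, ← hoff, hn]
    have sr : ∀ r, r ≠ 0 → r ≠ 1 → r ≠ 7 → σ.reg r = 0 := by
      intro r h h' h''; simp [hσ, inputState, h, h', h'']
    have s7 : σ.reg 7 = 1 := by simp [hσ]
    have sm : σ.mem = (inputState adj).mem := by simp [hσ]
    have sc : σ.coins = 0 := by simp [hσ, inputState]
    have h := Ends.loop (ω := ω) (b := .lt 5 0) (p := prepBody) (σ := σ)
      (fun σ' => σ'.reg 7 = σ'.reg 5 + 1 ∧ σ'.reg 5 ≤ n ∧ off (σ'.reg 5) ≤ σ'.reg 6 ∧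
        σ'.reg 6 ≤ M ∧ ∀ (q : ℕ) (e : ℕ × ℕ), q < σ'.reg 6 → (arcsOf adj)[q]? = some e →
          σ'.mem 3 q = e.1)
      (fun σ' => 8 * ((n - σ'.reg 5) + (M - σ'.reg 6))) ?_ ?_
    · refine h.mono ?_ ?_
      · simp only [sr 5 (by simp) (by simp) (by simp), sr 6 (by simp) (by simp) (by simp)]
        omega
      · rintro σ' ha ⟨⟨h7, h5, ho, h6, hm⟩, hb⟩
        have a0 : σ'.reg 0 = n := by rw [ha.reg 0 (by simp [prepBody]), s0]
        have hb' : ¬ σ'.reg 5 < σ'.reg 0 := hb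
        have h5' : σ'.reg 5 = n := by omega
        rw [h5', hn] at ho
        refine ⟨⟨a0, ?_, ?_, fun q e he => ⟨hm q e ?_ he, ?_⟩⟩, ?_, ?_⟩
        · rw [ha.reg 1 (by simp [prepBody]), s1]
        · rw [ha.reg 4 (by simp [prepBody]), sr 4 (by simp) (by simp) (by simp)]
        · have := (List.getElem?_eq_some_iff.1 he).1
          omega
        · rw [ha.mem 1 (by simp [prepBody]), sm]
          exact inputState_mem_one adj he
        · rw [ha.reg 3 (by simp [prepBody]), sr 3 (by simp) (by simp) (by simp)]
        · rw [ha.coins (by simp [prepBody]), sc]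
    · rintro σ' ha ⟨h7, h5, ho, h6, hm⟩ hb
      have a0 : σ'.reg 0 = n := by rw [ha.reg 0 (by simp [prepBody]), s0]
      have am : σ'.mem 0 = off := by rw [ha.mem 0 (by simp [prepBody]), sm]
      have hb' : σ'.reg 5 < σ'.reg 0 := hb
      have hlt : σ'.reg 5 < n := by omega
      have hoM := hle (σ'.reg 5 + 1) (by omega)
      refine ⟨prepBody.size, Prog.LoopFree.ends (by simp [prepBody]) ?_⟩
      have hsize : prepBody.size = 6 := rfl
      rw [hsize]
      by_cases hc : σ'.reg 6 < off (σ'.reg 5 + 1)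
      · have t5 : (prepBody.eval ω σ').reg 5 = σ'.reg 5 := by simp [prepBody, am, h7, hc]
        have t6 : (prepBody.eval ω σ').reg 6 = σ'.reg 6 + 1 := by simp [prepBody, am, h7, hc]
        have t7 : (prepBody.eval ω σ').reg 7 = σ'.reg 7 := by simp [prepBody, am, h7, hc]
        have tm : (prepBody.eval ω σ').mem 3 =
            Function.update (σ'.mem 3) (σ'.reg 6) (σ'.reg 5) := by
          simp [prepBody, am, h7, hc]
        rw [t5, t6, t7, tm]
        refine ⟨⟨h7, h5, by omega, by omega, fun q e hq he => ?_⟩, by omega⟩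
        by_cases hq' : q = σ'.reg 6
        · rw [hq', Function.update_self]
          exact (fst_eq_of_getElem?_arcsOf adj he hlt (hq' ▸ ho) (hq' ▸ hc)).symm
        · rw [Function.update_of_ne hq']
          exact hm q e (by omega) he
      · have t5 : (prepBody.eval ω σ').reg 5 = σ'.reg 5 + 1 := by simp [prepBody, am, h7, hc]
        have t6 : (prepBody.eval ω σ').reg 6 = σ'.reg 6 := by simp [prepBody, am, h7, hc]
        have t7 : (prepBody.eval ω σ').reg 7 = σ'.reg 7 + 1 := by simp [prepBody, am, h7, hc]
        have tm : (prepBody.eval ω σ').mem 3 = σ'.mem 3 := by simp [prepBody, am, h7, hc]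
        rw [t5, t6, t7, tm]
        exact ⟨⟨by omega, by omega, by omega, h6, hm⟩, by omega⟩
    · rw [s7, sr 5 (by simp) (by simp) (by simp), sr 6 (by simp) (by simp) (by simp)]
      refine ⟨rfl, by omega, ?_, by omega, by simp⟩
      simp [hoff, inputState]
  obtain ⟨σ₁, t₁, hr, ht, rfl⟩ := e1
  cases hr with
  | seq hp hq =>
    obtain ⟨σ₂, t₂, hr₂, ht₂, hQ⟩ := hloop _ rfl
    exact ⟨σ₂, _, hp.seq (hq.seq hr₂), by omega, hQ⟩

end CycleSearch

namespace CycleSearch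

open RAM
open scoped ENNReal

/-! ### Probability -/

theorem coinMeasure_cylinder (S : Finset ℕ) (f : ℕ → Bool) :
    coinMeasure {ω | ∀ i ∈ S, ω i = f i} = 2⁻¹ ^ S.card := by
  have h : {ω : ℕ → Bool | ∀ i ∈ S, ω i = f i} = Set.pi (S : Set ℕ) fun i => {f i} := by
    ext ω; simp
  rw [h, coinMeasure, Measure.infinitePi_pi _ (fun _ _ => measurableSet_singleton _)]
  simp

/-- The event depends only on the first `c` coins. -/
def IsPrefixEvent (c : ℕ) (A : Set (ℕ → Bool)) : Prop :=
  ∀ ω ω' : ℕ → Bool, (∀ i < c, ω i = ω' i) → ω ∈ A → ω' ∈ A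

def extend (c : ℕ) (s : Fin c → Bool) (i : ℕ) : Bool := if h : i < c then s ⟨i, h⟩ else false

theorem IsPrefixEvent.eq_iUnion {c : ℕ} {A : Set (ℕ → Bool)} (hA : IsPrefixEvent c A) :
    A = ⋃ s : {s : Fin c → Bool // extend c s ∈ A},
      {ω | ∀ i ∈ Finset.range c, ω i = extend c s.1 i} := by
  ext ω
  simp only [Set.mem_iUnion, Set.mem_ofPred_eq, Finset.mem_range]
  constructor
  · intro h
    have e : ∀ i < c, ω i = extend c (fun i => ω i) i := fun i hi => by simp [extend, hi]
    exact ⟨⟨fun i => ω i, hA _ _ e h⟩, e⟩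
  · rintro ⟨s, hs⟩
    exact hA _ _ (fun i hi => (hs i hi).symm) s.2

theorem measurableSet_cylinder (S : Finset ℕ) (f : ℕ → Bool) :
    MeasurableSet {ω : ℕ → Bool | ∀ i ∈ S, ω i = f i} := by
  have h : {ω : ℕ → Bool | ∀ i ∈ S, ω i = f i} = Set.pi (S : Set ℕ) fun i => {f i} := by
    ext ω; simp
  rw [h]
  exact MeasurableSet.pi S.countable_toSet fun _ _ => measurableSet_singleton _

theorem IsPrefixEvent.measurableSet {c : ℕ} {A : Set (ℕ → Bool)} (hA : IsPrefixEvent c A) :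
    MeasurableSet A := by
  rw [hA.eq_iUnion]
  exact MeasurableSet.iUnion fun s => measurableSet_cylinder _ _

/-- If every outcome of the first coins that lies in `A` can be forced into `B` by few further
coins, then `B` is not much less likely than `A`. -/
theorem IsPrefixEvent.le_measure {c K : ℕ} {A B : Set (ℕ → Bool)} (hA : IsPrefixEvent c A)
    (h : ∀ ω ∈ A, ∃ (S : Finset ℕ) (f : ℕ → Bool), S.card ≤ K ∧ (∀ i ∈ S, c ≤ i) ∧
      ∀ ω' : ℕ → Bool, (∀ i < c, ω' i = ω i) → (∀ i ∈ S, ω' i = f i) → ω' ∈ B) :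
    2⁻¹ ^ K * coinMeasure A ≤ coinMeasure B := by
  classical
  choose! S f hcard hS hB using h
  set T := {s : Fin c → Bool // extend c s ∈ A}
  let g : T → ℕ → Bool := fun s i => if i < c then extend c s.1 i else f (extend c s.1) i
  let Z : T → Set (ℕ → Bool) := fun s =>
    {ω | ∀ i ∈ Finset.range c ∪ S (extend c s.1), ω i = g s i}
  have hZB : (⋃ s, Z s) ⊆ B := by
    intro ω hω
    obtain ⟨s, hs⟩ := Set.mem_iUnion.1 hω
    refine hB _ s.2 ω (fun i hi => ?_) fun i hi => ?_
    · rw [hs i (Finset.mem_union_left _ (Finset.mem_range.2 hi))]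
      simp [g, hi]
    · rw [hs i (Finset.mem_union_right _ hi)]
      simp [g, (hS _ s.2 i hi).not_gt]
  have hdisj : Pairwise (Function.onFun Disjoint Z) := by
    intro s s' hne
    rw [Function.onFun, Set.disjoint_left]
    intro ω hs hs'
    refine hne (Subtype.ext (funext fun i => ?_))
    have e1 := hs i (Finset.mem_union_left _ (Finset.mem_range.2 i.2))
    have e2 := hs' i (Finset.mem_union_left _ (Finset.mem_range.2 i.2))
    rw [e1] at e2
    simpa [g, extend] using e2
  have hZ : ∀ s, 2⁻¹ ^ K * 2⁻¹ ^ c ≤ coinMeasure (Z s) := by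
    intro s
    rw [coinMeasure_cylinder, ← pow_add]
    refine pow_le_pow_right_of_le_one' (by simp) ?_
    have := Finset.card_union_le (Finset.range c) (S (extend c s.1))
    have := hcard _ s.2
    rw [Finset.card_range] at *
    omega
  have hAle : coinMeasure A ≤ ∑ _s : T, 2⁻¹ ^ c := by
    conv_lhs => rw [hA.eq_iUnion]
    refine (measure_iUnion_le _).trans ?_
    rw [tsum_fintype]
    refine Finset.sum_le_sum fun s _ => ?_
    rw [coinMeasure_cylinder, Finset.card_range]
  calc 2⁻¹ ^ K * coinMeasure A ≤ 2⁻¹ ^ K * ∑ _s : T, 2⁻¹ ^ c := by gcongr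
    _ = ∑ _s : T, 2⁻¹ ^ K * 2⁻¹ ^ c := by rw [Finset.mul_sum]
    _ ≤ ∑ s : T, coinMeasure (Z s) := Finset.sum_le_sum fun s _ => hZ s
    _ = coinMeasure (⋃ s, Z s) := by
      rw [measure_iUnion hdisj fun s => measurableSet_cylinder _ _, tsum_fintype]
    _ ≤ coinMeasure B := measure_mono hZB

theorem coinBits_congr {ω ω' : ℕ → Bool} {n c r : ℕ} (h : ∀ i < c + r * n, ω i = ω' i) {i : ℕ}
    (hi : i < r) : coinBits ω n c i = coinBits ω' n c i := by
  ext v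
  by_cases hv : v < n
  · have : (i + 1) * n ≤ r * n := Nat.mul_le_mul_right n hi
    rw [add_mul, one_mul] at this
    rw [coinBits, coinBits, h _ (by omega)]
  · simp [coinBits, hv]

/-- A version of `IsPrefixEvent.le_measure` for the next row of bits. -/
theorem IsPrefixEvent.le_measure_row {n c r K : ℕ} {A B : Set (ℕ → Bool)}
    (hA : IsPrefixEvent (c + r * n) A)
    (h : ∀ ω ∈ A, ∃ (S : Finset ℕ) (w : ℕ), S.card ≤ K ∧ w < n ∧ ∀ ω' : ℕ → Bool,
      (∀ i < c + r * n, ω' i = ω i) → (∀ v ∈ S, coinBits ω' n c r v = decide (v = w)) → ω' ∈ B) :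
    2⁻¹ ^ K * coinMeasure A ≤ coinMeasure B := by
  refine hA.le_measure fun ω hω => ?_
  obtain ⟨S, w, hS, hw, hB⟩ := h ω hω
  refine ⟨S.image fun v => c + r * n + v, fun i => decide (i = c + r * n + w),
    Finset.card_image_le.trans hS, ?_, fun ω' h1 h2 => hB ω' h1 fun v hv => ?_⟩
  · intro i hi
    obtain ⟨v, -, rfl⟩ := Finset.mem_image.1 hi
    omega
  · by_cases hvn : v < n
    · rw [coinBits, h2 _ (Finset.mem_image_of_mem _ hv)]
      simp [hvn]
    · simp [coinBits, hvn]
      omega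

theorem IsPrefixEvent.mono {c c' : ℕ} {A : Set (ℕ → Bool)} (hA : IsPrefixEvent c A) (h : c ≤ c') :
    IsPrefixEvent c' A :=
  fun ω ω' hω => hA ω ω' fun i hi => hω i (hi.trans_le h)

theorem IsPrefixEvent.inter {c : ℕ} {A B : Set (ℕ → Bool)} (hA : IsPrefixEvent c A)
    (hB : IsPrefixEvent c B) : IsPrefixEvent c (A ∩ B) :=
  fun ω ω' hω h => ⟨hA ω ω' hω h.1, hB ω ω' hω h.2⟩

theorem isPrefixEvent_coinBits {n c r : ℕ} (P : (ℕ → ℕ → Bool) → Prop)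
    (hP : ∀ bits bits', (∀ i < r, bits i = bits' i) → P bits → P bits') :
    IsPrefixEvent (c + r * n) {ω | P (coinBits ω n c)} :=
  fun _ _ hω h => hP _ _ (fun _ hi => coinBits_congr hω hi) h

/-- A cycle of arcs without chords, on distinct vertices below `n`. -/
structure InducedCycle (n k : ℕ) (arcs : List (ℕ × ℕ)) (y : ℕ → ℕ) : Prop where
  lt : ∀ i < k, y i < n
  inj : ∀ i < k, ∀ j < k, y i = y j → i = j
  arc : ∀ i, i + 1 < k → (y (i + 1), y i) ∈ arcs
  closing : (y (k - 1), y 0) ∈ arcs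
  ind : ∀ i < k, ∀ j < k, (y i, y j) ∈ arcs → badPair k (i + 1) (j + 1) = false

section

variable {n : ℕ} {G : SimpleGraph (Fin n)} {arcs : List (ℕ × ℕ)} {k D d : ℕ} {y : ℕ → ℕ}

theorem IsArcs.of_mem_orient (hA : IsArcs G arcs) {t : Entry} (ht : t ∈ orient D arcs) :
    (t.1, t.2.1) ∈ arcs := by
  have key : ∀ s ∈ collect (fun x b => decide (x < b)) id arcs, (s.1, s.2.1) ∈ arcs := by
    intro s hs
    obtain ⟨h1, -, h2⟩ := of_mem_collect hs
    rwa [h2]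
  rcases mem_of_mem_peel ht with h | h
  · exact key _ h
  · obtain ⟨u, v, huv, e⟩ := (hA _).1 (key _ h)
    rw [Prod.mk.injEq] at e
    exact (hA _).2 ⟨v, u, huv.symm, Prod.ext e.2 e.1⟩

/-- A trial succeeds with positive probability, independently of the coins tossed before. -/
theorem le_measure_inter_found (hG : SparseMinors d G) (hA : IsArcs G arcs) (hD : 4 * d ≤ D)
    (hk : 1 ≤ k) (hy : InducedCycle n k arcs y) {c : ℕ} {A : Set (ℕ → Bool)}
    (hAc : IsPrefixEvent c A) :
    2⁻¹ ^ (k * (D + 1) * (k + (k - 1))) * coinMeasure A ≤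
      coinMeasure (A ∩ {ω | Found k D arcs (coinBits ω n c)}) := by
  set K := k * (D + 1) with hK
  let good : ℕ → (ℕ → ℕ → Bool) → Prop := fun m bits =>
    ∀ i < m, ∀ v ∈ critical D arcs k y, bits i v = decide (v = y i)
  let same : ℕ → (ℕ → ℕ → Bool) → Prop := fun j bits =>
    (∀ i < k, cleanColour k D arcs bits (y i) = i + 1) ∧
      rep k D arcs bits (cleanColour k D arcs bits) j (y j) =
        rep k D arcs bits (cleanColour k D arcs bits) j (y 0)
  have hgood : ∀ m, IsPrefixEvent (c + m * n) (A ∩ {ω | good m (coinBits ω n c)}) := fun m =>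
    (hAc.mono (by omega)).inter (isPrefixEvent_coinBits _ fun bits bits' h hb i hi v hv =>
      h i hi ▸ hb i hi v hv)
  have hsame : ∀ j, IsPrefixEvent (c + (k + j) * n) (A ∩ {ω | same j (coinBits ω n c)}) := by
    refine fun j => (hAc.mono (by omega)).inter (isPrefixEvent_coinBits _ fun bits bits' h hb => ?_)
    have e := cleanColour_congr (k := k) (D := D) (arcs := arcs) (bits := bits) (bits' := bits')
      fun i hi => h i (by omega)
    refine ⟨e ▸ hb.1, ?_⟩
    rw [← rep_congr h, ← e]
    exact hb.2
  have h1 : ∀ m ≤ k, 2⁻¹ ^ (K * m) * coinMeasure A ≤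
      coinMeasure (A ∩ {ω | good m (coinBits ω n c)}) := by
    intro m
    induction m with
    | zero => intro _; simp [good]
    | succ m ih =>
      intro hm
      have hstep : 2⁻¹ ^ K * coinMeasure (A ∩ {ω | good m (coinBits ω n c)}) ≤
          coinMeasure (A ∩ {ω | good (m + 1) (coinBits ω n c)}) := by
        refine (hgood m).le_measure_row fun ω hω => ⟨critical D arcs k y, y m,
          card_critical_le D arcs k y, hy.lt m hm, fun ω' h h' => ?_⟩
        have hω' := hgood m ω ω' (fun i hi => (h i hi).symm) hω
        refine ⟨hω'.1, fun i hi v hv => ?_⟩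
        by_cases him : i = m
        · exact him ▸ h' v hv
        · exact hω'.2 i (by omega) v hv
      refine le_trans ?_ hstep
      rw [mul_add, mul_one, pow_add, mul_comm (2⁻¹ ^ (K * m)), mul_assoc]
      gcongr
      exact ih (by omega)
  have h2 : ∀ j ≤ k - 1, 2⁻¹ ^ (K * (k + j)) * coinMeasure A ≤
      coinMeasure (A ∩ {ω | same j (coinBits ω n c)}) := by
    intro j
    induction j with
    | zero =>
      intro _
      refine (h1 k le_rfl).trans (measure_mono fun ω hω => ⟨hω.1, fun i hi => ?_, rfl⟩)
      exact cleanColour_eq hy.inj hy.ind (fun t ht => hA.of_mem_orient ht) hω.2 hi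
    | succ j ih =>
      intro hj
      have hstep : 2⁻¹ ^ K * coinMeasure (A ∩ {ω | same j (coinBits ω n c)}) ≤
          coinMeasure (A ∩ {ω | same (j + 1) (coinBits ω n c)}) := by
        refine (hsame j).le_measure_row fun ω hω => ?_
        obtain ⟨S, w, hS, hw, hrep⟩ := exists_good_marks hG hA hD (hω.2.1 (j + 1) (by omega))
          (hω.2.1 j (by omega)) (hy.arc j (by omega)) hω.2.2
        refine ⟨S, w, hS.trans ?_, hw, fun ω' h h' => ?_⟩
        · exact Nat.le_mul_of_pos_left _ hk
        · have hω' := hsame j ω ω' (fun i hi => (h i hi).symm) hω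
          have hrows : ∀ i < k + j, coinBits ω' n c i = coinBits ω n c i :=
            fun i hi => coinBits_congr h hi
          refine ⟨hω'.1, hω'.2.1, ?_⟩
          rw [cleanColour_congr fun i hi => hrows i (by omega)]
          exact hrep _ hrows h'
      refine le_trans ?_ hstep
      rw [← add_assoc, mul_add K (k + j), mul_one, pow_add, mul_comm (2⁻¹ ^ (K * (k + j))),
        mul_assoc]
      gcongr
      exact ih (by omega)
  refine (h2 (k - 1) le_rfl).trans (measure_mono fun ω hω => ⟨hω.1, _, hy.closing, ?_, ?_, hω.2.2⟩)
  · have := hω.2.1 (k - 1) (by omega)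
    rw [this]
    omega
  · exact hω.2.1 0 hk

/-- The first `i` trials fail. -/
def failures (k D : ℕ) (arcs : List (ℕ × ℕ)) (n i : ℕ) : Set (ℕ → Bool) :=
  {ω | ∀ m < i, ¬ Found k D arcs (coinBits ω n (m * ((k + (k - 1)) * n)))}

theorem isPrefixEvent_failures (k D : ℕ) (arcs : List (ℕ × ℕ)) (n i : ℕ) :
    IsPrefixEvent (i * ((k + (k - 1)) * n)) (failures k D arcs n i) := by
  intro ω ω' h hω m hm hf
  refine hω m hm ((found_congr fun r hr => coinBits_congr (r := k + (k - 1)) (fun q hq => ?_) hr).1 hf)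
  refine (h q (hq.trans_le ?_)).symm
  have := Nat.mul_le_mul_right ((k + (k - 1)) * n) (Nat.succ_le_of_lt hm)
  rwa [Nat.succ_mul] at this

theorem measure_failures_le (hG : SparseMinors d G) (hA : IsArcs G arcs) (hD : 4 * d ≤ D)
    (hk : 1 ≤ k) (hy : InducedCycle n k arcs y) (i : ℕ) :
    coinMeasure (failures k D arcs n i) ≤ (1 - 2⁻¹ ^ (k * (D + 1) * (k + (k - 1)))) ^ i := by
  set p : ℝ≥0∞ := 2⁻¹ ^ (k * (D + 1) * (k + (k - 1))) with hp
  induction i with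
  | zero => simp [prob_le_one]
  | succ i ih =>
    set c := i * ((k + (k - 1)) * n) with hc
    set B : Set (ℕ → Bool) := {ω | Found k D arcs (coinBits ω n c)} with hB
    have hBm : MeasurableSet B := (isPrefixEvent_coinBits (n := n) (c := c) (r := k + (k - 1))
      (fun bits => Found k D arcs bits) fun _ _ h => (found_congr h).1).measurableSet
    have e : failures k D arcs n (i + 1) = failures k D arcs n i \ B := by
      ext ω
      simp only [failures, Set.mem_sdiff, Set.mem_ofPred_eq, hB, hc, Nat.lt_succ_iff_lt_or_eq]
      constructor
      · exact fun h => ⟨fun m hm => h m (.inl hm), h i (.inr rfl)⟩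
      · rintro ⟨h, h'⟩ m (hm | rfl)
        · exact h m hm
        · exact h'
    have hle := le_measure_inter_found hG hA hD hk hy (isPrefixEvent_failures k D arcs n i)
    rw [← hc, ← hB, ← hp] at hle
    have hsum := measure_inter_add_sdiff (μ := coinMeasure) (failures k D arcs n i) hBm
    have hfin : p * coinMeasure (failures k D arcs n i) ≠ ⊤ :=
      ENNReal.mul_ne_top (by simp [hp]) (measure_ne_top _ _)
    rw [e, pow_succ, mul_comm]
    calc coinMeasure (failures k D arcs n i \ B)
        ≤ coinMeasure (failures k D arcs n i) - p * coinMeasure (failures k D arcs n i) := by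
          refine ENNReal.le_sub_of_add_le_left hfin ?_
          rw [← hsum]
          gcongr
          rwa [hsum]
      _ = (1 - p) * coinMeasure (failures k D arcs n i) := by
          rw [ENNReal.sub_mul (fun _ _ => measure_ne_top _ _), one_mul]
      _ ≤ _ := by gcongr

theorem tsum_measure_failures_le (hG : SparseMinors d G) (hA : IsArcs G arcs) (hD : 4 * d ≤ D)
    (hk : 1 ≤ k) (hy : InducedCycle n k arcs y) :
    ∑' i, coinMeasure (failures k D arcs n i) ≤ 2 ^ (k * (D + 1) * (k + (k - 1))) := by
  refine (ENNReal.tsum_le_tsum fun i => measure_failures_le hG hA hD hk hy i).trans ?_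
  rw [ENNReal.tsum_geometric, ENNReal.sub_sub_cancel ENNReal.one_ne_top, ENNReal.inv_pow, inv_inv]
  exact pow_le_one₀ (by simp) (by simp)

end

end CycleSearch

namespace CycleSearch

open RAM
open scoped ENNReal

/-! ### The algorithm -/

variable {n : ℕ} {G : SimpleGraph (Fin n)} {arcs : List (ℕ × ℕ)} {k D d : ℕ}

theorem exists_inducedCycle (hA : IsArcs G arcs) (hk : 3 ≤ k)
    (h : (SimpleGraph.cycleGraph k).IsIndContained G) : ∃ y, InducedCycle n k arcs y := by
  obtain ⟨f⟩ := h
  let y : ℕ → ℕ := fun i => if h : i < k then f ⟨i, h⟩ else 0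
  have hy : ∀ i (hi : i < k), y i = f ⟨i, hi⟩ := fun i hi => by simp [y, hi]
  have hadj : ∀ i (hi : i < k) j (hj : j < k),
      (y i, y j) ∈ arcs ↔ badPair k (i + 1) (j + 1) = false := by
    intro i hi j hj
    rw [hy i hi, hy j hj, hA.mem_iff, f.map_adj_iff, cycleGraph_adj_iff hk]
  refine ⟨y, ⟨fun i hi => hy i hi ▸ (f _).2, fun i hi j hj e => ?_, fun i hi => ?_, ?_,
    fun i hi j hj => (hadj i hi j hj).1⟩⟩
  · rw [hy i hi, hy j hj] at e
    simpa using f.injective (Fin.ext e)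
  · rw [hadj _ hi _ (by omega), badPair, decide_eq_false_iff_not]
    omega
  · rw [hadj _ (by omega) _ (by omega), badPair, decide_eq_false_iff_not]
    omega

/-- Repeat the trials until one of them succeeds. -/
def searchProg (k D : ℕ) : Prog := prepProg ;; .loop (.eq 3 4) (trialProg k D)

/-- A state between two trials. -/
structure Waiting (n : ℕ) (arcs : List (ℕ × ℕ)) (σ : State) : Prop where
  input : Input n arcs σ
  flag : σ.reg 3 = 0

/-- A trial leads to another trial or to a correct output. -/
theorem exists_ends_trialProg_waiting (k D : ℕ) (hk : 3 ≤ k) : ∃ C : ℕ, ∀ (ω : ℕ → Bool) (d n : ℕ)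
    (G : SimpleGraph (Fin n)) (arcs : List (ℕ × ℕ)) (σ : State), SparseMinors d G → IsArcs G arcs →
    ArcList n arcs → 4 * d ≤ D → Waiting n arcs σ →
    Ends ω (trialProg k D) σ (C * (n + arcs.length + 1)) fun σ' => Input n arcs σ' ∧
      σ'.coins = σ.coins + (k + (k - 1)) * n ∧
      ((σ'.reg 3 = 0 ∧ ¬ Found k D arcs (coinBits ω n σ.coins)) ∨
        (σ'.reg 3 = 1 ∧ OutputsInducedCycle G k σ')) := by
  obtain ⟨C, hC⟩ := exists_ends_trialProg k D (by omega)
  refine ⟨C, fun ω d n G arcs σ hG hA hL hD hσ => ?_⟩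
  obtain ⟨w1, w2⟩ := trialProg_writes k D
  refine (hC ω d n arcs σ hσ.input hL hσ.flag hD (hG.sparseList_orient hA)
    fun bits c j => hG.sparseList_stageEdges hA j).mono le_rfl fun σ' a h => ⟨?_, h.1, ?_⟩
  · exact hσ.input.agree a (fun h => by have := w1 _ h; omega) (fun h => by have := w1 _ h; omega)
      (fun h => by have := w1 _ h; omega) (fun h => by have := w2 _ h; omega)
      (fun h => by have := w2 _ h; omega)
  · exact h.2.imp id fun h => ⟨h.1, h.2.2.outputs hG hA hD hk⟩

theorem outputs_of_runs_searchProg (hk : 3 ≤ k) (hG : SparseMinors d G)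
    (hD : 4 * d ≤ D) {adj : Fin n → List (Fin n)} (hadj : IsAdjacencyList G adj) {ω : ℕ → Bool}
    {σ : State} {t : ℕ} (h : Runs ω (searchProg k D) (inputState adj) σ t) :
    OutputsInducedCycle G k σ := by
  obtain ⟨C, hC⟩ := exists_ends_trialProg_waiting k D hk
  cases h with
  | seq hp hl =>
    obtain ⟨σ₁, t₁, hr, -, hin, h3, -⟩ := ends_prepProg ω adj
    obtain ⟨rfl, -⟩ := hp.det hr
    have hstep : ∀ τ τ' s, (Input n (arcsOf adj) τ ∧
        (τ.reg 3 = 0 ∨ τ.reg 3 = 1 ∧ OutputsInducedCycle G k τ)) → (Test.eq 3 4).Holds τ →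
        Runs ω (trialProg k D) τ τ' s → Input n (arcsOf adj) τ' ∧
          (τ'.reg 3 = 0 ∨ τ'.reg 3 = 1 ∧ OutputsInducedCycle G k τ') := by
      rintro τ τ' s ⟨hτ, -⟩ hb hr
      have h3 : τ.reg 3 = 0 := Eq.trans hb hτ.zero
      obtain ⟨τ'', s', hr', -, h1, -, h2⟩ := hC ω d n G _ τ hG hadj.isArcs (arcList_arcsOf adj) hD
        ⟨hτ, h3⟩
      obtain ⟨rfl, -⟩ := hr.det hr'
      exact ⟨h1, h2.imp And.left id⟩
    obtain ⟨⟨hin', h⟩, hne⟩ := hl.loop_invariant _ hstep ⟨hin, .inl h3⟩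
    exact (h.resolve_left fun h => hne (h.trans hin'.zero.symm)).2

/-- The running time in terms of the number of trials. -/
theorem exists_ends_searchProg (k D : ℕ) (hk : 3 ≤ k) : ∃ C : ℕ, ∀ (ω : ℕ → Bool) (d n : ℕ)
    (G : SimpleGraph (Fin n)) (adj : Fin n → List (Fin n)), SparseMinors d G →
    IsAdjacencyList G adj → 4 * d ≤ D → ∀ m,
    Found k D (arcsOf adj) (coinBits ω n (m * ((k + (k - 1)) * n))) →
    Ends ω (searchProg k D) (inputState adj) ((m + 2) * (C * (n + (arcsOf adj).length + 1)))
      fun _ => True := by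
  obtain ⟨C, hC⟩ := exists_ends_trialProg_waiting k D hk
  refine ⟨C + 8, fun ω d n G adj hG hadj hD m hm => ?_⟩
  set arcs := arcsOf adj with harcs
  set T := (C + 8) * (n + arcs.length + 1) with hT
  have hCT : C * (n + arcs.length + 1) + 8 * (n + arcs.length + 1) = T := by rw [hT]; ring
  have hloop : ∀ m i σ, Waiting n arcs σ → σ.coins = i * ((k + (k - 1)) * n) →
      Found k D arcs (coinBits ω n ((i + m) * ((k + (k - 1)) * n))) →
      Ends ω (.loop (.eq 3 4) (trialProg k D)) σ ((m + 1) * T + 1) fun _ => True := by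
    intro m
    induction m with
    | zero =>
      intro i σ hσ hc hf
      obtain ⟨σ', t, hr, ht, h1, -, h2⟩ := hC ω d n G arcs σ hG hadj.isArcs (arcList_arcsOf adj) hD hσ
      rw [hc] at h2
      rcases h2 with h2 | h2
      · exact absurd hf h2.2
      · refine ⟨σ', _, .loopTrue (hσ.flag.trans hσ.input.zero.symm) hr (.loopFalse ?_), ?_, trivial⟩
        · change ¬ σ'.reg 3 = σ'.reg 4
          rw [h2.1, h1.zero]
          exact one_ne_zero
        · rw [zero_add, one_mul]
          omega
    | succ m ih =>
      intro i σ hσ hc hf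
      obtain ⟨σ', t, hr, ht, h1, h1', h2⟩ :=
        hC ω d n G arcs σ hG hadj.isArcs (arcList_arcsOf adj) hD hσ
      have e : (m + 1 + 1) * T = (m + 1) * T + T := by ring
      rcases h2 with h2 | h2
      · obtain ⟨σ'', t', hr', ht', -⟩ := ih (i + 1) σ' ⟨h1, h2.1⟩ (by rw [h1', hc]; ring)
          (by rwa [show i + 1 + m = i + (m + 1) by omega])
        exact ⟨σ'', _, .loopTrue (hσ.flag.trans hσ.input.zero.symm) hr hr', by omega, trivial⟩
      · refine ⟨σ', _, .loopTrue (hσ.flag.trans hσ.input.zero.symm) hr (.loopFalse ?_), ?_, trivial⟩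
        · change ¬ σ'.reg 3 = σ'.reg 4
          rw [h2.1, h1.zero]
          exact one_ne_zero
        · have := Nat.zero_le ((m + 1) * T)
          omega
  refine ((ends_prepProg ω adj).seq fun σ' _ h => hloop m 0 σ' ⟨h.1, h.2.1⟩ (by rw [h.2.2, zero_mul])
    (by rwa [zero_add])).mono ?_ fun _ _ h => h
  have e : (m + 2) * T = (m + 1) * T + T := by ring
  rw [← harcs]
  omega

/-- The expected running time is linear in the size of the input. -/
theorem exists_expectedTime_searchProg_le (k D : ℕ) (hk : 3 ≤ k) : ∃ C : ℕ, ∀ (d n : ℕ)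
    (G : SimpleGraph (Fin n)) (adj : Fin n → List (Fin n)), SparseMinors d G →
    IsAdjacencyList G adj → 4 * d ≤ D → (SimpleGraph.cycleGraph k).IsIndContained G →
    expectedTime (searchProg k D) (inputState adj) ≤
      (C * (n + (arcsOf adj).length + 1) : ℕ) := by
  obtain ⟨C, hC⟩ := exists_ends_searchProg k D hk
  set K := k * (D + 1) * (k + (k - 1)) with hK
  refine ⟨(C + 1) * (2 ^ K + 1), fun d n G adj hG hadj hD hcyc => ?_⟩
  set arcs := arcsOf adj with harcs
  set T := (C + 1) * (n + arcs.length + 1) with hT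
  obtain ⟨y, hy⟩ := exists_inducedCycle hadj.isArcs hk hcyc
  have hfm : ∀ i, MeasurableSet (failures k D arcs n i) := fun i =>
    (isPrefixEvent_failures k D arcs n i).measurableSet
  have hpt : ∀ ω, (runTime (searchProg k D) (inputState adj) ω : ℝ≥0∞) ≤
      T + ∑' i, (failures k D arcs n i).indicator (fun _ => (T : ℝ≥0∞)) ω := by
    intro ω
    by_cases hex : ∃ m, Found k D arcs (coinBits ω n (m * ((k + (k - 1)) * n)))
    · classical
      set m := Nat.find hex with hm
      obtain ⟨σ, t, hr, ht, -⟩ := hC ω d n G adj hG hadj hD m (Nat.find_spec hex)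
      have htT : t ≤ (m + 2) * T :=
        ht.trans (Nat.mul_le_mul_left _ (Nat.mul_le_mul_right _ (Nat.le_succ C)))
      rw [hr.runTime_eq]
      have hfail : ∀ i ∈ Finset.range (m + 1),
          (failures k D arcs n i).indicator (fun _ => (T : ℝ≥0∞)) ω = T := by
        intro i hi
        have hmem : ω ∈ failures k D arcs n i := fun j hj => Nat.find_min hex (by
          have := Finset.mem_range.1 hi
          omega)
        exact Set.indicator_of_mem hmem _
      calc ((t : ℕ∞) : ℝ≥0∞) = (t : ℝ≥0∞) := by simp
        _ ≤ ((m + 2) * T : ℕ) := by exact_mod_cast htT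
        _ = T + ∑ i ∈ Finset.range (m + 1),
            (failures k D arcs n i).indicator (fun _ => (T : ℝ≥0∞)) ω := by
          rw [Finset.sum_congr rfl hfail, Finset.sum_const, Finset.card_range, nsmul_eq_mul]
          push_cast
          ring
        _ ≤ _ := by
          gcongr
          exact ENNReal.sum_le_tsum _
    · have hall : ∀ i, (failures k D arcs n i).indicator (fun _ => (T : ℝ≥0∞)) ω = T := by
        intro i
        have hmem : ω ∈ failures k D arcs n i := fun m _ h => hex ⟨m, h⟩
        exact Set.indicator_of_mem hmem _
      have hT0 : (T : ℝ≥0∞) ≠ 0 := by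
        rw [hT]
        positivity
      simp only [hall]
      rw [ENNReal.tsum_const_eq_top_of_ne_zero hT0]
      simp
  calc expectedTime (searchProg k D) (inputState adj)
      ≤ ∫⁻ ω, (T + ∑' i, (failures k D arcs n i).indicator (fun _ => (T : ℝ≥0∞)) ω)
          ∂coinMeasure := lintegral_mono hpt
    _ = T + ∑' i, T * coinMeasure (failures k D arcs n i) := by
      rw [lintegral_add_left measurable_const, lintegral_const, measure_univ, mul_one,
        lintegral_tsum fun i => (measurable_const.indicator (hfm i)).aemeasurable]
      simp only [lintegral_indicator_const (hfm _)]
    _ ≤ T + T * 2 ^ K := by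
      rw [ENNReal.tsum_mul_left]
      gcongr
      exact tsum_measure_failures_le hG hadj.isArcs hD (by omega) hy
    _ = _ := by
      rw [hT]
      push_cast
      ring

end CycleSearch

open CycleSearch in
theorem mainTheorem6 (F : GraphFamily) (hF : F.MinorClosed) (hF' : F.Nontrivial)
    (k : ℕ) (hk : 3 ≤ k) :
    ∃ (P : RAM.Prog) (C : ℕ),
      ∀ (n : ℕ) (G : SimpleGraph (Fin n)), G ∈ F n →
        (SimpleGraph.cycleGraph k).IsIndContained G →
        ∀ adj : Fin n → List (Fin n), IsAdjacencyList G adj →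
          (∀ᵐ ω ∂(RAM.coinMeasure), ∃ σ t, RAM.Runs ω P (inputState adj) σ t) ∧
          (∀ ω σ t, RAM.Runs ω P (inputState adj) σ t → OutputsInducedCycle G k σ) ∧
          RAM.expectedTime P (inputState adj) ≤ (C : ENNReal) * (n : ENNReal) := by
  obtain ⟨d, hd⟩ := GraphFamily.exists_edge_bound hF hF'
  obtain ⟨C, hC⟩ := exists_expectedTime_searchProg_le k (4 * d) hk
  refine ⟨searchProg k (4 * d), C * (2 * d + 2), fun n G hGF hcyc adj hadj => ?_⟩
  have hG : SparseMinors d G := hd n G hGF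
  have hn : 1 ≤ n := by
    obtain ⟨f⟩ := hcyc
    have := (f ⟨0, by omega⟩).2
    omega
  have htime : RAM.expectedTime (searchProg k (4 * d)) (inputState adj) ≤
      ((C * (2 * d + 2) : ℕ) : ENNReal) * n := by
    refine (hC d n G adj hG hadj le_rfl hcyc).trans ?_
    have h1 := hadj.length_arcsOf
    have h2 := hG.length_le
    have h3 : n + (arcsOf adj).length + 1 ≤ (2 * d + 2) * n := by nlinarith
    have h4 := Nat.mul_le_mul_left C h3
    rw [← mul_assoc] at h4
    exact_mod_cast h4
  refine ⟨?_, fun ω σ t h => outputs_of_runs_searchProg hk hG le_rfl hadj h, htime⟩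
  have hfin : RAM.expectedTime (searchProg k (4 * d)) (inputState adj) ≠ ⊤ :=
    (htime.trans_lt (ENNReal.mul_lt_top (ENNReal.natCast_lt_top _) (ENNReal.natCast_lt_top _))).ne
  have hmeas : Measurable fun ω =>
      (RAM.runTime (searchProg k (4 * d)) (inputState adj) ω : ENNReal) :=
    (measurable_of_countable _).comp (RAM.measurable_runTime _ _)
  filter_upwards [ae_lt_top hmeas hfin] with ω hω
  by_contra hno
  have htop : RAM.runTime (searchProg k (4 * d)) (inputState adj) ω = ⊤ :=
    iInf₂_eq_top.2 fun t ht => absurd (by obtain ⟨σ, h⟩ := ht; exact ⟨σ, t, h⟩) hno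
  rw [htop] at hω
  simp at hω
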